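/- Let $n,k,l$ be integers with $0\le l<k\le n-1$, let $\theta\in(0,\pi/2)$ and $p\ge 1$. Let $E_{n+1}$ be the last coordinate vector of $\mathbb{R}^{n+1}$, $e=-E_{n+1}$, and let $$\mathcal{C}_\theta=\{\xi\in\mathbb{R}^{n+1}:\ \xi_{n+1}\ge 0,\ |\xi-\cos\theta\, e|=1\}$$ be the (closed) spherical cap with its standard metric $\sigma$, with Levi-Civita connection $\nabla$, and let $\mu$ be the unit outward conormal of $\partial\mathcal{C}_\theta$ in $\mathcal{C}_\theta$. For $u\in C^2(\mathcal{C}_\theta)$ put $W[u]=\nabla^2u+u\,\sigma$, and let $\sigma_m(W[u])$ denote the $m$-th elementary symmetric function of the eigenvalues of $W[u]$ with respect to $\sigma$ ($\sigma_0=1$). Let $f$ be a positive smooth function on $\mathcal{C}_\theta$ such that $$\nabla^2 f^{-\frac{1}{p+k-l-1}}+f^{-\frac{1}{p+k-l-1}}\,\sigma\ \ge\ 0\quad\text{in }\mathcal{C}_\theta,\qquad \nabla_\mu f+\cot\theta\,(p+k-l-1)\,f\ \ge\ 0\quad\text{on }\partial\mathcal{C}_\theta .$$ Let $h\in C^4(\mathcal{C}_\theta)$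 be a positive function that is admissible, i.e. $\sigma_i(W[h])>0$ on $\mathcal{C}_\theta$ for all $1\le i\le k$, and that solves $$\frac{\sigma_k(W[h])}{\sigma_l(W[h])}=f\,h^{p-1}\quad\text{in }\mathcal{C}_\theta,\qquad \nabla_\mu h=\cot\theta\, h\quad\text{on }\partial\mathcal{C}_\theta .$$ If $W[h]$ is positive semi-definite on $\mathcal{C}_\theta$, then $W[h]$ is positive definite on $\mathcal{C}_\theta$, i.e. $h$ is strictly convex. -/

import Mathlib

open scoped ContDiff RealInnerProductSpace

noncomputable section

namespace Capillary

/-- Euclidean space of dimension `n + 1`. -/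
abbrev Amb (n : ℕ) : Type := EuclideanSpace ℝ (Fin (n + 1))

/-- The unit outward normal `e = -E_{n+1}` of the half-space `{x | 0 ≤ x_{n+1}}`. -/
def e (n : ℕ) : Amb n := -EuclideanSpace.single (Fin.last n) (1 : ℝ)

/-- The centre `cos θ e` of the spherical cap. -/
def center (n : ℕ) (θ : ℝ) : Amb n := Real.cos θ • e n

/-- The (closed) spherical cap `C_θ`. -/
def cap (n : ℕ) (θ : ℝ) : Set (Amb n) :=
  {ξ | 0 ≤ ξ (Fin.last n) ∧ ‖ξ - center n θ‖ = 1}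

/-- The boundary `∂C_θ`. -/
def capBoundary (n : ℕ) (θ : ℝ) : Set (Amb n) :=
  {ξ | ξ ∈ cap n θ ∧ ξ (Fin.last n) = 0}

/-- The tangent space at `ξ` of the unit sphere carrying the cap, as a subspace of the ambient
space; the metric `σ` is the restriction of the Euclidean inner product to it. -/
abbrev tangent {n : ℕ} (θ : ℝ) (ξ : Amb n) : Submodule ℝ (Amb n) :=
  (ℝ ∙ (ξ - center n θ))ᗮ

/-- The unit outward conormal `μ` of `∂C_θ` in `C_θ`. -/
def conormal {n : ℕ} (θ : ℝ) (ξ : Amb n) : Amb n :=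
  Real.cot θ • ξ + Real.sin θ • e n

/-- The defining properties of the outward unit conormal: it is tangent to the cap, orthogonal to
every tangent vector of the boundary, of unit length, and points out of the half-space. -/
theorem conormal_spec {n : ℕ} {θ : ℝ} (h0 : 0 < Real.sin θ) {ξ : Amb n}
    (hξ : ξ ∈ capBoundary n θ) :
    conormal θ ξ ∈ tangent θ ξ ∧
    (∀ w ∈ tangent θ ξ, ⟪w, e n⟫ = 0 → ⟪w, conormal θ ξ⟫ = 0) ∧
    ‖conormal θ ξ‖ = 1 ∧ 0 < ⟪conormal θ ξ, e n⟫ := by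
  obtain ⟨⟨-, h1⟩, h2⟩ := hξ
  have hxe : ⟪ξ, e n⟫ = 0 := by simp [e, EuclideanSpace.inner_single_right, h2]
  have hex : ⟪e n, ξ⟫ = 0 := by rw [real_inner_comm, hxe]
  have hee : ⟪e n, e n⟫ = (1 : ℝ) := by simp [e]
  have hsc := Real.sin_sq_add_cos_sq θ
  have hxx : ⟪ξ, ξ⟫ = Real.sin θ ^ 2 := by
    have h3 : ⟪ξ - center n θ, ξ - center n θ⟫ = (1 : ℝ) := by
      rw [real_inner_self_eq_norm_sq, h1]; norm_num
    simp only [center, inner_sub_left, inner_sub_right, inner_smul_left, inner_smul_right,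
      hxe, hex, hee, conj_trivial] at h3
    nlinarith
  have hcot : Real.cot θ * Real.sin θ = Real.cos θ := by
    rw [Real.cot_eq_cos_div_sin]; field_simp
  refine ⟨?_, ?_, ?_, ?_⟩
  · rw [Submodule.mem_orthogonal_singleton_iff_inner_right]
    simp only [center, conormal, inner_sub_left, inner_add_right, inner_smul_left,
      inner_smul_right, hxe, hex, hee, hxx, conj_trivial]
    linear_combination Real.sin θ * hcot
  · intro w hw hwe
    rw [Submodule.mem_orthogonal_singleton_iff_inner_left] at hw
    simp only [center, inner_sub_right, inner_smul_right, hwe] at hw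
    simp only [conormal, inner_add_right, inner_smul_right, hwe]
    linear_combination Real.cot θ * hw
  · have h4 : ‖conormal θ ξ‖ ^ 2 = 1 := by
      rw [← real_inner_self_eq_norm_sq]
      simp only [conormal, inner_add_left, inner_add_right, inner_smul_left,
        inner_smul_right, hxe, hex, hee, hxx, conj_trivial]
      linear_combination (Real.cot θ * Real.sin θ + Real.cos θ) * hcot + hsc
    exact (sq_eq_sq₀ (norm_nonneg _) zero_le_one).mp (by simpa using h4)
  · simp only [conormal, inner_add_left, inner_smul_left, hxe, hee, conj_trivial]
    simpa using h0

/-- Radial projection, from the centre, to the unit sphere carrying the cap. -/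
def radialProj {n : ℕ} (θ : ℝ) (x : Amb n) : Amb n :=
  center n θ + ‖x - center n θ‖⁻¹ • (x - center n θ)

/-- The solid cone over the cap, with vertex (excluded) at the centre. -/
def cone (n : ℕ) (θ : ℝ) : Set (Amb n) := {x | radialProj θ x ∈ cap n θ}

/-- Extension of a function on the cap to the cone, constant along rays from the centre.
On the cone it only depends on the values of `u` on the cap. -/
def ext {n : ℕ} (θ : ℝ) (u : Amb n → ℝ) (x : Amb n) : ℝ := u (radialProj θ x)

/-- The vector field on the cone which on the cap is the spherical gradient `∇u`
(the Euclidean gradient of the radially constant extension has no radial component).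
At boundary points of the cap the derivative is the one within the cone. -/
def grad {n : ℕ} (θ : ℝ) (u : Amb n → ℝ) (x : Amb n) : Amb n :=
  gradientWithin (ext θ u) (cone n θ) x

/-- The derivative `∇_v u` at `ξ` in the direction of a tangent vector `v`. -/
def dirDeriv {n : ℕ} (θ : ℝ) (u : Amb n → ℝ) (ξ v : Amb n) : ℝ := ⟪grad θ u ξ, v⟫

/-- The covariant Hessian `∇²u` at `ξ` as an endomorphism `v ↦ ∇_v ∇u` of the tangent space.
The Levi-Civita connection of the sphere is the tangential part of the Euclidean derivative. -/
def hess {n : ℕ} (θ : ℝ) (u : Amb n → ℝ) (ξ : Amb n) : tangent θ ξ →ₗ[ℝ] tangent θ ξ :=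
  ((tangent θ ξ).orthogonalProjectionOnto ∘L
    fderivWithin ℝ (grad θ u) (cone n θ) ξ ∘L (tangent θ ξ).subtypeL : _ →L[ℝ] _)

/-- `W[u] = ∇²u + u σ` at `ξ`, as an endomorphism of the tangent space. -/
def W {n : ℕ} (θ : ℝ) (u : Amb n → ℝ) (ξ : Amb n) : tangent θ ξ →ₗ[ℝ] tangent θ ξ :=
  hess θ u ξ + u ξ • LinearMap.id

/-- `σ_k(A)`: the `k`-th elementary symmetric function of the eigenvalues of `A`, counted with
multiplicity (the endomorphisms to which this is applied are self-adjoint). -/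
def sigma {V : Type*} [AddCommGroup V] [Module ℝ V] [Module.Finite ℝ V]
    (k : ℕ) (A : V →ₗ[ℝ] V) : ℝ :=
  A.charpoly.roots.esymm k

/-- `u` is `k`-convex (admissible): the eigenvalues of `W[u]` lie in the Gårding cone `Γ_k`
at every point of the cap. -/
def KConvex (n : ℕ) (θ : ℝ) (k : ℕ) (u : Amb n → ℝ) : Prop :=
  ∀ ξ ∈ cap n θ, ∀ i, 1 ≤ i → i ≤ k → 0 < sigma i (W θ u ξ)

/-- `u` is convex: `W[u]` is positive semi-definite at every point of the cap. -/
def IsConvex (n : ℕ) (θ : ℝ) (u : Amb n → ℝ) : Prop :=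
  ∀ ξ ∈ cap n θ, ∀ v : tangent θ ξ, 0 ≤ ⟪W θ u ξ v, v⟫

/-- `u` is strictly convex: `W[u]` is positive definite at every point of the cap. -/
def IsStrictlyConvex (n : ℕ) (θ : ℝ) (u : Amb n → ℝ) : Prop :=
  ∀ ξ ∈ cap n θ, ∀ v : tangent θ ξ, v ≠ 0 → 0 < ⟪W θ u ξ v, v⟫

/-- `h` solves the Hessian quotient equation `σ_k(W)/σ_l(W) = f h^{p-1}` in `C_θ` with the
Robin boundary condition `∇_μ h = cot θ h` on `∂C_θ`. -/
structure Solves (n : ℕ) (θ : ℝ) (k l : ℕ) (p : ℝ) (f h : Amb n → ℝ) : Prop where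
  eqn : ∀ ξ ∈ cap n θ, sigma k (W θ h ξ) / sigma l (W θ h ξ) = f ξ * h ξ ^ (p - 1)
  robin : ∀ ξ ∈ capBoundary n θ, dirDeriv θ h ξ (conormal θ ξ) = Real.cot θ * h ξ

end Capillary

end

/-! Everything is carried to the cone over the cap, with vertex at the centre of the sphere. If H is
the extension of h homogeneous of degree one, its Euclidean Hessian annihilates the radial direction
and equals W[h] on tangent vectors at points of the cap, so covariant derivatives become flat
derivatives that commute. Let g be the degree one extension of f^(-1/(p+k-l-1)) and a the axis of
the cone. The hypotheses say that D²H and D²g are nonnegative, that ∂_a H = 0 and ∂_a g ≥ 0 on the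
lateral boundary, and that log(σ_k/σ_l)(D²H) = -(p+k-l-1) log g + (p-1) log H. The structure `IsSol`
records this.

Interior: a strong maximum principle is proved for the smallest eigenvalue of D²H transverse to the
radial direction. That eigenvalue need not be smooth, so it is tested by smooth functions Ω > 0
touching it from below. Varying the base point and the test vector together yields conditions on D³H
and D⁴H. The best test vector produces exactly the term 2 Σ f_i B_ij²/x_j with which inverse
concavity of (σ_k/σ_l)^(1/(k-l)) controls the second derivative of the equation. Convexity of g and
p ≥ 1 fix the sign of the rest, and only multiples of Ω and of its gradient remain
(`IsSol.touching`). A barrier on a ball then gives a Hopf lemma (`IsSol.hopf`,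
`IsSol.thd_neg_of_hopf`): at a degenerate point x₀ on the sphere bounding a ball of nondegenerate
points, D³H(ν,u,u) < 0 for outward ν and null u. At an interior point D²H(u,u) is then at a minimum
and its derivative vanishes, a contradiction. A starting nondegenerate point is a minimum of h,
which the Robin condition keeps away from the boundary.

Boundary: interior balls touch the lateral boundary, so the Hopf lemma applies there with ν
conormal. Differentiating the Neumann condition along boundary circles separates ν from the
directions τ tangent to the boundary, and makes D³H(ν,τ,τ) nonnegative when τ is null. If ν is null,
the equation differentiated along ν, Euler's identity and the condition on g exclude D³H(ν,ν,ν) < 0.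
Both cases contradict the Hopf lemma.

Inverse concavity itself is elementary: concavity of the harmonic mean gives it for σ_{j+1}/σ_j by
induction, and the general quotient follows by telescoping. -/

noncomputable section

namespace CapillaryRank

open Polynomial Finset

/-! ### Elementary symmetric functions -/

section ElementarySymmetric

variable {ι : Type*}

/-- The `k`-th elementary symmetric function of the numbers `x a`, `a ∈ s`; it vanishes for
negative `k`. -/
def es (s : Finset ι) (x : ι → ℝ) (k : ℤ) : ℝ :=
  if k < 0 then 0 else (∏ a ∈ s, (1 + C (x a) * X : ℝ[X])).coeff k.toNat

theorem es_of_neg (s : Finset ι) (x : ι → ℝ) {k : ℤ} (hk : k < 0) : es s x k = 0 := if_pos hk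

theorem es_natCast (s : Finset ι) (x : ι → ℝ) (k : ℕ) :
    es s x k = (∏ a ∈ s, (1 + C (x a) * X : ℝ[X])).coeff k := by
  simp [es]

variable [DecidableEq ι]

theorem es_insert {s : Finset ι} {a : ι} (ha : a ∉ s) (x : ι → ℝ) (k : ℤ) :
    es (insert a s) x k = es s x k + x a * es s x (k - 1) := by
  rcases lt_or_ge k 0 with hk | hk
  · simp [es_of_neg, hk, show k - 1 < 0 by omega]
  lift k to ℕ using hk
  rcases k with _ | k
  · rw [es_natCast, es_natCast, prod_insert ha, es_of_neg _ _ (by norm_num)]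
    simp [mul_coeff_zero]
  · rw [show (((k + 1 : ℕ) : ℤ) - 1) = (k : ℤ) by push_cast; ring, es_natCast, es_natCast,
      es_natCast, prod_insert ha, add_mul, one_mul, coeff_add, mul_assoc, coeff_C_mul,
      coeff_X_mul]

theorem es_erase {s : Finset ι} {a : ι} (ha : a ∈ s) (x : ι → ℝ) (k : ℤ) :
    es s x k = es (s.erase a) x k + x a * es (s.erase a) x (k - 1) := by
  conv_lhs => rw [← insert_erase ha]
  exact es_insert (notMem_erase a s) x k

theorem es_empty (x : ι → ℝ) (k : ℤ) : es ∅ x k = if k = 0 then 1 else 0 := by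
  rcases lt_or_ge k 0 with hk | hk
  · rw [es_of_neg _ _ hk, if_neg hk.ne]
  lift k to ℕ using hk
  rw [es_natCast]
  simp [coeff_one]

theorem es_zero (s : Finset ι) (x : ι → ℝ) : es s x 0 = 1 := by
  induction s using Finset.induction_on with
  | empty => simp [es_empty]
  | insert a s ha ih => rw [es_insert ha, ih, es_of_neg _ _ (by norm_num)]; simp

theorem es_nonneg (s : Finset ι) {x : ι → ℝ} (hx : ∀ a, 0 ≤ x a) (k : ℤ) : 0 ≤ es s x k := by
  induction s using Finset.induction_on generalizing k with
  | empty => rw [es_empty]; split_ifs <;> norm_num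
  | insert a s ha ih =>
    rw [es_insert ha]
    exact add_nonneg (ih k) (mul_nonneg (hx a) (ih _))

/-- Euler's identity for the elementary symmetric functions. -/
theorem sum_mul_es_erase (s : Finset ι) (x : ι → ℝ) (k : ℤ) :
    ∑ a ∈ s, x a * es (s.erase a) x (k - 1) = k * es s x k := by
  induction s using Finset.induction_on generalizing k with
  | empty => rw [es_empty]; split_ifs with h <;> simp [h]
  | insert a s ha ih =>
    have h1 : ∀ b ∈ s, x b * es ((insert a s).erase b) x (k - 1)
        = x b * es (s.erase b) x (k - 1) + x a * (x b * es (s.erase b) x (k - 1 - 1)) := by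
      intro b hb
      have hab : a ≠ b := fun h => ha (h ▸ hb)
      rw [erase_insert_of_ne hab, es_insert (fun h => ha (mem_of_mem_erase h))]
      ring
    rw [sum_insert ha, erase_insert ha, sum_congr rfl h1, sum_add_distrib, ← mul_sum, ih, ih,
      es_insert ha]
    push_cast
    ring

/-- For nonnegative numbers, positivity of the `j`-th function means that at least `j` of them are
positive. -/
theorem es_pos_of_le (s : Finset ι) {x : ι → ℝ} (hx : ∀ a, 0 ≤ x a) {i j : ℤ} (hi : 0 ≤ i)
    (hij : i ≤ j) (hj : 0 < es s x j) : 0 < es s x i := by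
  induction s using Finset.induction_on generalizing i j with
  | empty =>
    rw [es_empty] at hj ⊢
    split_ifs at hj with h
    · rw [if_pos (by omega)]; norm_num
    · exact absurd hj (lt_irrefl _)
  | insert a s ha ih =>
    rw [es_insert ha] at hj ⊢
    have hn := es_nonneg s hx
    rcases (hn j).lt_or_eq with h | h
    · exact add_pos_of_pos_of_nonneg (ih hi hij h) (mul_nonneg (hx a) (hn _))
    · rw [← h, zero_add] at hj
      rcases hi.lt_or_eq with h0 | h0
      · refine add_pos_of_nonneg_of_pos (hn _) (mul_pos (pos_of_mul_pos_left hj (hn _)) ?_)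
        exact ih (by omega) (by omega) (pos_of_mul_pos_right hj (hx a))
      · rw [← h0, es_zero, es_of_neg _ _ (by norm_num)]; norm_num

theorem es_erase_pos {s : Finset ι} {x : ι → ℝ} (hx : ∀ a, 0 ≤ x a) {a : ι} (ha : a ∈ s) {j : ℤ}
    (hj1 : 1 ≤ j) (hj : 0 < es s x j) : 0 < es (s.erase a) x (j - 1) := by
  rw [es_erase ha] at hj
  have hn := es_nonneg (s.erase a) hx
  rcases (hn j).lt_or_eq with h | h
  · exact es_pos_of_le _ hx (by omega) (by omega) h
  · rw [← h, zero_add] at hj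
    exact pos_of_mul_pos_right hj (hx a)

/-- Newton's inequalities without the optimal constants. -/
theorem es_mul_es_le (s : Finset ι) {x : ι → ℝ} (hx : ∀ a, 0 ≤ x a) {i j : ℤ} (hij : i ≤ j) :
    es s x (i - 1) * es s x (j + 1) ≤ es s x i * es s x j := by
  induction s using Finset.induction_on generalizing i j with
  | empty =>
    simp only [es_empty]
    split_ifs <;> first | omega | norm_num
  | insert a s ha ih =>
    simp only [es_insert ha]
    have h1 := ih hij
    have h2 := ih (i := i - 1) (j := j - 1) (by omega)
    -- Coefficient of `x a` once both products are expanded: the two mixed terms `es (i - 1) * es j`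
    -- cancel and this inequality is left. It follows by shifting the indices one step at a time.
    have h3 : es s x (i - 1 - 1) * es s x (j + 1) ≤ es s x i * es s x (j - 1) := by
      rcases hij.lt_or_eq with h | rfl
      · have h4 := ih (i := i - 1) (j := j) (by omega)
        have h5 := ih (i := i) (j := j - 1) (by omega)
        rw [sub_add_cancel] at h5
        linarith
      · have h4 := ih (i := i - 1) (j := i) (by omega)
        linarith
    rw [sub_add_cancel] at h2
    rw [add_sub_cancel_right]
    nlinarith [mul_nonneg (hx a) (sub_nonneg.2 h3),
      mul_nonneg (mul_nonneg (hx a) (hx a)) (sub_nonneg.2 h2)]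

/-- Strictness is inherited from `s` when its `j`-th function is positive. Otherwise the functions
of `s` of order `j` and `j + 1` vanish, so the left side is zero while the right side is positive.
-/
theorem es_mul_es_lt (s : Finset ι) {x : ι → ℝ} (hx : ∀ a, 0 ≤ x a) {i j : ℤ} (hi : 0 ≤ i)
    (hij : i ≤ j) (hj : 0 < es s x j) :
    es s x (i - 1) * es s x (j + 1) < es s x i * es s x j := by
  induction s using Finset.induction_on generalizing i j with
  | empty =>
    simp only [es_empty] at hj ⊢
    split_ifs at hj ⊢ <;> first | omega | exact absurd hj (lt_irrefl _) | norm_num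
  | insert a s ha ih =>
    have hn := es_nonneg s hx
    have h1 := es_mul_es_le s hx hij
    have h2 := es_mul_es_le s hx (i := i - 1) (j := j - 1) (by omega)
    have h3 : es s x (i - 1 - 1) * es s x (j + 1) ≤ es s x i * es s x (j - 1) := by
      rcases hij.lt_or_eq with h | rfl
      · have h4 := es_mul_es_le s hx (i := i - 1) (j := j) (by omega)
        have h5 := es_mul_es_le s hx (i := i) (j := j - 1) (by omega)
        rw [sub_add_cancel] at h5
        linarith
      · have h4 := es_mul_es_le s hx (i := i - 1) (j := i) (by omega)
        linarith
    rw [sub_add_cancel] at h2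
    have hxa := hx a
    rcases (hn j).lt_or_eq with h | h
    · simp only [es_insert ha]
      have h6 := ih hi hij h
      rw [add_sub_cancel_right]
      nlinarith [mul_nonneg (hx a) (sub_nonneg.2 h3),
        mul_nonneg (mul_nonneg (hx a) (hx a)) (sub_nonneg.2 h2)]
    · rw [es_insert ha, ← h, zero_add] at hj
      have hxp : 0 < x a := pos_of_mul_pos_left hj (hn _)
      have hjp : 0 < es s x (j - 1) := pos_of_mul_pos_right hj hxa
      have hj0 : 0 ≤ j - 1 := by
        by_contra hlt
        rw [es_of_neg _ _ (by omega)] at hjp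
        exact lt_irrefl _ hjp
      have hj1 : es s x (j + 1) = 0 := by
        by_contra hne
        have := es_pos_of_le s hx (i := j) (by omega) (by omega)
          (lt_of_le_of_ne (hn (j + 1)) (Ne.symm hne))
        rw [← h] at this
        exact lt_irrefl _ this
      simp only [es_insert ha]
      rw [add_sub_cancel_right, ← h, hj1]
      have : 0 < es s x i + x a * es s x (i - 1) := by
        rcases hi.lt_or_eq with h0 | h0
        · exact add_pos_of_nonneg_of_pos (hn _)
            (mul_pos hxp (es_pos_of_le s hx (by omega) (by omega) hjp))
        · rw [← h0, es_zero, es_of_neg _ _ (by norm_num)]; norm_num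
      simp only [mul_zero, add_zero, zero_add]
      exact mul_pos this (mul_pos hxp hjp)

/-- The harmonic mean is concave (midpoint form). -/
theorem inv_sum_inv_midpoint {κ : Type*} (s : Finset κ) {u v w : κ → ℝ} (hs : s.Nonempty)
    (hu : ∀ a ∈ s, 0 < u a) (hv : ∀ a ∈ s, 0 < v a) (hw : ∀ a ∈ s, u a + v a ≤ 2 * w a) :
    (∑ a ∈ s, (u a)⁻¹)⁻¹ + (∑ a ∈ s, (v a)⁻¹)⁻¹ ≤ 2 * (∑ a ∈ s, (w a)⁻¹)⁻¹ := by
  have hU : 0 < ∑ a ∈ s, (u a)⁻¹ := sum_pos (fun a ha => inv_pos.2 (hu a ha)) hs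
  have hV : 0 < ∑ a ∈ s, (v a)⁻¹ := sum_pos (fun a ha => inv_pos.2 (hv a ha)) hs
  have hwp : ∀ a ∈ s, 0 < w a := fun a ha => by linarith [hu a ha, hv a ha, hw a ha]
  have hW : 0 < ∑ a ∈ s, (w a)⁻¹ := sum_pos (fun a ha => inv_pos.2 (hwp a ha)) hs
  set p := (∑ a ∈ s, (u a)⁻¹)⁻¹ with hp
  set q := (∑ a ∈ s, (v a)⁻¹)⁻¹ with hq
  have hp0 : 0 < p := inv_pos.2 hU
  have hq0 : 0 < q := inv_pos.2 hV
  -- The Cauchy–Schwarz bound (p+q)²/(u+v) ≤ p²/u + q²/v. The weights are the reciprocals `p`, `q`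
  -- of the two sums, so that summing over `a` gives exactly `2 / (p + q)`.
  have key : ∀ a ∈ s, (w a)⁻¹ ≤ 2 / (p + q) ^ 2 * (p ^ 2 * (u a)⁻¹ + q ^ 2 * (v a)⁻¹) := by
    intro a ha
    have h1 := hu a ha
    have h2 := hv a ha
    have h3 : (w a)⁻¹ ≤ 2 / (u a + v a) := by
      rw [inv_eq_one_div, div_le_div_iff₀ (hwp a ha) (by linarith)]
      linarith [hw a ha]
    refine h3.trans ?_
    rw [show 2 / (p + q) ^ 2 * (p ^ 2 * (u a)⁻¹ + q ^ 2 * (v a)⁻¹)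
      = 2 * (p ^ 2 * v a + q ^ 2 * u a) / ((p + q) ^ 2 * (u a * v a)) by field_simp,
      div_le_div_iff₀ (by positivity) (by positivity)]
    nlinarith [sq_nonneg (p * v a - q * u a)]
  have hsum : ∑ a ∈ s, (w a)⁻¹ ≤ 2 / (p + q) := by
    refine (sum_le_sum key).trans (le_of_eq ?_)
    rw [← mul_sum, sum_add_distrib, ← mul_sum, ← mul_sum,
      show ∑ a ∈ s, (u a)⁻¹ = p⁻¹ by rw [hp, inv_inv],
      show ∑ a ∈ s, (v a)⁻¹ = q⁻¹ by rw [hq, inv_inv]]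
    field_simp
  have h4 : (2 / (p + q))⁻¹ ≤ (∑ a ∈ s, (w a)⁻¹)⁻¹ := inv_anti₀ hW hsum
  rw [inv_div] at h4
  linarith

/-- Euler's identity writes `(j + 1) σ_{j+1} / σ_j` as the sum of `x a * σ_j(s \ a) / σ_j`, and
expanding `σ_j` in `x a` inverts each summand. This expresses a quotient through quotients of one
order less, which drives the induction in `es_ratio_midpoint`. -/
theorem es_ratio_eq {s : Finset ι} {x : ι → ℝ} (hx : ∀ a, 0 ≤ x a) (j : ℕ)
    (hj : 0 < es s x (j + 1)) :
    es s x j / es s x (j + 1) = (j + 1) * (∑ a ∈ s with 0 < x a,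
      ((x a)⁻¹ + es (s.erase a) x (j - 1) / es (s.erase a) x j)⁻¹)⁻¹ := by
  have hj0 : 0 < es s x j := es_pos_of_le s hx (by omega) (by omega) hj
  have h1 : ∑ a ∈ s with 0 < x a,
      ((x a)⁻¹ + es (s.erase a) x (j - 1) / es (s.erase a) x j)⁻¹
      = (j + 1) * es s x (j + 1) / es s x j := by
    have h2 := sum_mul_es_erase s x (j + 1)
    push_cast at h2
    rw [← h2, sum_div, sum_filter]
    refine sum_congr rfl fun a ha => ?_
    split_ifs with hxa
    · have h3 := es_erase_pos hx ha (by omega) hj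
      rw [add_sub_cancel_right] at h3 ⊢
      rw [es_erase ha x j] at hj0 ⊢
      have h4 : (x a)⁻¹ + es (s.erase a) x (j - 1) / es (s.erase a) x j
        = (es (s.erase a) x j + x a * es (s.erase a) x (j - 1)) / (x a * es (s.erase a) x j) := by
        field_simp
      rw [h4, inv_div]
    · rw [le_antisymm (not_lt.1 hxa) (hx a)]; simp
  rw [h1]
  have : (0 : ℝ) < j + 1 := by positivity
  field_simp

/-- Inverse concavity of the quotients `σ_j / σ_{j-1}` (midpoint form). -/
theorem es_ratio_midpoint (j : ℕ) (s : Finset ι) {x y z : ι → ℝ}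
    (hx : ∀ a, 0 ≤ x a) (hy : ∀ a, 0 ≤ y a) (hz : ∀ a, 0 ≤ z a)
    (hxz : ∀ a, 0 < x a ↔ 0 < z a) (hyz : ∀ a, 0 < y a ↔ 0 < z a)
    (hm : ∀ a, (x a)⁻¹ + (y a)⁻¹ ≤ 2 * (z a)⁻¹)
    (hjx : 0 < es s x j) (hjy : 0 < es s y j) (hjz : 0 < es s z j) :
    es s x (j - 1) / es s x j + es s y (j - 1) / es s y j ≤ 2 * (es s z (j - 1) / es s z j) := by
  induction j generalizing s with
  | zero => simp [es_of_neg]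
  | succ j ih =>
    push_cast at hjx hjy hjz ⊢
    rw [add_sub_cancel_right, es_ratio_eq hx j hjx, es_ratio_eq hy j hjy, es_ratio_eq hz j hjz,
      filter_congr (fun a _ => hxz a), filter_congr (fun a _ => hyz a)]
    have hne : (s.filter fun a => 0 < z a).Nonempty := by
      by_contra hempty
      rw [not_nonempty_iff_eq_empty, filter_eq_empty_iff] at hempty
      have h2 := sum_mul_es_erase s z (j + 1)
      rw [sum_eq_zero (fun a ha => by
        rw [le_antisymm (not_lt.1 (hempty ha)) (hz a), zero_mul])] at h2
      have : (0 : ℝ) < ((j + 1 : ℤ) : ℝ) := by push_cast; positivity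
      exact (mul_pos this hjz).ne h2
    have hpos : ∀ (w : ι → ℝ), (∀ a, 0 ≤ w a) → (∀ a, 0 < w a ↔ 0 < z a) → 0 < es s w (j + 1) →
        ∀ a ∈ s.filter fun a => 0 < z a,
          0 < es (s.erase a) w j ∧
          0 < (w a)⁻¹ + es (s.erase a) w (j - 1) / es (s.erase a) w j := by
      intro w hw hwz hjw a ha
      rw [mem_filter] at ha
      have h1 := es_erase_pos hw ha.1 (by omega) hjw
      rw [add_sub_cancel_right] at h1
      exact ⟨h1, add_pos_of_pos_of_nonneg (inv_pos.2 ((hwz a).2 ha.2))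
        (div_nonneg (es_nonneg _ hw _) h1.le)⟩
    -- Each entry of the harmonic sum satisfies the midpoint inequality: the inverse `(z a)⁻¹` by
    -- hypothesis, the lower quotient by induction with `a` deleted.
    have h := inv_sum_inv_midpoint (s.filter fun a => 0 < z a) hne
      (fun a ha => (hpos x hx hxz hjx a ha).2) (fun a ha => (hpos y hy hyz hjy a ha).2)
      (w := fun a => (z a)⁻¹ + es (s.erase a) z (j - 1) / es (s.erase a) z j) (by
        intro a ha
        have := ih (s.erase a) (hpos x hx hxz hjx a ha).1 (hpos y hy hyz hjy a ha).1
          (hpos z hz (fun _ => Iff.rfl) hjz a ha).1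
        linarith [hm a])
    have hj0 : (0 : ℝ) ≤ j + 1 := by positivity
    nlinarith [mul_le_mul_of_nonneg_left h hj0]

end ElementarySymmetric

end CapillaryRank

namespace CapillaryRank

open Polynomial Finset Filter Topology

/-! ### Second order jets of functions of one variable -/

/-- `f` is twice differentiable at `0`, with first derivative `b` and second derivative `c`. -/
def HasJet2 (f : ℝ → ℝ) (b c : ℝ) : Prop :=
  ∃ f' : ℝ → ℝ, (∀ᶠ t in 𝓝 0, HasDerivAt f (f' t) t) ∧ f' 0 = b ∧ HasDerivAt f' c 0

namespace HasJet2

theorem hasDerivAt {f : ℝ → ℝ} {b c : ℝ} (h : HasJet2 f b c) : HasDerivAt f b 0 := by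
  obtain ⟨f', h1, h2, -⟩ := h
  exact h2 ▸ h1.self_of_nhds

theorem congr {f g : ℝ → ℝ} {b c : ℝ} (h : HasJet2 f b c) (hfg : g =ᶠ[𝓝 0] f) :
    HasJet2 g b c := by
  obtain ⟨f', h1, h2, h3⟩ := h
  refine ⟨f', ?_, h2, h3⟩
  filter_upwards [h1, hfg.eventuallyEq_nhds] with t ht hg
  exact ht.congr_of_eventuallyEq hg

theorem unique {f : ℝ → ℝ} {b c b' c' : ℝ} (h : HasJet2 f b c) (h' : HasJet2 f b' c') :
    b = b' ∧ c = c' := by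
  refine ⟨h.hasDerivAt.unique h'.hasDerivAt, ?_⟩
  obtain ⟨f', h1, h2, h3⟩ := h
  obtain ⟨g', k1, k2, k3⟩ := h'
  refine h3.unique (k3.congr_of_eventuallyEq ?_)
  filter_upwards [h1, k1] with t ht kt using ht.unique kt

theorem const (a : ℝ) : HasJet2 (fun _ => a) 0 0 :=
  ⟨fun _ => 0, Eventually.of_forall fun t => hasDerivAt_const t a, rfl, hasDerivAt_const 0 0⟩

theorem id : HasJet2 (fun t => t) 1 0 :=
  ⟨fun _ => 1, Eventually.of_forall fun t => hasDerivAt_id t, rfl, hasDerivAt_const 0 1⟩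

theorem add {f g : ℝ → ℝ} {b c b' c' : ℝ} (h : HasJet2 f b c) (h' : HasJet2 g b' c') :
    HasJet2 (fun t => f t + g t) (b + b') (c + c') := by
  obtain ⟨f', h1, h2, h3⟩ := h
  obtain ⟨g', k1, k2, k3⟩ := h'
  refine ⟨fun t => f' t + g' t, ?_, by simp [h2, k2], h3.add k3⟩
  filter_upwards [h1, k1] with t ht kt using ht.add kt

theorem mul {f g : ℝ → ℝ} {b c b' c' : ℝ} (h : HasJet2 f b c) (h' : HasJet2 g b' c') :
    HasJet2 (fun t => f t * g t) (b * g 0 + f 0 * b') (c * g 0 + 2 * (b * b') + f 0 * c') := by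
  have e1 := h.hasDerivAt
  have e2 := h'.hasDerivAt
  obtain ⟨f', h1, h2, h3⟩ := h
  obtain ⟨g', k1, k2, k3⟩ := h'
  refine ⟨fun t => f' t * g t + f t * g' t, ?_, by simp [h2, k2], ?_⟩
  · filter_upwards [h1, k1] with t ht kt using ht.mul kt
  · refine ((h3.mul e2).add (e1.mul k3)).congr_deriv ?_
    rw [h2, k2]; ring

theorem const_mul {f : ℝ → ℝ} {b c : ℝ} (a : ℝ) (h : HasJet2 f b c) :
    HasJet2 (fun t => a * f t) (a * b) (a * c) := by
  convert! (const a).mul h using 1 <;> ring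

theorem neg {f : ℝ → ℝ} {b c : ℝ} (h : HasJet2 f b c) : HasJet2 (fun t => -f t) (-b) (-c) := by
  convert! h.const_mul (-1) using 1
  · ext; ring
  · ring
  · ring

theorem sub {f g : ℝ → ℝ} {b c b' c' : ℝ} (h : HasJet2 f b c) (h' : HasJet2 g b' c') :
    HasJet2 (fun t => f t - g t) (b - b') (c - c') := by
  simpa only [sub_eq_add_neg] using h.add h'.neg

theorem sum {κ : Type*} (s : Finset κ) {f : κ → ℝ → ℝ} {b c : κ → ℝ}
    (h : ∀ i ∈ s, HasJet2 (f i) (b i) (c i)) :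
    HasJet2 (fun t => ∑ i ∈ s, f i t) (∑ i ∈ s, b i) (∑ i ∈ s, c i) := by
  classical
  induction s using Finset.induction_on with
  | empty => simpa using const 0
  | insert a s ha ih =>
    simp only [sum_insert ha]
    exact (h a (mem_insert_self a s)).add (ih fun i hi => h i (mem_insert_of_mem hi))

theorem inv {f : ℝ → ℝ} {b c : ℝ} (h : HasJet2 f b c) (h0 : f 0 ≠ 0) :
    HasJet2 (fun t => (f t)⁻¹) (-b / f 0 ^ 2) (-c / f 0 ^ 2 + 2 * b ^ 2 / f 0 ^ 3) := by
  have e1 := h.hasDerivAt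
  obtain ⟨f', h1, h2, h3⟩ := h
  refine ⟨fun t => -f' t / f t ^ 2, ?_, by simp [h2], ?_⟩
  · filter_upwards [h1, e1.continuousAt.eventually_ne h0] with t ht h0t using ht.inv h0t
  · refine (h3.neg.div (e1.pow 2) (pow_ne_zero 2 h0)).congr_deriv ?_
    simp only [h2, Pi.neg_apply, Pi.pow_apply]
    field_simp
    ring

theorem log {f : ℝ → ℝ} {b c : ℝ} (h : HasJet2 f b c) (h0 : 0 < f 0) :
    HasJet2 (fun t => Real.log (f t)) (b / f 0) (c / f 0 - (b / f 0) ^ 2) := by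
  have e1 := h.hasDerivAt
  obtain ⟨f', h1, h2, h3⟩ := h
  refine ⟨fun t => f' t / f t, ?_, by simp [h2], ?_⟩
  · filter_upwards [h1, e1.continuousAt.eventually_ne h0.ne'] with t ht h0t using ht.log h0t
  · refine (h3.div e1 h0.ne').congr_deriv ?_
    rw [h2]
    field_simp

/-- The first and second derivative tests at a local minimum. -/
theorem of_isLocalMin {f : ℝ → ℝ} {b c : ℝ} (h : HasJet2 f b c) (hmin : IsLocalMin f 0) :
    b = 0 ∧ 0 ≤ c := by
  have hb : b = 0 := hmin.hasDerivAt_eq_zero h.hasDerivAt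
  refine ⟨hb, ?_⟩
  by_contra! hc
  obtain ⟨f', h1, h2, h3⟩ := h
  rw [hb] at h2
  -- As `f' 0 = 0` and its slope `c` is negative, `f` would decrease strictly to the right of the
  -- minimum.
  have hneg : ∀ᶠ t in 𝓝[>] (0 : ℝ), f' t < 0 := by
    have h4 := (hasDerivAt_iff_tendsto_slope.1 h3).mono_left
      (nhdsWithin_mono 0 (fun t (ht : 0 < t) => ht.ne'))
    filter_upwards [h4.eventually (eventually_lt_nhds hc), self_mem_nhdsWithin] with t ht ht0
    rw [slope_def_field, h2, sub_zero, sub_zero] at ht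
    by_contra! hge
    exact absurd ht (not_lt.2 (div_nonneg hge (le_of_lt ht0)))
  obtain ⟨δ, hδ, hδ'⟩ := Metric.eventually_nhds_iff.1 (h1.and hmin)
  obtain ⟨η, hη, hη'⟩ := mem_nhdsGT_iff_exists_Ioo_subset.1 hneg
  have hη0 : (0 : ℝ) < η := hη
  set r := min (δ / 2) (η / 2) with hr
  have hr0 : 0 < r := lt_min (half_pos hδ) (half_pos hη0)
  have hrδ : r < δ := (min_le_left _ _).trans_lt (half_lt_self hδ)
  have hrη : r < η := (min_le_right _ _).trans_lt (half_lt_self hη0)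
  have hd : ∀ t ∈ Set.Icc 0 r, HasDerivAt f (f' t) t := by
    intro t ht
    refine (hδ' ?_).1
    rw [Real.dist_eq, sub_zero, abs_of_nonneg ht.1]
    exact ht.2.trans_lt hrδ
  have hanti : StrictAntiOn f (Set.Icc 0 r) := by
    refine strictAntiOn_of_deriv_neg (convex_Icc 0 r)
      (fun t ht => (hd t ht).continuousAt.continuousWithinAt) fun t ht => ?_
    rw [interior_Icc] at ht
    rw [(hd t ⟨ht.1.le, ht.2.le⟩).deriv]
    exact hη' ⟨ht.1, ht.2.trans hrη⟩
  have h5 := hanti ⟨le_rfl, hr0.le⟩ ⟨hr0.le, le_rfl⟩ hr0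
  have h6 : f 0 ≤ f r := by
    refine (hδ' ?_).2
    rw [Real.dist_eq, sub_zero, abs_of_nonneg hr0.le]
    exact hrδ
  linarith

end HasJet2

/-! ### Derivatives of determinants and of elementary symmetric functions of matrices -/

section Matrix

variable {ι : Type*} [Fintype ι] [DecidableEq ι]

theorem hasDerivWithinAt_det {M : ℝ → Matrix ι ι ℝ} {M' : Matrix ι ι ℝ} {s : Set ℝ} {t : ℝ}
    (h : ∀ i j, HasDerivWithinAt (fun t => M t i j) (M' i j) s t) :
    HasDerivWithinAt (fun t => (M t).det)
      (∑ a, ((M t).updateCol a fun i => M' i a).det) s t := by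
  simp only [Matrix.det_apply]
  rw [sum_comm]
  refine HasDerivWithinAt.fun_sum fun σ _ => ?_
  rw [← smul_sum]
  refine HasDerivWithinAt.const_smul _ ?_
  refine (HasDerivWithinAt.fun_finsetProd fun i _ => h (σ i) i).congr_deriv ?_
  refine sum_congr rfl fun a _ => ?_
  rw [← mul_prod_erase univ _ (mem_univ a), smul_eq_mul, mul_comm]
  congr 1
  · simp
  · refine prod_congr rfl fun i hi => ?_
    rw [Matrix.updateCol_ne (ne_of_mem_erase hi)]

theorem det_updateCol_diagonal (d : ι → ℝ) (a : ι) (v : ι → ℝ) :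
    ((Matrix.diagonal d).updateCol a v).det = v a * ∏ i ∈ univ.erase a, d i := by
  rw [← Matrix.cramer_apply, Matrix.cramer_eq_adjugate_mulVec, Matrix.adjugate_diagonal,
    Matrix.mulVec_diagonal, mul_comm]

/-- Replacing two columns is a perturbation `U * V` of the identity of rank at most two, so det(1 +
UV) = det(1 + VU) reduces it to a 2×2 determinant. -/
theorem det_updateCol_updateCol_one {a b : ι} (hab : a ≠ b) (v w : ι → ℝ) :
    (((1 : Matrix ι ι ℝ).updateCol a v).updateCol b w).det = v a * w b - v b * w a := by
  let U : Matrix ι (Fin 2) ℝ := fun i j =>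
    if j = 0 then v i - (1 : Matrix ι ι ℝ) i a else w i - (1 : Matrix ι ι ℝ) i b
  let V : Matrix (Fin 2) ι ℝ := fun j i =>
    if j = 0 then (1 : Matrix ι ι ℝ) a i else (1 : Matrix ι ι ℝ) b i
  have h : ((1 : Matrix ι ι ℝ).updateCol a v).updateCol b w = 1 + U * V := by
    ext i j
    rw [Matrix.add_apply, Matrix.mul_apply, Fin.sum_univ_two]
    by_cases hjb : j = b
    · subst hjb
      simp [U, V, Matrix.one_apply, hab]
    · by_cases hja : j = a
      · subst hja
        simp [U, V, Matrix.one_apply, hab, Ne.symm hab]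
      · simp [U, V, hjb, hja, Ne.symm hjb, Ne.symm hja, Matrix.one_apply]
  rw [h, Matrix.det_one_add_mul_comm, Matrix.det_fin_two]
  have e : ∀ i j, (V * U) i j = U (if i = 0 then a else b) j := by
    intro i j
    rw [Matrix.mul_apply]
    fin_cases i <;> simp [V, Matrix.one_apply]
  simp only [Matrix.add_apply, e]
  simp [U, Matrix.one_apply, hab, Ne.symm hab, mul_comm]

theorem det_updateCol_updateCol_diagonal {d : ι → ℝ} (hd : ∀ i, d i ≠ 0) {a b : ι} (hab : a ≠ b)
    (v w : ι → ℝ) :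
    (((Matrix.diagonal d).updateCol a v).updateCol b w).det
      = (v a * w b - v b * w a) * ∏ i ∈ (univ.erase a).erase b, d i := by
  have h : ((Matrix.diagonal d).updateCol a v).updateCol b w
      = Matrix.diagonal d * ((1 : Matrix ι ι ℝ).updateCol a fun i => v i / d i).updateCol b
          fun i => w i / d i := by
    ext i j
    rw [Matrix.diagonal_mul]
    simp only [Matrix.updateCol_apply]
    have := hd i
    split_ifs
    · field_simp
    · field_simp
    · rw [Matrix.diagonal_apply, Matrix.one_apply]; split_ifs <;> simp
  rw [h, Matrix.det_mul, det_updateCol_updateCol_one hab, Matrix.det_diagonal,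
    ← mul_prod_erase univ d (mem_univ a),
    ← mul_prod_erase (univ.erase a) d (mem_erase.2 ⟨hab.symm, mem_univ b⟩)]
  have := hd a
  have := hd b
  field_simp

/-- Two differentiations act on the same column, giving the `D` terms, or on two different ones,
giving the 2×2 principal minors of `B`. Nonvanishing of `d` allows the diagonal factor to be pulled
out in the second case. -/
theorem hasJet2_det_of_diagonal {M : ℝ → Matrix ι ι ℝ} {B D : Matrix ι ι ℝ} {d : ι → ℝ}
    (hd : ∀ i, d i ≠ 0) (h0 : M 0 = Matrix.diagonal d)
    (h : ∀ i j, HasJet2 (fun t => M t i j) (B i j) (D i j)) :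
    HasJet2 (fun t => (M t).det) (∑ a, B a a * ∏ i ∈ univ.erase a, d i)
      (∑ a, D a a * ∏ i ∈ univ.erase a, d i + ∑ a, ∑ b ∈ univ.erase a,
        (B a a * B b b - B a b * B b a) * ∏ i ∈ (univ.erase a).erase b, d i) := by
  choose M' h1 h2 h3 using h
  have hB : (fun i j => M' i j 0) = B := by ext i j; exact h2 i j
  refine ⟨fun t => ∑ a, ((M t).updateCol a fun i => M' i a t).det, ?_, ?_, ?_⟩
  · have h4 : ∀ᶠ t in 𝓝 (0 : ℝ), ∀ i j, HasDerivAt (fun t => M t i j) (M' i j t) t :=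
      eventually_all.2 fun i => eventually_all.2 fun j => h1 i j
    filter_upwards [h4] with t ht
    have := hasDerivWithinAt_det (s := Set.univ) (t := t) (M := M) (M' := fun i j => M' i j t)
      fun i j => (ht i j).hasDerivWithinAt
    simpa using this
  · simp only [h0, det_updateCol_diagonal, h2]
  · rw [← sum_add_distrib]
    refine HasDerivAt.fun_sum fun a _ => ?_
    have h5 := hasDerivWithinAt_det (s := Set.univ) (t := 0)
      (M := fun t => (M t).updateCol a fun i => M' i a t)
      (M' := fun i j => if j = a then D i a else B i j) (by
        intro i j
        rw [hasDerivWithinAt_univ]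
        by_cases hj : j = a
        · subst hj
          simpa using h3 i j
        · simpa [Matrix.updateCol_apply, hj, h2] using (h1 i j).self_of_nhds)
    rw [hasDerivWithinAt_univ] at h5
    refine h5.congr_deriv ?_
    rw [← add_sum_erase univ _ (mem_univ a)]
    congr 1
    · simp [h0, det_updateCol_diagonal]
    · refine sum_congr rfl fun b hb => ?_
      have hba := ne_of_mem_erase hb
      simp only [h0, h2, if_neg hba]
      rw [det_updateCol_updateCol_diagonal hd hba.symm]
      ring

/-- The `k`-th elementary symmetric function of the eigenvalues of a matrix. -/
def msym (M : Matrix ι ι ℝ) (k : ℕ) : ℝ := (Matrix.charpolyRev (-M)).coeff k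

theorem eval_charpolyRev_neg (M : Matrix ι ι ℝ) (t : ℝ) :
    (Matrix.charpolyRev (-M)).eval t = (1 + t • M).det := by
  rw [Matrix.charpolyRev, ← coe_evalRingHom, RingHom.map_det]
  congr 1
  ext i j
  rcases eq_or_ne i j with hij | hij <;> simp [hij, mul_comm t]

theorem charpolyRev_neg_diagonal (x : ι → ℝ) :
    Matrix.charpolyRev (-Matrix.diagonal x) = ∏ a, (1 + C (x a) * X : ℝ[X]) := by
  rw [Matrix.charpolyRev, ← Matrix.det_diagonal]
  congr 1
  ext1 i j
  rcases eq_or_ne i j with hij | hij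
  · subst hij
    simp
  · simp [hij]

theorem msym_diagonal (x : ι → ℝ) (k : ℕ) : msym (Matrix.diagonal x) k = es univ x k := by
  rw [msym, charpolyRev_neg_diagonal, es_natCast]

theorem natDegree_charpolyRev_le (M : Matrix ι ι ℝ) :
    (Matrix.charpolyRev M).natDegree ≤ Fintype.card ι := by
  rw [← Matrix.reverse_charpoly]
  exact (reverse_natDegree_le _).trans (Matrix.charpoly_natDegree_eq_dim M).le

/-- A coefficient of a polynomial of bounded degree is a combination of its values at natural
numbers. -/
theorem exists_coeff_eq_sum_eval (N k : ℕ) : ∃ c : ℕ → ℝ, ∀ p : ℝ[X], p.natDegree ≤ N →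
    p.coeff k = ∑ i ∈ range (N + 1), c i * p.eval (i : ℝ) := by
  refine ⟨fun i => (Lagrange.basis (range (N + 1)) (fun i : ℕ => (i : ℝ)) i).coeff k, ?_⟩
  intro p hp
  have h := Lagrange.eq_interpolate (s := range (N + 1)) (v := fun i : ℕ => (i : ℝ)) (f := p)
    (Nat.cast_injective.injOn) (by
      rw [card_range]
      exact lt_of_le_of_lt (degree_le_of_natDegree_le hp) (by exact_mod_cast Nat.lt_succ_self N))
  conv_lhs => rw [h]
  rw [Lagrange.interpolate_apply, finsetSum_coeff]
  refine sum_congr rfl fun i _ => ?_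
  rw [coeff_C_mul, mul_comm]

theorem natDegree_prod_one_add_le (s : Finset ι) (x : ι → ℝ) :
    (∏ a ∈ s, (1 + C (x a) * X : ℝ[X])).natDegree ≤ s.card := by
  refine (natDegree_prod_le _ _).trans ?_
  rw [card_eq_sum_ones]
  refine sum_le_sum fun a _ => ?_
  refine (natDegree_add_le _ _).trans (max_le (by simp) ?_)
  exact (natDegree_C_mul_le _ _).trans natDegree_X_le

theorem coeff_X_mul_prod (s : Finset ι) (x : ι → ℝ) (k : ℕ) :
    (X * ∏ a ∈ s, (1 + C (x a) * X : ℝ[X])).coeff k = es s x (k - 1) := by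
  rcases k with _ | k
  · simp [es_of_neg]
  · rw [coeff_X_mul, show (((k + 1 : ℕ) : ℤ) - 1) = (k : ℤ) by push_cast; ring, es_natCast]

theorem coeff_X_mul_X_mul_prod (s : Finset ι) (x : ι → ℝ) (k : ℕ) :
    (X * (X * ∏ a ∈ s, (1 + C (x a) * X : ℝ[X]))).coeff k = es s x (k - 2) := by
  rcases k with _ | k
  · simp [es_of_neg]
  · rw [coeff_X_mul, coeff_X_mul_prod]
    congr 1
    push_cast; ring

/-- The extra factor `i` is the value of `X` at the node, and multiplication by `X` shifts the
coefficient index by one. -/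
theorem sum_eval_prod_erase {x : ι → ℝ} {k : ℕ} {c : ℕ → ℝ}
    (hc : ∀ p : ℝ[X], p.natDegree ≤ Fintype.card ι →
      p.coeff k = ∑ i ∈ range (Fintype.card ι + 1), c i * p.eval (i : ℝ)) (a : ι) :
    ∑ i ∈ range (Fintype.card ι + 1), c i * ((i : ℝ) * ∏ b ∈ univ.erase a, (1 + i * x b))
      = es (univ.erase a) x (k - 1) := by
  rw [← coeff_X_mul_prod, hc]
  · refine sum_congr rfl fun i _ => ?_
    simp only [eval_mul, eval_X, eval_prod, eval_add, eval_one, eval_C, mul_comm (x _)]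
  · refine (natDegree_mul_le).trans ?_
    have h1 := natDegree_prod_one_add_le (univ.erase a) x
    have h2 := card_erase_add_one (mem_univ a)
    rw [card_univ] at h2
    rw [natDegree_X]
    omega

theorem sum_eval_prod_erase_erase {x : ι → ℝ} {k : ℕ} {c : ℕ → ℝ}
    (hc : ∀ p : ℝ[X], p.natDegree ≤ Fintype.card ι →
      p.coeff k = ∑ i ∈ range (Fintype.card ι + 1), c i * p.eval (i : ℝ)) {a b : ι}
    (hab : b ∈ univ.erase a) :
    ∑ i ∈ range (Fintype.card ι + 1), c i * ((i : ℝ) * ((i : ℝ) *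
      ∏ j ∈ (univ.erase a).erase b, (1 + i * x j))) = es ((univ.erase a).erase b) x (k - 2) := by
  rw [← coeff_X_mul_X_mul_prod, hc]
  · refine sum_congr rfl fun i _ => ?_
    simp only [eval_mul, eval_X, eval_prod, eval_add, eval_one, eval_C, mul_comm (x _)]
  · refine (natDegree_mul_le).trans ?_
    have h0 := natDegree_mul_le (p := X)
      (q := ∏ a ∈ (univ.erase a).erase b, (1 + C (x a) * X : ℝ[X]))
    have h1 := natDegree_prod_one_add_le ((univ.erase a).erase b) x
    have h2 := card_erase_add_one (mem_univ a)
    have h3 := card_erase_add_one hab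
    rw [card_univ] at h2
    rw [natDegree_X] at h0 ⊢
    omega

/-- The one-sided version serves at boundary points of the cone, where only inward rays are
available. -/
theorem hasDerivWithinAt_msym {M : ℝ → Matrix ι ι ℝ} {B : Matrix ι ι ℝ} {x : ι → ℝ} {s : Set ℝ}
    (h0 : M 0 = Matrix.diagonal x)
    (h : ∀ i j, HasDerivWithinAt (fun t => M t i j) (B i j) s 0) (k : ℕ) :
    HasDerivWithinAt (fun t => msym (M t) k) (∑ a, B a a * es (univ.erase a) x (k - 1)) s 0 := by
  obtain ⟨c, hc⟩ := exists_coeff_eq_sum_eval (Fintype.card ι) k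
  have h1 : ∀ t, msym (M t) k
      = ∑ i ∈ range (Fintype.card ι + 1), c i * (1 + (i : ℝ) • M t).det := by
    intro t
    rw [msym, hc _ (natDegree_charpolyRev_le _)]
    simp only [eval_charpolyRev_neg]
  simp only [h1, ← sum_eval_prod_erase hc, mul_sum]
  rw [sum_comm]
  refine HasDerivWithinAt.fun_sum fun i _ => ?_
  have h2 := hasDerivWithinAt_det (M := fun t => 1 + (i : ℝ) • M t) (M' := (i : ℝ) • B) (s := s)
    (t := 0) (fun a b => by
      simpa using ((h a b).const_mul (i : ℝ)).const_add ((1 : Matrix ι ι ℝ) a b))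
  refine (h2.const_mul (c i)).congr_deriv ?_
  have h3 : (1 : Matrix ι ι ℝ) + (i : ℝ) • M 0 = Matrix.diagonal fun j => 1 + i * x j := by
    rw [h0, ← Matrix.diagonal_one, ← Matrix.diagonal_smul, Matrix.diagonal_add]
    rfl
  rw [mul_sum]
  refine sum_congr rfl fun a _ => ?_
  rw [h3, det_updateCol_diagonal, Matrix.smul_apply, smul_eq_mul]
  ring

/-- The coefficient is a fixed linear combination of the determinants of `1 + i M` at natural
numbers `i`, so its jet follows from that of a determinant. -/
theorem hasJet2_msym {M : ℝ → Matrix ι ι ℝ} {B D : Matrix ι ι ℝ} {x : ι → ℝ} (hx : ∀ a, 0 ≤ x a)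
    (h0 : M 0 = Matrix.diagonal x)
    (h : ∀ i j, HasJet2 (fun t => M t i j) (B i j) (D i j)) (k : ℕ) :
    HasJet2 (fun t => msym (M t) k) (∑ a, B a a * es (univ.erase a) x (k - 1))
      (∑ a, D a a * es (univ.erase a) x (k - 1) + ∑ a, ∑ b ∈ univ.erase a,
        (B a a * B b b - B a b * B b a) * es ((univ.erase a).erase b) x (k - 2)) := by
  obtain ⟨c, hc⟩ := exists_coeff_eq_sum_eval (Fintype.card ι) k
  have h1 : ∀ t, msym (M t) k
      = ∑ i ∈ range (Fintype.card ι + 1), c i * (1 + (i : ℝ) • M t).det := by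
    intro t
    rw [msym, hc _ (natDegree_charpolyRev_le _)]
    simp only [eval_charpolyRev_neg]
  -- The nodes are nonnegative, so `1 + i M 0` is invertible even where `x` vanishes; degenerate
  -- diagonal matrices are thus covered.
  have hd : ∀ i : ℕ, ∀ j, 1 + (i : ℝ) * x j ≠ 0 := fun i j => by
    have := mul_nonneg (Nat.cast_nonneg (α := ℝ) i) (hx j)
    positivity
  have hd0 : ∀ i : ℕ, (1 : Matrix ι ι ℝ) + (i : ℝ) • M 0 = Matrix.diagonal fun j => 1 + i * x j := by
    intro i
    rw [h0, ← Matrix.diagonal_one, ← Matrix.diagonal_smul, Matrix.diagonal_add]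
    rfl
  have hj : ∀ i : ℕ, ∀ a b, HasJet2 (fun t => ((1 : Matrix ι ι ℝ) + (i : ℝ) • M t) a b)
      (((i : ℝ) • B) a b) (((i : ℝ) • D) a b) := by
    intro i a b
    simpa using (HasJet2.const ((1 : Matrix ι ι ℝ) a b)).add ((h a b).const_mul (i : ℝ))
  have h2 := fun i : ℕ => (hasJet2_det_of_diagonal (hd i) (hd0 i) (hj i)).const_mul (c i)
  simp only [h1]
  convert! HasJet2.sum (range (Fintype.card ι + 1)) (fun i _ => h2 i) using 1
  · simp only [← sum_eval_prod_erase hc, mul_sum]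
    rw [sum_comm]
    refine sum_congr rfl fun i _ => sum_congr rfl fun a _ => ?_
    rw [Matrix.smul_apply, smul_eq_mul]
    ring
  · simp only [mul_add, sum_add_distrib]
    congr 1
    · simp only [← sum_eval_prod_erase hc, mul_sum]
      rw [sum_comm]
      refine sum_congr rfl fun i _ => sum_congr rfl fun a _ => ?_
      rw [Matrix.smul_apply, smul_eq_mul]
      ring
    · simp only [mul_sum]
      rw [sum_comm]
      refine sum_congr rfl fun a _ => ?_
      rw [sum_comm]
      refine sum_congr rfl fun b hb => ?_
      rw [← sum_eval_prod_erase_erase hc hb, mul_sum]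
      refine sum_congr rfl fun i _ => ?_
      simp only [Matrix.smul_apply, smul_eq_mul]
      ring

end Matrix

end CapillaryRank

namespace CapillaryRank

open Polynomial Finset Filter Topology

theorem HasJet2.comp_neg {f : ℝ → ℝ} {b c : ℝ} (h : HasJet2 f b c) :
    HasJet2 (fun t => f (-t)) (-b) c := by
  obtain ⟨f', h1, h2, h3⟩ := h
  refine ⟨fun t => -f' (-t), ?_, by simp [h2], ?_⟩
  · have h4 : Tendsto (fun t : ℝ => -t) (𝓝 0) (𝓝 0) := by
      simpa using (continuous_neg (G := ℝ)).tendsto 0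
    filter_upwards [h4.eventually h1] with t ht
    exact (ht.comp t (hasDerivAt_neg t)).congr_deriv (by ring)
  · have h4 : HasDerivAt f' c (-0) := by rwa [neg_zero]
    exact (h4.comp (0 : ℝ) (hasDerivAt_neg 0)).neg.congr_deriv (by ring)

/-! ### Ellipticity and inverse concavity of the quotients σ_k / σ_l -/

section Quotients

variable {ι : Type*} [DecidableEq ι]

theorem continuous_es (s : Finset ι) (k : ℤ) : Continuous fun x : ι → ℝ => es s x k := by
  induction s using Finset.induction_on generalizing k with
  | empty => simpa only [es_empty] using continuous_const
  | insert a s ha ih =>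
    simp only [es_insert ha]
    exact (ih k).add ((continuous_apply a).mul (ih (k - 1)))

variable [Fintype ι]

/-- The logarithmic derivative of `σ_j` in the direction of the `a`-th variable. -/
def w1 (x : ι → ℝ) (j : ℕ) (a : ι) : ℝ := es (univ.erase a) x (j - 1) / es univ x j

/-- The mixed second derivative of `σ_j`, divided by `σ_j`. -/
def w2 (x : ι → ℝ) (j : ℕ) (a b : ι) : ℝ := es ((univ.erase a).erase b) x (j - 2) / es univ x j

/-- The first derivative of `log σ_j` at a diagonal matrix. -/
def logD1 (x : ι → ℝ) (j : ℕ) (B : Matrix ι ι ℝ) : ℝ := ∑ a, B a a * w1 x j a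

/-- The second derivative of `log σ_j` at a diagonal matrix. -/
def logD2 (x : ι → ℝ) (j : ℕ) (B : Matrix ι ι ℝ) : ℝ :=
  ∑ a, ∑ b ∈ univ.erase a, (B a a * B b b - B a b * B b a) * w2 x j a b - logD1 x j B ^ 2

/-- Ellipticity of `σ_{i+1} / σ_i`. After clearing denominators the terms with `x a` cancel, leaving
the strict Newton inequality between the functions of orders `i - 1`, `i`, `i + 1` of the other
variables. -/
theorem w1_sub_pos {x : ι → ℝ} (hx : ∀ a, 0 ≤ x a) {i : ℕ} (hi : 0 < es univ x (i + 1)) (a : ι) :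
    0 < w1 x (i + 1) a - w1 x i a := by
  have h0 : 0 < es univ x i := es_pos_of_le _ hx (by omega) (by omega) hi
  have h1 := es_erase_pos hx (mem_univ a) (by omega) hi
  rw [add_sub_cancel_right] at h1
  have h2 := es_mul_es_lt (univ.erase a) hx (i := i) (j := i) (by omega) le_rfl h1
  have e1 := es_erase (mem_univ a) x i
  have e2 := es_erase (mem_univ a) x (i + 1)
  rw [add_sub_cancel_right] at e2
  rw [w1, w1]
  push_cast
  rw [add_sub_cancel_right, sub_pos, div_lt_div_iff₀ h0 hi, e1, e2]
  nlinarith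

theorem w1_sub_w1_pos {x : ι → ℝ} (hx : ∀ a, 0 ≤ x a) {k l : ℕ} (hlk : l < k)
    (hk : 0 < es univ x k) (a : ι) : 0 < w1 x k a - w1 x l a := by
  induction k, hlk using Nat.le_induction with
  | base => exact w1_sub_pos hx (by exact_mod_cast hk) a
  | succ k hk' ih =>
    have h1 := w1_sub_pos hx (i := k) (by exact_mod_cast hk) a
    have h2 := ih (es_pos_of_le _ hx (by omega) (by push_cast; omega) hk)
    linarith

/-- Euler's identity for `log σ_j`. -/
theorem sum_mul_w1 (x : ι → ℝ) {j : ℕ} (hj : es univ x j ≠ 0) : ∑ a, x a * w1 x j a = j := by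
  have h := sum_mul_es_erase univ x j
  simp only [w1, mul_div_assoc', ← sum_div]
  rw [h]
  field_simp
  simp

/-- Along a path whose inverses are affine in `t`, `es_ratio_midpoint` says that `2 q(0) - q(t) -
q(-t)` is nonnegative for `q = σ_i / σ_{i+1}`. It vanishes at `t = 0`, so the second derivative test
gives `q''(0) ≤ 0`, which is the claim after division by `q(0)`. -/
theorem inverse_concavity_diagonal {x v : ι → ℝ} (hx : ∀ a, 0 ≤ x a)
    (hv : ∀ a, x a = 0 → v a = 0) {i : ℕ} (hi : 0 < es univ x (i + 1)) :
    (logD1 x (i + 1) (Matrix.diagonal v) - logD1 x i (Matrix.diagonal v)) ^ 2 ≤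
      logD2 x (i + 1) (Matrix.diagonal v) - logD2 x i (Matrix.diagonal v)
        + 2 * ∑ a, (w1 x (i + 1) a - w1 x i a) * (v a ^ 2 / x a) := by
  have hi0 : 0 < es univ x i := es_pos_of_le _ hx (by omega) (by omega) hi
  -- The path has velocity `v` and acceleration `2 v² / x` at `0`. Where `x a = 0` also `v a = 0`,
  -- and the convention `0⁻¹ = 0` makes `y t a` vanish identically.
  set y : ℝ → ι → ℝ := fun t a => ((x a)⁻¹ - t * (v a / x a ^ 2))⁻¹ with hy
  have hy0 : y 0 = x := by ext a; simp [hy]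
  have hjet : ∀ a, HasJet2 (fun t => y t a) (v a) (2 * v a ^ 2 / x a) := by
    intro a
    rcases (hx a).lt_or_eq with hpos | hzero
    · have h1 : HasJet2 (fun t => (x a)⁻¹ - t * (v a / x a ^ 2)) (-(v a / x a ^ 2)) 0 := by
        convert! (HasJet2.const (x a)⁻¹).sub (HasJet2.id.mul (HasJet2.const (v a / x a ^ 2)))
          using 1 <;> simp
      convert! h1.inv (by simpa using hpos.ne') using 1
      · simp; field_simp
      · simp; field_simp
    · have : (fun t => y t a) = fun _ => 0 := by
        ext t; simp [hy, ← hzero, hv a hzero.symm]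
      rw [this, hv a hzero.symm]
      simpa using HasJet2.const 0
  have hM : ∀ a b, HasJet2 (fun t => Matrix.diagonal (y t) a b) (Matrix.diagonal v a b)
      (Matrix.diagonal (fun a => 2 * v a ^ 2 / x a) a b) := by
    intro a b
    by_cases hab : a = b
    · subst hab
      simpa using hjet a
    · simpa [Matrix.diagonal_apply_ne _ hab] using HasJet2.const 0
  have hS : ∀ k : ℕ, HasJet2 (fun t => es univ (y t) k) _ _ := fun k => by
    simpa only [msym_diagonal] using
      hasJet2_msym (M := fun t => Matrix.diagonal (y t)) hx (by simp only [hy0]) hM k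
  have hs := hS (i + 1)
  have hu := hS i
  push_cast at hs
  have hr := hu.mul (hs.inv (by rw [hy0]; exact hi.ne'))
  have hR := (HasJet2.const (2 * (es univ x i * (es univ x (i + 1))⁻¹))).sub (hr.add hr.comp_neg)
  have hypos : ∀ᶠ t in 𝓝 (0 : ℝ), ∀ a, 0 ≤ y t a ∧ (0 < y t a ↔ 0 < x a) := by
    refine eventually_all.2 fun a => ?_
    rcases (hx a).lt_or_eq with hpos | hzero
    · have h2 : ContinuousAt (fun t => y t a) 0 := (hjet a).hasDerivAt.continuousAt
      have h3 : 0 < y 0 a := by rw [hy0]; exact hpos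
      filter_upwards [h2.eventually (lt_mem_nhds h3)] with t ht
      exact ⟨ht.le, fun _ => hpos, fun _ => ht⟩
    · refine Eventually.of_forall fun t => ?_
      have : y t a = 0 := by simp [hy, ← hzero, hv a hzero.symm]
      simp [this, ← hzero]
  have hspos : ∀ᶠ t in 𝓝 (0 : ℝ), 0 < es univ (y t) (i + 1) :=
    hs.hasDerivAt.continuousAt.eventually (lt_mem_nhds (by simpa only [hy0] using hi))
  have hneg : Tendsto (fun t : ℝ => -t) (𝓝 0) (𝓝 0) := by
    simpa using (continuous_neg (G := ℝ)).tendsto 0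
  have hmin : IsLocalMin (fun t => 2 * (es univ x i * (es univ x (i + 1))⁻¹)
      - (es univ (y t) i * (es univ (y t) (i + 1))⁻¹
        + es univ (y (-t)) i * (es univ (y (-t)) (i + 1))⁻¹)) 0 := by
    filter_upwards [hypos, hneg.eventually hypos, hspos, hneg.eventually hspos]
      with t h1 h2 h3 h4
    have h5 := es_ratio_midpoint (i + 1) univ (fun a => (h1 a).1) (fun a => (h2 a).1) hx
      (fun a => (h1 a).2) (fun a => (h2 a).2) (fun a => by simp only [hy, inv_inv]; linarith)
      (by exact_mod_cast h3) (by exact_mod_cast h4) (by exact_mod_cast hi)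
    push_cast at h5
    simp only [add_sub_cancel_right, div_eq_mul_inv] at h5
    simp only [neg_zero, hy0]
    linarith
  have hc := (hR.of_isLocalMin hmin).2
  simp only [hy0] at hc
  clear hR hmin hr hs hu hS
  have hF : ∀ k : ℕ, es univ x k ≠ 0 → ∑ a, (Matrix.diagonal v) a a * es (univ.erase a) x (k - 1)
      = es univ x k * logD1 x k (Matrix.diagonal v) := by
    intro k hk
    rw [logD1, mul_sum]
    refine sum_congr rfl fun a _ => ?_
    rw [w1]; field_simp
  have hG : ∀ k : ℕ, es univ x k ≠ 0 →
      ∑ a, (Matrix.diagonal (fun a => 2 * v a ^ 2 / x a)) a a * es (univ.erase a) x (k - 1)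
      + ∑ a, ∑ b ∈ univ.erase a, ((Matrix.diagonal v) a a * (Matrix.diagonal v) b b
        - (Matrix.diagonal v) a b * (Matrix.diagonal v) b a) * es ((univ.erase a).erase b) x (k - 2)
      = es univ x k * (logD2 x k (Matrix.diagonal v) + logD1 x k (Matrix.diagonal v) ^ 2
        + 2 * ∑ a, w1 x k a * (v a ^ 2 / x a)) := by
    intro k hk
    rw [logD2, sub_add_cancel, mul_add, add_comm]
    simp only [mul_sum]
    congr 1
    · refine sum_congr rfl fun a _ => sum_congr rfl fun b _ => ?_
      rw [w2]; field_simp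
    · refine sum_congr rfl fun a _ => ?_
      rw [w1, Matrix.diagonal_apply_eq]; field_simp
  have e1 := hF (i + 1) (by exact_mod_cast hi.ne')
  have e2 := hF i hi0.ne'
  have e3 := hG (i + 1) (by exact_mod_cast hi.ne')
  have e4 := hG i hi0.ne'
  push_cast at e1 e3
  rw [e1, e2, e3, e4] at hc
  simp only [sub_mul, sum_sub_distrib]
  set S := es univ x (i + 1)
  set U := es univ x i
  set p := logD1 x (i + 1) (Matrix.diagonal v)
  set q := logD1 x i (Matrix.diagonal v)
  set P := logD2 x (i + 1) (Matrix.diagonal v)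
  set Q := logD2 x i (Matrix.diagonal v)
  set A := ∑ a, w1 x (i + 1) a * (v a ^ 2 / x a)
  set B := ∑ a, w1 x i a * (v a ^ 2 / x a)
  have hc2 : 0 ≤ 2 * (U / S) * (P + 2 * A - Q - 2 * B - (p - q) ^ 2) := by
    refine hc.trans (le_of_eq ?_)
    have := hi.ne'
    field_simp
    ring
  have h6 : 0 < 2 * (U / S) := by positivity
  have := nonneg_of_mul_nonneg_right hc2 h6
  linarith

/-- The difference of the two sides is `(e1 S - e0 U) / (x_a x_b U S)`, whose numerator is a
nonnegative combination of two Newton differences in the variables other than `a` and `b`. -/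
theorem inverse_concavity_offDiagonal {x : ι → ℝ} (hx : ∀ a, 0 ≤ x a) {i : ℕ}
    (hi : 0 < es univ x (i + 1)) {a b : ι} (hab : b ∈ univ.erase a) (ha : 0 < x a)
    (hb : 0 < x b) :
    w2 x (i + 1) a b - w2 x i a b
      ≤ (w1 x (i + 1) a - w1 x i a) / x b + (w1 x (i + 1) b - w1 x i b) / x a := by
  have hi0 : 0 < es univ x i := es_pos_of_le _ hx (by omega) (by omega) hi
  have hba : a ∈ univ.erase b := mem_erase.2 ⟨(ne_of_mem_erase hab).symm, mem_univ a⟩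
  have hS : ∀ k : ℤ, es univ x k = es ((univ.erase a).erase b) x k
      + (x a + x b) * es ((univ.erase a).erase b) x (k - 1)
      + x a * x b * es ((univ.erase a).erase b) x (k - 2) := by
    intro k
    rw [es_erase (mem_univ a), es_erase hab, es_erase hab x (k - 1),
      show k - 1 - 1 = k - 2 by ring]
    ring
  have h1 : ∀ k : ℤ, es (univ.erase a) x k = es ((univ.erase a).erase b) x k
      + x b * es ((univ.erase a).erase b) x (k - 1) := fun k => es_erase hab x k
  have h2 : ∀ k : ℤ, es (univ.erase b) x k = es ((univ.erase a).erase b) x k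
      + x a * es ((univ.erase a).erase b) x (k - 1) := fun k => by
    rw [erase_right_comm]; exact es_erase hba x k
  have l1 := es_mul_es_le ((univ.erase a).erase b) hx (i := i) (j := i) le_rfl
  have l2 := es_mul_es_le ((univ.erase a).erase b) hx (i := (i : ℤ) - 1) (j := i) (by omega)
  rw [w1, w1, w1, w1, w2, w2]
  push_cast
  rw [h1, h1, h2, h2]
  have hSi := hS i
  have hSi1 := hS (i + 1)
  rw [show (i : ℤ) + 1 - 2 = i - 1 by ring, add_sub_cancel_right] at *
  rw [show (i : ℤ) - 1 - 1 = i - 2 by ring] at *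
  set e0 := es ((univ.erase a).erase b) x (i + 1)
  set e1 := es ((univ.erase a).erase b) x i
  set e2 := es ((univ.erase a).erase b) x (i - 1)
  set e3 := es ((univ.erase a).erase b) x (i - 2)
  set S := es univ x (i + 1)
  set U := es univ x i
  have key : 0 ≤ (e1 * S - e0 * U) / (x a * x b * U * S) := by
    refine div_nonneg ?_ (by positivity)
    rw [hSi, hSi1]
    nlinarith [mul_nonneg (add_nonneg (hx a) (hx b)) (sub_nonneg.2 l1),
      mul_nonneg (mul_nonneg (hx a) (hx b)) (sub_nonneg.2 l2)]
  have heq : ((e1 + x b * e2) / S - (e2 + x b * e3) / U) / x b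
      + ((e1 + x a * e2) / S - (e2 + x a * e3) / U) / x a - (e2 / S - e3 / U)
      = (e1 * S - e0 * U) / (x a * x b * U * S) := by
    have e0' : e0 = S - (x a + x b) * e1 - x a * x b * e2 := by rw [hSi1]; ring
    have e1' : e1 = U - (x a + x b) * e2 - x a * x b * e3 := by rw [hSi]; ring
    have := hi.ne'
    rw [e0']
    field_simp
    rw [e1']
    ring
  linarith

/-- The off-diagonal entries of `B` enter `logD2` only through `-B_ab² w2`, so the claim splits into
the diagonal case and one inequality for each pair; the last sum is symmetrised in `a` and `b` to
match the pairwise form. -/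
theorem inverse_concavity_succ {x : ι → ℝ} (hx : ∀ a, 0 ≤ x a) {B : Matrix ι ι ℝ}
    (hB : ∀ a b, B a b = B b a) (hB0 : ∀ a b, x a = 0 → B a b = 0) {i : ℕ}
    (hi : 0 < es univ x (i + 1)) :
    (logD1 x (i + 1) B - logD1 x i B) ^ 2 ≤ logD2 x (i + 1) B - logD2 x i B
      + 2 * ∑ a, ∑ b, (w1 x (i + 1) a - w1 x i a) * (B a b ^ 2 / x b) := by
  set f : ι → ℝ := fun a => w1 x (i + 1) a - w1 x i a with hf
  have h1 := inverse_concavity_diagonal (v := fun a => B a a) hx (fun a ha => hB0 a a ha) hi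
  have hd1 : ∀ k, logD1 x k (Matrix.diagonal fun a => B a a) = logD1 x k B := by
    intro k; simp [logD1]
  have hd2 : ∀ k, logD2 x k B = logD2 x k (Matrix.diagonal fun a => B a a)
      - ∑ a, ∑ b ∈ univ.erase a, B a b ^ 2 * w2 x k a b := by
    intro k
    rw [logD2, logD2, hd1, sub_right_comm, ← sum_sub_distrib]
    congr 1
    refine sum_congr rfl fun a _ => ?_
    rw [← sum_sub_distrib]
    refine sum_congr rfl fun b hb => ?_
    rw [Matrix.diagonal_apply_ne _ (ne_of_mem_erase hb), hB b a]
    simp only [Matrix.diagonal_apply_eq]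
    ring
  have hsplit : ∑ a, ∑ b, f a * (B a b ^ 2 / x b) = ∑ a, f a * (B a a ^ 2 / x a)
      + ∑ a, ∑ b ∈ univ.erase a, f a * (B a b ^ 2 / x b) := by
    rw [← sum_add_distrib]
    exact sum_congr rfl fun a _ => (add_sum_erase univ _ (mem_univ a)).symm
  have hswap : ∑ a, ∑ b ∈ univ.erase a, f a * (B a b ^ 2 / x b)
      = ∑ a, ∑ b ∈ univ.erase a, f b * (B a b ^ 2 / x a) := by
    rw [sum_comm' (t' := univ) (s' := fun b => univ.erase b)]
    · refine sum_congr rfl fun a _ => sum_congr rfl fun b _ => ?_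
      rw [hB b a]
    · intro a b; simp [eq_comm]
  have hoff : ∑ a, ∑ b ∈ univ.erase a, B a b ^ 2 * w2 x (i + 1) a b
      - ∑ a, ∑ b ∈ univ.erase a, B a b ^ 2 * w2 x i a b
      ≤ 2 * ∑ a, ∑ b ∈ univ.erase a, f a * (B a b ^ 2 / x b) := by
    rw [two_mul]
    nth_rewrite 2 [hswap]
    rw [← sum_add_distrib, ← sum_sub_distrib]
    refine sum_le_sum fun a _ => ?_
    rw [← sum_add_distrib, ← sum_sub_distrib]
    refine sum_le_sum fun b hb => ?_
    rcases (hx a).lt_or_eq with ha | ha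
    · rcases (hx b).lt_or_eq with hb' | hb'
      · have h2 := inverse_concavity_offDiagonal hx hi hb ha hb'
        have h3 := mul_le_mul_of_nonneg_left h2 (sq_nonneg (B a b))
        calc _ = B a b ^ 2 * (w2 x (i + 1) a b - w2 x i a b) := by ring
          _ ≤ _ := h3
          _ = _ := by simp only [hf]; ring
      · simp [hB a b, hB0 b a hb'.symm]
    · simp [hB0 a b ha.symm]
  rw [hd1, hd1] at h1
  rw [hd2, hd2, hsplit]
  linarith

/-- Inverse concavity of `(σ_k / σ_l) ^ (1 / (k - l))`, in infinitesimal form, at a positive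
semidefinite diagonal matrix. -/
theorem inverse_concavity {x : ι → ℝ} (hx : ∀ a, 0 ≤ x a) {B : Matrix ι ι ℝ}
    (hB : ∀ a b, B a b = B b a) (hB0 : ∀ a b, x a = 0 → B a b = 0) {k l : ℕ} (hlk : l < k)
    (hk : 0 < es univ x k) :
    (logD1 x k B - logD1 x l B) ^ 2 / (k - l) ≤ logD2 x k B - logD2 x l B
      + 2 * ∑ a, ∑ b, (w1 x k a - w1 x l a) * (B a b ^ 2 / x b) := by
  induction k, hlk using Nat.le_induction with
  | base =>
    have := inverse_concavity_succ hx hB hB0 (i := l) (by exact_mod_cast hk)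
    push_cast
    simpa using this
  | succ k hk' ih =>
    have h1 := inverse_concavity_succ hx hB hB0 (i := k) (by exact_mod_cast hk)
    have h2 := ih (es_pos_of_le _ hx (by omega) (by push_cast; omega) hk)
    have hsum : ∑ a, ∑ b, (w1 x (k + 1) a - w1 x l a) * (B a b ^ 2 / x b)
        = ∑ a, ∑ b, (w1 x (k + 1) a - w1 x k a) * (B a b ^ 2 / x b)
          + ∑ a, ∑ b, (w1 x k a - w1 x l a) * (B a b ^ 2 / x b) := by
      simp only [← sum_add_distrib]
      exact sum_congr rfl fun a _ => sum_congr rfl fun b _ => by ring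
    rw [hsum]
    have hm : (0 : ℝ) < k - l := by
      have : (l : ℝ) + 1 ≤ k := by exact_mod_cast hk'
      linarith
    set X := logD1 x (k + 1) B - logD1 x k B
    set Y := logD1 x k B - logD1 x l B
    -- Telescoping combines the weights `1` and `m = k - l` by Cauchy–Schwarz: (X+Y)²/(m+1) ≤ X² +
    -- Y²/m.
    have h3 : (logD1 x (k + 1) B - logD1 x l B) ^ 2 / (((k + 1 : ℕ) : ℝ) - l)
        ≤ X ^ 2 + Y ^ 2 / (k - l) := by
      push_cast
      rw [show logD1 x (k + 1) B - logD1 x l B = X + Y by ring,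
        show (k : ℝ) + 1 - l = (k - l) + 1 by ring, div_le_iff₀ (by linarith)]
      set m : ℝ := k - l
      have : (X ^ 2 + Y ^ 2 / m) * (m + 1) - (X + Y) ^ 2 = (m * X - Y) ^ 2 / m := by
        field_simp; ring
      have h4 : 0 ≤ (m * X - Y) ^ 2 / m := by positivity
      linarith
    linarith

/-- On the compact set where `0 ≤ x ≤ L` and `σ_k ≥ κ`, the denominators do not vanish, so all the
quotients and the inverse of the positive ellipticity factor are continuous and hence bounded. -/
theorem exists_bounds {k l : ℕ} (hlk : l < k) (L : ℝ) {κ : ℝ} (hκ : 0 < κ) :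
    ∃ c C : ℝ, 0 < c ∧ 0 ≤ C ∧ ∀ x : ι → ℝ, (∀ a, 0 ≤ x a) → (∀ a, x a ≤ L) → κ ≤ es univ x k →
      (∀ a, c ≤ w1 x k a - w1 x l a) ∧ (∀ j, j = k ∨ j = l → ∀ a, |w1 x j a| ≤ C) ∧
      ∀ j, j = k ∨ j = l → ∀ a b, |w2 x j a b| ≤ C := by
  let S : Set (ι → ℝ) := Set.Icc 0 (fun _ => L) ∩ {x | κ ≤ es univ x k}
  have hS : IsCompact S := isCompact_Icc.inter_right
    (isClosed_le continuous_const (continuous_es univ k))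
  have hpos : ∀ x ∈ S, ∀ j, j = k ∨ j = l → 0 < es univ x j := by
    intro x hx j hj
    refine es_pos_of_le univ (fun a => hx.1.1 a) (by omega) (j := k) (by omega) (hκ.trans_le hx.2)
  have hw1 : ∀ j, j = k ∨ j = l → ∀ a, ContinuousOn (fun x : ι → ℝ => w1 x j a) S := fun j hj a =>
    (continuous_es _ _).continuousOn.div (continuous_es _ _).continuousOn
      fun x hx => (hpos x hx j hj).ne'
  have hw2 : ∀ j, j = k ∨ j = l → ∀ a b, ContinuousOn (fun x : ι → ℝ => w2 x j a b) S :=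
    fun j hj a b => (continuous_es _ _).continuousOn.div (continuous_es _ _).continuousOn
      fun x hx => (hpos x hx j hj).ne'
  have hinv : ∀ a, ContinuousOn (fun x : ι → ℝ => (w1 x k a - w1 x l a)⁻¹) S := fun a =>
    ((hw1 k (Or.inl rfl) a).sub (hw1 l (Or.inr rfl) a)).inv₀ fun x hx =>
      (w1_sub_w1_pos (fun a => hx.1.1 a) hlk (hpos x hx k (Or.inl rfl)) a).ne'
  choose C1 hC1 using fun (j : {j // j = k ∨ j = l}) a =>
    hS.exists_bound_of_continuousOn (hw1 j j.2 a)
  choose C2 hC2 using fun (j : {j // j = k ∨ j = l}) a b =>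
    hS.exists_bound_of_continuousOn (hw2 j j.2 a b)
  choose C3 hC3 using fun a => hS.exists_bound_of_continuousOn (hinv a)
  have hfin : Finite {j // j = k ∨ j = l} := (Set.toFinite ({k, l} : Set ℕ)).subset
    (fun j hj => by simpa using show j = k ∨ j = l from hj)
  obtain ⟨D1, hD1⟩ := (Set.finite_range fun p : {j // j = k ∨ j = l} × ι => C1 p.1 p.2).bddAbove
  obtain ⟨D2, hD2⟩ :=
    (Set.finite_range fun p : {j // j = k ∨ j = l} × ι × ι => C2 p.1 p.2.1 p.2.2).bddAbove
  obtain ⟨D3, hD3⟩ := (Set.finite_range C3).bddAbove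
  refine ⟨(max D3 1)⁻¹, max (max D1 D2) 0, by positivity, le_max_right _ _, ?_⟩
  intro x h0 h1 h2
  have hx : x ∈ S := ⟨⟨h0, h1⟩, h2⟩
  refine ⟨fun a => ?_, fun j hj a => ?_, fun j hj a b => ?_⟩
  · have hp := w1_sub_w1_pos h0 hlk (hpos x hx k (Or.inl rfl)) a
    rw [inv_le_comm₀ (by positivity) hp]
    have h3 := hC3 a x hx
    rw [Real.norm_of_nonneg (inv_pos.2 hp).le] at h3
    exact h3.trans ((hD3 ⟨a, rfl⟩).trans (le_max_left _ _))
  · exact (hC1 ⟨j, hj⟩ a x hx).trans ((hD1 ⟨(⟨j, hj⟩, a), rfl⟩).trans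
      ((le_max_left _ _).trans (le_max_left _ _)))
  · exact (hC2 ⟨j, hj⟩ a b x hx).trans ((hD2 ⟨(⟨j, hj⟩, a, b), rfl⟩).trans
      ((le_max_right _ _).trans (le_max_left _ _)))

theorem abs_logD1_le {x : ι → ℝ} {j : ℕ} {C η : ℝ} (hw : ∀ a, |w1 x j a| ≤ C)
    {B : Matrix ι ι ℝ} (hB : ∀ a b, |B a b| ≤ η) : |logD1 x j B| ≤ Fintype.card ι * (η * C) := by
  refine (abs_sum_le_sum_abs _ _).trans ?_
  rw [← card_univ, ← nsmul_eq_mul]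
  refine sum_le_card_nsmul _ _ _ fun a _ => ?_
  rw [abs_mul]
  exact mul_le_mul (hB a a) (hw a) (abs_nonneg _) ((abs_nonneg _).trans (hB a a))

theorem abs_logD2_sub_le {x : ι → ℝ} {j : ℕ} {C L η : ℝ} (hC : 0 ≤ C)
    (hw : ∀ a, |w1 x j a| ≤ C) (hw2 : ∀ a b, |w2 x j a b| ≤ C)
    {B B' : Matrix ι ι ℝ} (hB : ∀ a b, |B a b| ≤ L) (hB' : ∀ a b, |B' a b| ≤ L)
    (hd : ∀ a b, |B a b - B' a b| ≤ η) :
    |logD2 x j B - logD2 x j B'|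
      ≤ (Fintype.card ι * (Fintype.card ι * (4 * L * C)) + 2 * Fintype.card ι ^ 2 * C ^ 2 * L) * η := by
  have hprod : ∀ a b c d, |B a b * B c d - B' a b * B' c d| ≤ 2 * L * η := by
    intro a b c d
    have h1 : B a b * B c d - B' a b * B' c d
        = (B a b - B' a b) * B c d + B' a b * (B c d - B' c d) := by ring
    have hη : 0 ≤ η := (abs_nonneg _).trans (hd a b)
    have hL : 0 ≤ L := (abs_nonneg _).trans (hB a b)
    rw [h1]
    refine (abs_add_le _ _).trans ?_
    rw [abs_mul, abs_mul]
    nlinarith [mul_le_mul (hd a b) (hB c d) (abs_nonneg _) hη,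
      mul_le_mul (hB' a b) (hd c d) (abs_nonneg _) hL]
  have h1 : |∑ a, ∑ b ∈ univ.erase a, (B a a * B b b - B a b * B b a) * w2 x j a b
      - ∑ a, ∑ b ∈ univ.erase a, (B' a a * B' b b - B' a b * B' b a) * w2 x j a b|
      ≤ Fintype.card ι * (Fintype.card ι * (4 * L * C * η)) := by
    rw [← sum_sub_distrib]
    refine (abs_sum_le_sum_abs _ _).trans ?_
    rw [← card_univ, ← nsmul_eq_mul]
    refine sum_le_card_nsmul _ _ _ fun a _ => ?_
    rw [← sum_sub_distrib]
    refine (abs_sum_le_sum_abs _ _).trans ?_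
    have hη : 0 ≤ η := (abs_nonneg _).trans (hd a a)
    have hL : 0 ≤ L := (abs_nonneg _).trans (hB a a)
    refine (sum_le_card_nsmul _ _ (4 * L * C * η) fun b _ => ?_).trans ?_
    · rw [← sub_mul, abs_mul]
      have h2 : |B a a * B b b - B a b * B b a - (B' a a * B' b b - B' a b * B' b a)|
          ≤ 4 * L * η := by
        rw [show B a a * B b b - B a b * B b a - (B' a a * B' b b - B' a b * B' b a)
          = (B a a * B b b - B' a a * B' b b) - (B a b * B b a - B' a b * B' b a) by ring]
        refine (abs_sub _ _).trans ?_
        linarith [hprod a a b b, hprod a b b a]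
      calc _ ≤ 4 * L * η * C := mul_le_mul h2 (hw2 a b) (abs_nonneg _) (by positivity)
        _ = _ := by ring
    · rw [nsmul_eq_mul]
      refine mul_le_mul_of_nonneg_right ?_ (by positivity)
      exact_mod_cast card_le_card (erase_subset a univ)
  have h2 : |logD1 x j B ^ 2 - logD1 x j B' ^ 2| ≤ 2 * Fintype.card ι ^ 2 * C ^ 2 * L * η := by
    have e1 : logD1 x j B ^ 2 - logD1 x j B' ^ 2
        = logD1 x j (B - B') * (logD1 x j B + logD1 x j B') := by
      have : logD1 x j (B - B') = logD1 x j B - logD1 x j B' := by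
        simp [logD1, sub_mul]
      rw [this]; ring
    have h3 := abs_logD1_le hw hB
    have h4 := abs_logD1_le hw hB'
    have h5 := abs_logD1_le (B := B - B') hw hd
    rw [e1, abs_mul]
    have h6 := (abs_add_le (logD1 x j B) (logD1 x j B')).trans (add_le_add h3 h4)
    calc _ ≤ (Fintype.card ι * (η * C)) * (Fintype.card ι * (L * C) + Fintype.card ι * (L * C)) :=
          mul_le_mul h5 h6 (abs_nonneg _) ((abs_nonneg _).trans h5)
      _ = _ := by ring
  rw [logD2, logD2]
  have h7 := abs_le.1 h1
  have h8 := abs_le.1 h2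
  rw [abs_le]
  constructor <;> nlinarith

/-- Inverse concavity for a symmetric matrix that is small outside of a block on which the
diagonal matrix is positive definite, with constants that are uniform on compact sets. -/
theorem exists_inverse_concavity_perturbed {k l : ℕ} (hlk : l < k) (L : ℝ) {κ : ℝ} (hκ : 0 < κ) :
    ∃ c C : ℝ, 0 < c ∧ 0 ≤ C ∧ ∀ x : ι → ℝ, (∀ a, 0 ≤ x a) → (∀ a, x a ≤ L) → κ ≤ es univ x k →
      (∀ a, c ≤ w1 x k a - w1 x l a ∧ w1 x k a - w1 x l a ≤ C) ∧
      ∀ (J : Finset ι) (B : Matrix ι ι ℝ) (η : ℝ), 0 ≤ η → (∀ a ∈ J, 0 < x a) → (∀ a b, B a b = B b a) →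
        (∀ a b, |B a b| ≤ L) → (∀ a b, a ∉ J → |B a b| ≤ η) →
        (logD1 x k B - logD1 x l B) ^ 2 / (k - l) ≤ logD2 x k B - logD2 x l B
          + 2 * ∑ a ∈ J, ∑ b ∈ J, (w1 x k a - w1 x l a) * (B a b ^ 2 / x b) + C * η := by
  obtain ⟨c, C, hc, hC, h⟩ := exists_bounds (ι := ι) hlk L hκ
  have hm : (1 : ℝ) ≤ k - l := by
    have : (l : ℝ) + 1 ≤ k := by exact_mod_cast hlk
    linarith
  set D : ℝ := (Fintype.card ι : ℝ) * ((Fintype.card ι : ℝ) * (4 * L * C)) + 2 * Fintype.card ι ^ 2 * C ^ 2 * L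
    with hD
  set N : ℝ := (Fintype.card ι : ℝ) with hN
  refine ⟨c, max (2 * C) (2 * D + 8 * N ^ 2 * C ^ 2 * L), hc, le_max_of_le_left (by positivity), ?_⟩
  intro x h0 h1 h2
  obtain ⟨h3, h4, h5⟩ := h x h0 h1 h2
  refine ⟨fun a => ⟨h3 a, le_max_of_le_left ?_⟩, ?_⟩
  · have := abs_le.1 (h4 k (Or.inl rfl) a)
    have := abs_le.1 (h4 l (Or.inr rfl) a)
    linarith
  intro J B η hη hJ hB hBL hBη
  rcases isEmpty_or_nonempty ι with hι | ⟨⟨a₀⟩⟩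
  · have hk0 : 0 < es univ x k := hκ.trans_le h2
    rw [univ_eq_empty, es_empty, if_neg (by omega)] at hk0
    exact absurd hk0 (lt_irrefl _)
  have hL : 0 ≤ L := (h0 a₀).trans (h1 a₀)
  -- Truncation to the block `J` restores the requirement that `B` vanish in the null directions of
  -- `x`; the truncation changes all terms by a multiple of `η` only.
  let B' : Matrix ι ι ℝ := fun a b => if a ∈ J ∧ b ∈ J then B a b else 0
  have hB' : ∀ a b, B' a b = B' b a := fun a b => by simp only [B', and_comm, hB a b]
  have hB'0 : ∀ a b, x a = 0 → B' a b = 0 := fun a b ha => by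
    have : a ∉ J := fun hJa => (hJ a hJa).ne' ha
    simp [B', this]
  have hB'L : ∀ a b, |B' a b| ≤ L := fun a b => by
    by_cases hab : a ∈ J ∧ b ∈ J
    · simpa [B', hab] using hBL a b
    · simpa [B', hab] using hL
  have hd : ∀ a b, |B a b - B' a b| ≤ η := fun a b => by
    by_cases ha : a ∈ J
    · by_cases hb : b ∈ J
      · simpa [B', ha, hb] using hη
      · simpa [B', hb, hB a b] using hBη b a hb
    · simpa [B', ha] using hBη a b ha
  have h6 := inverse_concavity h0 hB' hB'0 hlk (hκ.trans_le h2)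
  have hsum : ∑ a, ∑ b, (w1 x k a - w1 x l a) * (B' a b ^ 2 / x b)
      = ∑ a ∈ J, ∑ b ∈ J, (w1 x k a - w1 x l a) * (B a b ^ 2 / x b) := by
    rw [← sum_subset (subset_univ J)]
    · refine sum_congr rfl fun a ha => ?_
      rw [← sum_subset (subset_univ J)]
      · refine sum_congr rfl fun b hb => ?_
        simp [B', ha, hb]
      · intro b _ hb
        simp [B', hb]
    · intro a _ ha
      simp [B', ha]
  rw [hsum] at h6
  have h7 := abs_le.1 (abs_logD2_sub_le hC (h4 k (Or.inl rfl)) (h5 k (Or.inl rfl)) hBL hB'L hd)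
  have h8 := abs_le.1 (abs_logD2_sub_le hC (h4 l (Or.inr rfl)) (h5 l (Or.inr rfl)) hBL hB'L hd)
  have h9 : (logD1 x k B - logD1 x l B) ^ 2 / (k - l)
      ≤ (logD1 x k B' - logD1 x l B') ^ 2 / (k - l) + 8 * N ^ 2 * C ^ 2 * L * η := by
    set p := logD1 x k B - logD1 x l B
    set q := logD1 x k B' - logD1 x l B'
    have e1 : p - q = logD1 x k (B - B') - logD1 x l (B - B') := by
      simp only [p, q, logD1, Matrix.sub_apply, sub_mul, sum_sub_distrib]
      ring
    have b1 := abs_le.1 (abs_logD1_le (h4 k (Or.inl rfl)) hBL)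
    have b2 := abs_le.1 (abs_logD1_le (h4 l (Or.inr rfl)) hBL)
    have b3 := abs_le.1 (abs_logD1_le (h4 k (Or.inl rfl)) hB'L)
    have b4 := abs_le.1 (abs_logD1_le (h4 l (Or.inr rfl)) hB'L)
    have b5 := abs_le.1 (abs_logD1_le (B := B - B') (h4 k (Or.inl rfl)) hd)
    have b6 := abs_le.1 (abs_logD1_le (B := B - B') (h4 l (Or.inr rfl)) hd)
    have c1 : |p - q| ≤ 2 * (N * (η * C)) := by rw [e1, abs_le]; constructor <;> linarith
    have c2 : |p + q| ≤ 4 * (N * (L * C)) := by rw [abs_le]; constructor <;> linarith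
    have c3 : p ^ 2 - q ^ 2 ≤ 8 * N ^ 2 * C ^ 2 * L * η := by
      calc p ^ 2 - q ^ 2 = (p - q) * (p + q) := by ring
        _ ≤ |(p - q) * (p + q)| := le_abs_self _
        _ ≤ 2 * (N * (η * C)) * (4 * (N * (L * C))) := by
          rw [abs_mul]
          exact mul_le_mul c1 c2 (abs_nonneg _) ((abs_nonneg _).trans c1)
        _ = _ := by ring
    rw [← sub_le_iff_le_add', ← sub_div]
    refine (div_le_div_of_nonneg_right c3 (by linarith)).trans ?_
    exact div_le_self (by positivity) hm
  have h10 : (2 * D + 8 * N ^ 2 * C ^ 2 * L) * η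
      ≤ max (2 * C) (2 * D + 8 * N ^ 2 * C ^ 2 * L) * η :=
    mul_le_mul_of_nonneg_right (le_max_right _ _) hη
  linarith

end Quotients

end CapillaryRank

set_option maxSynthPendingDepth 3

namespace CapillaryRank

open Filter Topology

section Calculus

variable {E : Type*} [NormedAddCommGroup E] [InnerProductSpace ℝ E]

/-! ### Circular cones -/

/-- The closed circular cone with axis `a`, without its vertex. -/
def Cone (a : E) (c : ℝ) : Set E := {y | y ≠ 0 ∧ c * ‖y‖ ≤ ⟪a, y⟫}

/-- The open circular cone with axis `a`. -/
def OpenCone (a : E) (c : ℝ) : Set E := {y | c * ‖y‖ < ⟪a, y⟫}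

variable {a : E} {c : ℝ}

theorem isOpen_openCone : IsOpen (OpenCone a c) :=
  isOpen_lt (continuous_const.mul continuous_norm) (continuous_const.inner continuous_id)

theorem inner_pos_of_mem_cone (hc : 0 < c) {y : E} (hy : y ∈ Cone a c) : 0 < ⟪a, y⟫ :=
  (mul_pos hc (norm_pos_iff.2 hy.1)).trans_le hy.2

theorem openCone_subset_cone : OpenCone a c ⊆ Cone a c := by
  intro y hy
  refine ⟨fun h => ?_, le_of_lt hy⟩
  rw [OpenCone, Set.mem_ofPred_eq, h] at hy
  simp at hy

theorem cone_mem_nhds {y : E} (hy : y ∈ OpenCone a c) : Cone a c ∈ 𝓝 y :=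
  mem_of_superset (isOpen_openCone.mem_nhds hy) openCone_subset_cone

theorem convex_cone (hc : 0 < c) : Convex ℝ (Cone a c) := by
  intro y hy z hz s t hs ht hst
  have h1 : c * ‖s • y + t • z‖ ≤ ⟪a, s • y + t • z⟫ := by
    have h2 := norm_add_le (s • y) (t • z)
    rw [norm_smul, norm_smul, Real.norm_of_nonneg hs, Real.norm_of_nonneg ht] at h2
    rw [inner_add_right, inner_smul_right, inner_smul_right]
    nlinarith [mul_le_mul_of_nonneg_left h2 hc.le, mul_le_mul_of_nonneg_left hy.2 hs,
      mul_le_mul_of_nonneg_left hz.2 ht]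
  refine ⟨fun h => ?_, h1⟩
  have h3 : 0 < ⟪a, s • y + t • z⟫ := by
    rw [inner_add_right, inner_smul_right, inner_smul_right]
    have hy' := inner_pos_of_mem_cone hc hy
    have hz' := inner_pos_of_mem_cone hc hz
    rcases hs.lt_or_eq with hs' | hs'
    · exact add_pos_of_pos_of_nonneg (mul_pos hs' hy') (mul_nonneg ht hz'.le)
    · have : t = 1 := by linarith
      rw [← hs', this]; simpa using hz'
  rw [h, inner_zero_right] at h3
  exact lt_irrefl _ h3

theorem smul_mem_cone {y : E} (hy : y ∈ Cone a c) {t : ℝ} (ht : 0 < t) : t • y ∈ Cone a c := by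
  refine ⟨smul_ne_zero ht.ne' hy.1, ?_⟩
  rw [norm_smul, Real.norm_of_nonneg ht.le, inner_smul_right]
  nlinarith [mul_le_mul_of_nonneg_left hy.2 ht.le]

theorem smul_mem_openCone {y : E} (hy : y ∈ OpenCone a c) {t : ℝ} (ht : 0 < t) :
    t • y ∈ OpenCone a c := by
  rw [OpenCone, Set.mem_ofPred_eq, norm_smul, Real.norm_of_nonneg ht.le, inner_smul_right]
  nlinarith [mul_lt_mul_of_pos_left hy ht]

theorem add_mem_openCone (hc : 0 < c) {y z : E} (hy : y ∈ Cone a c) (hz : z ∈ OpenCone a c) :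
    y + z ∈ OpenCone a c := by
  rw [OpenCone, Set.mem_ofPred_eq, inner_add_right]
  have h1 : c * ‖z‖ < ⟪a, z⟫ := hz
  nlinarith [mul_le_mul_of_nonneg_left (norm_add_le y z) hc.le, hy.2]

theorem convex_openCone (hc : 0 < c) : Convex ℝ (OpenCone a c) := by
  intro y hy z hz s t hs ht hst
  rcases hs.lt_or_eq with hs' | hs'
  · rcases ht.lt_or_eq with ht' | ht'
    · exact add_mem_openCone hc (openCone_subset_cone (smul_mem_openCone hy hs'))
        (smul_mem_openCone hz ht')
    · have : s = 1 := by linarith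
      simpa [← ht', this] using hy
  · have : t = 1 := by linarith
    simpa [← hs', this] using hz

theorem axis_mem_openCone (ha : ‖a‖ = 1) (hc1 : c < 1) : a ∈ OpenCone a c := by
  rw [OpenCone, Set.mem_ofPred_eq, real_inner_self_eq_norm_sq, ha]
  simpa using hc1

/-- A small multiple of the axis pushes any point of the cone into the open cone. This density is
what symmetry of derivatives within the cone requires at boundary points. -/
theorem cone_subset_closure (ha : ‖a‖ = 1) (hc : 0 < c) (hc1 : c < 1) :
    Cone a c ⊆ closure (OpenCone a c) := by
  intro y hy
  have h1 : Tendsto (fun t : ℝ => y + t • a) (𝓝[>] 0) (𝓝 y) := by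
    have : ContinuousAt (fun t : ℝ => y + t • a) 0 := by fun_prop
    have h2 := this.tendsto
    rw [zero_smul, add_zero] at h2
    exact h2.mono_left nhdsWithin_le_nhds
  refine mem_closure_of_tendsto h1 ?_
  filter_upwards [self_mem_nhdsWithin] with t ht
  exact add_mem_openCone hc hy (smul_mem_openCone (axis_mem_openCone ha hc1) ht)

theorem openCone_subset_interior : OpenCone a c ⊆ interior (Cone a c) :=
  interior_maximal openCone_subset_cone isOpen_openCone

theorem uniqueDiffOn_cone (ha : ‖a‖ = 1) (hc : 0 < c) (hc1 : c < 1) :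
    UniqueDiffOn ℝ (Cone a c) :=
  uniqueDiffOn_convex (convex_cone hc) ⟨a, openCone_subset_interior (axis_mem_openCone ha hc1)⟩

/-! ### Derivatives within a set -/

/-- The second derivative within a set. -/
def hes (K : Set E) (F : E → ℝ) : E → E →L[ℝ] E →L[ℝ] ℝ :=
  fderivWithin ℝ (fderivWithin ℝ F K) K

/-- The third derivative within a set. -/
def thd (K : Set E) (F : E → ℝ) : E → E →L[ℝ] E →L[ℝ] E →L[ℝ] ℝ :=
  fderivWithin ℝ (hes K F) K

/-- The fourth derivative within a set. -/
def fth (K : Set E) (F : E → ℝ) : E → E →L[ℝ] E →L[ℝ] E →L[ℝ] E →L[ℝ] ℝ :=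
  fderivWithin ℝ (thd K F) K

section Smooth

variable {K : Set E} {F : E → ℝ}

theorem hasFDerivWithinAt_self (hF : ContDiffOn ℝ 4 F K) {y : E} (hy : y ∈ K) :
    HasFDerivWithinAt F (fderivWithin ℝ F K y) K y :=
  ((hF.differentiableOn (by norm_num)) y hy).hasFDerivWithinAt

variable (hK : UniqueDiffOn ℝ K) (hF : ContDiffOn ℝ 4 F K)
include hK hF

theorem contDiffOn_fderivWithin : ContDiffOn ℝ 3 (fderivWithin ℝ F K) K :=
  hF.fderivWithin hK (by norm_num)

theorem contDiffOn_hes : ContDiffOn ℝ 2 (hes K F) K :=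
  (contDiffOn_fderivWithin hK hF).fderivWithin hK (by norm_num)

theorem contDiffOn_thd : ContDiffOn ℝ 1 (thd K F) K :=
  (contDiffOn_hes hK hF).fderivWithin hK (by norm_num)

variable {y : E} (hy : y ∈ K)
include hy

theorem hasFDerivWithinAt_fderivWithin :
    HasFDerivWithinAt (fderivWithin ℝ F K) (hes K F y) K y :=
  (((contDiffOn_fderivWithin hK hF).differentiableOn (by norm_num)) y hy).hasFDerivWithinAt

theorem hasFDerivWithinAt_hes : HasFDerivWithinAt (hes K F) (thd K F y) K y :=
  (((contDiffOn_hes hK hF).differentiableOn (by norm_num)) y hy).hasFDerivWithinAt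

theorem hasFDerivWithinAt_thd : HasFDerivWithinAt (thd K F) (fth K F y) K y :=
  (((contDiffOn_thd hK hF).differentiableOn (by norm_num)) y hy).hasFDerivWithinAt

variable (hcl : K ⊆ closure (interior K))
include hcl

theorem hes_symm (u v : E) : hes K F y u v = hes K F y v u :=
  (hF y hy).isSymmSndFDerivWithinAt (by simp; norm_num) hK (hcl hy) hy u v

theorem thd_swap (u v : E) : thd K F y u v = thd K F y v u :=
  ((contDiffOn_fderivWithin hK hF) y hy).isSymmSndFDerivWithinAt (by simp; norm_num) hK (hcl hy) hy u v

theorem fth_swap (u v : E) : fth K F y u v = fth K F y v u :=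
  ((contDiffOn_hes hK hF) y hy).isSymmSndFDerivWithinAt (by simp) hK (hcl hy) hy u v

theorem thd_symm (u v w : E) : thd K F y u v w = thd K F y u w v := by
  have h := hasFDerivWithinAt_hes hK hF hy
  have h1 := (h.clm_apply (hasFDerivWithinAt_const v y K)).clm_apply
    (hasFDerivWithinAt_const w y K)
  have h2 := (h.clm_apply (hasFDerivWithinAt_const w y K)).clm_apply
    (hasFDerivWithinAt_const v y K)
  have h3 := (hK y hy).eq (h1.congr (fun z hz => (hes_symm hK hF hz hcl w v))
    (hes_symm hK hF hy hcl w v)) h2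
  simpa using DFunLike.congr_fun h3 u

theorem fth_swap' (u v w : E) : fth K F y u v w = fth K F y u w v := by
  have h := hasFDerivWithinAt_thd hK hF hy
  have h1 := (h.clm_apply (hasFDerivWithinAt_const v y K)).clm_apply
    (hasFDerivWithinAt_const w y K)
  have h2 := (h.clm_apply (hasFDerivWithinAt_const w y K)).clm_apply
    (hasFDerivWithinAt_const v y K)
  have h3 := (hK y hy).eq (h1.congr (fun z hz => (thd_swap hK hF hz hcl w v))
    (thd_swap hK hF hy hcl w v)) h2
  simpa using DFunLike.congr_fun h3 u

theorem fth_symm (u v w z : E) : fth K F y u v w z = fth K F y u v z w := by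
  have h := hasFDerivWithinAt_thd hK hF hy
  have h1 := ((h.clm_apply (hasFDerivWithinAt_const v y K)).clm_apply
    (hasFDerivWithinAt_const w y K)).clm_apply (hasFDerivWithinAt_const z y K)
  have h2 := ((h.clm_apply (hasFDerivWithinAt_const v y K)).clm_apply
    (hasFDerivWithinAt_const z y K)).clm_apply (hasFDerivWithinAt_const w y K)
  have h3 := (hK y hy).eq (h1.congr (fun x hx => (thd_symm hK hF hx hcl v z w))
    (thd_symm hK hF hy hcl v z w)) h2
  simpa using DFunLike.congr_fun h3 u

/-- Flat derivatives commute without curvature terms, the advantage of the homogeneous extension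
over covariant derivatives on the sphere. -/
theorem fth_exchange (u v : E) : fth K F y u u v v = fth K F y v v u u := by
  rw [fth_swap' hK hF hy hcl, fth_swap hK hF hy hcl, fth_symm hK hF hy hcl,
    fth_swap' hK hF hy hcl]

end Smooth

/-! ### Jets along lines -/

theorem HasJet2.of_hasFDerivAt {F : Type*} [NormedAddCommGroup F] [NormedSpace ℝ F] {G : E → F}
    {G1 : E → E →L[ℝ] F} {G2 : E →L[ℝ] E →L[ℝ] F} {x : E}
    (h1 : ∀ᶠ y in 𝓝 x, HasFDerivAt G (G1 y) y) (h2 : HasFDerivAt G1 G2 x) (φ : F →L[ℝ] ℝ)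
    (ξ : E) : HasJet2 (fun t : ℝ => φ (G (x + t • ξ))) (φ (G1 x ξ)) (φ (G2 ξ ξ)) := by
  have hline : ∀ t : ℝ, HasDerivAt (fun t : ℝ => x + t • ξ) ξ t := fun t =>
    (((hasDerivAt_id t).smul_const ξ).const_add x).congr_deriv (one_smul ℝ ξ)
  have hcont : Tendsto (fun t : ℝ => x + t • ξ) (𝓝 0) (𝓝 x) := by
    have := (hline 0).continuousAt.tendsto
    simpa using this
  refine ⟨fun t => φ (G1 (x + t • ξ) ξ), ?_, by simp, ?_⟩
  · filter_upwards [hcont.eventually h1] with t ht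
    exact φ.hasFDerivAt.comp_hasDerivAt t (ht.comp_hasDerivAt t (hline t))
  · have h3 : HasFDerivAt G1 G2 (x + (0 : ℝ) • ξ) := by simpa using h2
    have h4 : HasDerivAt (fun t : ℝ => G1 (x + t • ξ)) (G2 ξ) 0 := h3.comp_hasDerivAt (0 : ℝ) (hline 0)
    exact (φ.comp (ContinuousLinearMap.apply ℝ F ξ)).hasFDerivAt.comp_hasDerivAt (0 : ℝ) h4

section Lines

variable {K : Set E} {F : E → ℝ}

theorem eventually_hasFDerivAt_self (hF : ContDiffOn ℝ 4 F K) {x : E} (hx : K ∈ 𝓝 x) : ∀ᶠ y in 𝓝 x, HasFDerivAt F (fderivWithin ℝ F K y) y := by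
  filter_upwards [eventually_mem_nhds_iff.2 hx] with y hy
  exact (hasFDerivWithinAt_self hF (mem_of_mem_nhds hy)).hasFDerivAt hy

variable (hK : UniqueDiffOn ℝ K) (hF : ContDiffOn ℝ 4 F K) {x : E} (hx : K ∈ 𝓝 x)
include hK hF hx

theorem hasJet2_line (ξ : E) : HasJet2 (fun t : ℝ => F (x + t • ξ)) (fderivWithin ℝ F K x ξ)
    (hes K F x ξ ξ) := by
  simpa using HasJet2.of_hasFDerivAt (eventually_hasFDerivAt_self hF hx)
    ((hasFDerivWithinAt_fderivWithin hK hF (mem_of_mem_nhds hx)).hasFDerivAt hx)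
    (ContinuousLinearMap.id ℝ ℝ) ξ

theorem hasJet2_hes_line (ξ u w : E) : HasJet2 (fun t : ℝ => hes K F (x + t • ξ) u w)
    (thd K F x ξ u w) (fth K F x ξ ξ u w) := by
  have h1 : ∀ᶠ y in 𝓝 x, HasFDerivAt (hes K F) (thd K F y) y := by
    filter_upwards [eventually_mem_nhds_iff.2 hx] with y hy
    exact (hasFDerivWithinAt_hes hK hF (mem_of_mem_nhds hy)).hasFDerivAt hy
  simpa using HasJet2.of_hasFDerivAt h1
    ((hasFDerivWithinAt_thd hK hF (mem_of_mem_nhds hx)).hasFDerivAt hx)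
    ((ContinuousLinearMap.apply ℝ ℝ w).comp (ContinuousLinearMap.apply ℝ (E →L[ℝ] ℝ) u)) ξ

end Lines

/-! ### Homogeneous functions -/

section Homogeneous

variable {K : Set E} {F : E → ℝ} (hF : ContDiffOn ℝ 4 F K)
  (hKs : ∀ y ∈ K, ∀ t : ℝ, 0 < t → t • y ∈ K)
  (hhom : ∀ y ∈ K, ∀ t : ℝ, 0 < t → F (t • y) = t * F y)
include hF hKs hhom

theorem fderivWithin_apply_self {y : E} (hy : y ∈ K) : fderivWithin ℝ F K y y = F y := by
  have h1 : HasDerivWithinAt (fun t : ℝ => t • y) y (Set.Ioi 0) 1 := by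
    simpa using ((hasDerivAt_id (1 : ℝ)).smul_const y).hasDerivWithinAt
  have h2 : HasFDerivWithinAt F (fderivWithin ℝ F K y) K ((1 : ℝ) • y) := by
    rw [one_smul]; exact hasFDerivWithinAt_self hF hy
  have h3 := h2.comp_hasDerivWithinAt (1 : ℝ) h1 (fun t ht => hKs y hy t ht)
  have h4 : HasDerivWithinAt (fun t : ℝ => F (t • y)) (F y) (Set.Ioi 0) 1 := by
    have h5 : HasDerivWithinAt (fun t : ℝ => t * F y) (F y) (Set.Ioi 0) 1 := by
      simpa using ((hasDerivAt_id (1 : ℝ)).mul_const (F y)).hasDerivWithinAt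
    refine h5.congr (fun t ht => hhom y hy t ht) (hhom y hy 1 one_pos)
  exact ((isOpen_Ioi.uniqueDiffWithinAt (Set.mem_Ioi.2 one_pos)).eq_deriv _ h3 h4)

variable (hK : UniqueDiffOn ℝ K)
include hK

/-- Differentiate Euler's relation `DF(z) z = F(z)`. -/
theorem hes_apply_self {y : E} (hy : y ∈ K) (u : E) : hes K F y u y = 0 := by
  have h1 := (hasFDerivWithinAt_fderivWithin hK hF hy).clm_apply (hasFDerivWithinAt_id y K)
  have h2 := (hK y hy).eq (h1.congr
    (fun z hz => (fderivWithin_apply_self hF hKs hhom hz).symm)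
    (fderivWithin_apply_self hF hKs hhom hy).symm) (hasFDerivWithinAt_self hF hy)
  simpa using DFunLike.congr_fun h2 u

/-- Differentiate the relation `hes_apply_self`. It makes third derivatives with a radial entry as
small as the Hessian itself. -/
theorem thd_apply_self {y : E} (hy : y ∈ K) (w u : E) : thd K F y w u y = -hes K F y u w := by
  have h1 := ((hasFDerivWithinAt_hes hK hF hy).clm_apply (hasFDerivWithinAt_const u y K)).clm_apply
    (hasFDerivWithinAt_id y K)
  have h2 := (hK y hy).eq (h1.congr
    (fun z hz => (hes_apply_self hF hKs hhom hK hz u).symm)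
    (hes_apply_self hF hKs hhom hK hy u).symm) (hasFDerivWithinAt_const 0 y K)
  have h3 := DFunLike.congr_fun h2 w
  simp at h3
  linarith

theorem fderivWithin_smul {y : E} (hy : y ∈ K) {t : ℝ} (ht : 0 < t) :
    fderivWithin ℝ F K (t • y) = fderivWithin ℝ F K y := by
  have h1 := (hasFDerivWithinAt_self hF (hKs y hy t ht)).comp y
    ((hasFDerivWithinAt_id y K).const_smul t) (fun z hz => hKs z hz t ht)
  have h2 := (hK y hy).eq (h1.congr (fun z hz => (hhom z hz t ht).symm) (hhom y hy t ht).symm)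
    ((hasFDerivWithinAt_self hF hy).const_mul t)
  ext u
  have h3 := DFunLike.congr_fun h2 u
  simpa [ht.ne'] using h3

theorem hes_smul {y : E} (hy : y ∈ K) {t : ℝ} (ht : 0 < t) (u v : E) :
    hes K F (t • y) u v = t⁻¹ * hes K F y u v := by
  have h1 := (hasFDerivWithinAt_fderivWithin hK hF (hKs y hy t ht)).comp y
    ((hasFDerivWithinAt_id y K).const_smul t) (fun z hz => hKs z hz t ht)
  have h2 := (hK y hy).eq (h1.congr
    (fun z hz => (fderivWithin_smul hF hKs hhom hK hz ht).symm)
    (fderivWithin_smul hF hKs hhom hK hy ht).symm) (hasFDerivWithinAt_fderivWithin hK hF hy)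
  have h3 := DFunLike.congr_fun (DFunLike.congr_fun h2 u) v
  simp at h3
  rw [← h3]
  field_simp

end Homogeneous

end Calculus

end CapillaryRank

namespace CapillaryRank

open Filter Topology

/-! ### The differential inequality at a point where the smallest eigenvalue is touched -/

section Touching

variable {E : Type*} [NormedAddCommGroup E] [InnerProductSpace ℝ E]

/-- The matrix of a bilinear form. -/
def bmat {ι : Type*} [Fintype ι] (B : E →L[ℝ] E →L[ℝ] ℝ) (b : OrthonormalBasis ι ℝ E) :
    Matrix ι ι ℝ :=
  Matrix.of fun i j => B (b i) (b j)

theorem exists_eigenbasis [FiniteDimensional ℝ E] {B : E →L[ℝ] E →L[ℝ] ℝ} (hB : ∀ u v, B u v = B v u) :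
    ∃ (b : OrthonormalBasis (Fin (Module.finrank ℝ E)) ℝ E) (x : Fin (Module.finrank ℝ E) → ℝ),
      ∀ i u, B (b i) u = x i * ⟪b i, u⟫ := by
  have : CompleteSpace E := FiniteDimensional.complete ℝ E
  let T : E →ₗ[ℝ] E :=
    { toFun := fun u => (InnerProductSpace.toDual ℝ E).symm (B u)
      map_add' := fun u v => by simp
      map_smul' := fun r u => by simp }
  have hT : ∀ u v, ⟪T u, v⟫ = B u v := fun u v => InnerProductSpace.toDual_symm_apply
  have hsymm : T.IsSymmetric := fun u v => by
    rw [real_inner_comm (T v) u, hT, hT, hB]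
  refine ⟨hsymm.eigenvectorBasis rfl, hsymm.eigenvalues rfl, fun i u => ?_⟩
  rw [← hT, hsymm.apply_eigenvectorBasis]
  simp [inner_smul_left]

theorem bmat_eq_diagonal {ι : Type*} [Fintype ι] [DecidableEq ι] {B : E →L[ℝ] E →L[ℝ] ℝ}
    {b : OrthonormalBasis ι ℝ E} {x : ι → ℝ} (h : ∀ i u, B (b i) u = x i * ⟪b i, u⟫) :
    bmat B b = Matrix.diagonal x := by
  ext i j
  rw [bmat, Matrix.of_apply, h]
  rcases eq_or_ne i j with rfl | hij
  · simp
  · simp [b.inner_eq_zero hij, hij]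

/-- The extension by homogeneity of a solution of the Hessian quotient equation on a spherical
cap, together with the data in the equation. The Robin condition turns into a Neumann condition in
the direction of the axis of the cone. -/
structure IsSol (a : E) (c : ℝ) (k l : ℕ) (p : ℝ) (g H : E → ℝ) : Prop where
  norm_axis : ‖a‖ = 1
  c_pos : 0 < c
  c_lt : c < 1
  l_lt : l < k
  one_le_p : 1 ≤ p
  smooth_H : ContDiffOn ℝ 4 H (Cone a c)
  smooth_g : ContDiffOn ℝ 4 g (Cone a c)
  hom_H : ∀ y ∈ Cone a c, ∀ t : ℝ, 0 < t → H (t • y) = t * H y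
  hom_g : ∀ y ∈ Cone a c, ∀ t : ℝ, 0 < t → g (t • y) = t * g y
  pos_H : ∀ y ∈ Cone a c, 0 < H y
  pos_g : ∀ y ∈ Cone a c, 0 < g y
  convex_H : ∀ y ∈ Cone a c, ∀ u, 0 ≤ hes (Cone a c) H y u u
  convex_g : ∀ y ∈ Cone a c, ∀ u, 0 ≤ hes (Cone a c) g y u u
  boundary_H : ∀ y ∈ Cone a c, c * ‖y‖ = ⟪a, y⟫ → fderivWithin ℝ H (Cone a c) y a = 0
  boundary_g : ∀ y ∈ Cone a c, c * ‖y‖ = ⟪a, y⟫ → 0 ≤ fderivWithin ℝ g (Cone a c) y a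
  admissible : ∀ y ∈ Cone a c, ∀ b : OrthonormalBasis (Fin (Module.finrank ℝ E)) ℝ E,
    0 < msym (bmat (hes (Cone a c) H y) b) k
  equation : ∀ y ∈ Cone a c, ∀ b : OrthonormalBasis (Fin (Module.finrank ℝ E)) ℝ E,
    Real.log (msym (bmat (hes (Cone a c) H y) b) k)
      - Real.log (msym (bmat (hes (Cone a c) H y) b) l)
      = -(p + k - l - 1) * Real.log (g y) + (p - 1) * Real.log (H y)

/-- Inverse concavity of the quotient `σ_k / σ_l`, in quantitative form. -/
def InverseConcavityBound (ι : Type*) [Fintype ι] [DecidableEq ι] (k l : ℕ) (L κ c C : ℝ) : Prop :=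
  ∀ x : ι → ℝ, (∀ a, 0 ≤ x a) → (∀ a, x a ≤ L) → κ ≤ es Finset.univ x k →
    (∀ a, c ≤ w1 x k a - w1 x l a ∧ w1 x k a - w1 x l a ≤ C) ∧
    ∀ (J : Finset ι) (B : Matrix ι ι ℝ) (η : ℝ), 0 ≤ η → (∀ a ∈ J, 0 < x a) →
      (∀ a b, B a b = B b a) → (∀ a b, |B a b| ≤ L) → (∀ a b, a ∉ J → |B a b| ≤ η) →
      (logD1 x k B - logD1 x l B) ^ 2 / (k - l) ≤ logD2 x k B - logD2 x l B
        + 2 * ∑ a ∈ J, ∑ b ∈ J, (w1 x k a - w1 x l a) * (B a b ^ 2 / x b) + C * η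

namespace IsSol

variable {a : E} {c : ℝ} {k l : ℕ} {p : ℝ} {g H : E → ℝ}

theorem uniqueDiffOn (hS : IsSol a c k l p g H) : UniqueDiffOn ℝ (Cone a c) :=
  uniqueDiffOn_cone hS.norm_axis hS.c_pos hS.c_lt

theorem subset_closure (hS : IsSol a c k l p g H) : Cone a c ⊆ closure (interior (Cone a c)) :=
  (cone_subset_closure hS.norm_axis hS.c_pos hS.c_lt).trans (closure_mono openCone_subset_interior)

theorem hes_comm (hS : IsSol a c k l p g H) {y : E} (hy : y ∈ Cone a c) (u v : E) :
    hes (Cone a c) H y u v = hes (Cone a c) H y v u :=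
  hes_symm hS.uniqueDiffOn hS.smooth_H hy hS.subset_closure u v

theorem hes_self (hS : IsSol a c k l p g H) {y : E} (hy : y ∈ Cone a c) (u : E) :
    hes (Cone a c) H y u y = 0 :=
  hes_apply_self hS.smooth_H (fun _ hy _ ht => smul_mem_cone hy ht) hS.hom_H hS.uniqueDiffOn hy u

theorem hes_self' (hS : IsSol a c k l p g H) {y : E} (hy : y ∈ Cone a c) (u : E) :
    hes (Cone a c) H y y u = 0 := by
  rw [hS.hes_comm hy, hS.hes_self hy]

theorem thd_self (hS : IsSol a c k l p g H) {y : E} (hy : y ∈ Cone a c) (w u : E) :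
    thd (Cone a c) H y w u y = -hes (Cone a c) H y u w :=
  thd_apply_self hS.smooth_H (fun _ hy _ ht => smul_mem_cone hy ht) hS.hom_H hS.uniqueDiffOn
    hy w u

/-- The derivatives of the function that is minimal at a touching point. -/
theorem touching_jets (hS : IsSol a c k l p g H) {x₁ : E} (hx : x₁ ∈ OpenCone a c)
    {Ω : E → ℝ} {ω₁ ω₂ : E → ℝ}
    (hΩ : ∀ ξ, HasJet2 (fun t : ℝ => Ω (x₁ + t • ξ)) (ω₁ ξ) (ω₂ ξ)) {κ : ℝ}
    (htouch : ∀ᶠ x in 𝓝 x₁, ∀ u, Ω x * (‖u‖ ^ 2 - κ * ⟪u, x⟫ ^ 2) ≤ hes (Cone a c) H x u u)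
    {v : E} (hv : ‖v‖ = 1) (hvx : ⟪v, x₁⟫ = 0) (heq : hes (Cone a c) H x₁ v v = Ω x₁)
    {u : E} (hux : ⟪u, x₁⟫ = 0) (ξ : E) :
    thd (Cone a c) H x₁ ξ v v + 2 * hes (Cone a c) H x₁ v u = ω₁ ξ + 2 * (Ω x₁ * ⟪v, u⟫) ∧
    0 ≤ fth (Cone a c) H x₁ ξ ξ v v + 4 * thd (Cone a c) H x₁ ξ v u
      + 2 * hes (Cone a c) H x₁ u u - ω₂ ξ - 4 * (ω₁ ξ * ⟪v, u⟫)
      - Ω x₁ * (2 * ‖u‖ ^ 2 - 2 * κ * ⟪v, ξ⟫ ^ 2) := by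
  have hxc := openCone_subset_cone hx
  have hnhds := cone_mem_nhds hx
  have hj := fun w z => hasJet2_hes_line hS.uniqueDiffOn hS.smooth_H hnhds ξ w z
  have hq : HasJet2 (fun t : ℝ => ‖v + t • u‖ ^ 2 - κ * ⟪v + t • u, x₁ + t • ξ⟫ ^ 2)
      (2 * ⟪v, u⟫) (2 * ‖u‖ ^ 2 - 2 * κ * ⟪v, ξ⟫ ^ 2) := by
    have e : (fun t : ℝ => ‖v + t • u‖ ^ 2 - κ * ⟪v + t • u, x₁ + t • ξ⟫ ^ 2)
        = fun t : ℝ => (1 + t * (2 * ⟪v, u⟫) + t * t * ‖u‖ ^ 2)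
          - κ * ((t * ⟪v, ξ⟫ + t * t * ⟪u, ξ⟫) * (t * ⟪v, ξ⟫ + t * t * ⟪u, ξ⟫)) := by
      ext t
      rw [← real_inner_self_eq_norm_sq, ← real_inner_self_eq_norm_sq]
      simp only [inner_add_left, inner_add_right, inner_smul_left, inner_smul_right, hvx, hux,
        real_inner_self_eq_norm_sq, hv, real_inner_comm v u, conj_trivial]
      ring
    rw [e]
    have hid := HasJet2.id
    have hsq := hid.mul hid
    have h2 := (hid.mul (HasJet2.const ⟪v, ξ⟫)).add (hsq.mul (HasJet2.const ⟪u, ξ⟫))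
    convert! (((HasJet2.const 1).add (hid.mul (HasJet2.const (2 * ⟪v, u⟫)))).add
      (hsq.mul (HasJet2.const (‖u‖ ^ 2)))).sub ((h2.mul h2).const_mul κ) using 1
    · simp
    · simp; ring
  have hA : HasJet2 (fun t : ℝ => hes (Cone a c) H (x₁ + t • ξ) (v + t • u) (v + t • u))
      (thd (Cone a c) H x₁ ξ v v + 2 * hes (Cone a c) H x₁ v u)
      (fth (Cone a c) H x₁ ξ ξ v v + 4 * thd (Cone a c) H x₁ ξ v u
        + 2 * hes (Cone a c) H x₁ u u) := by
    have e : (fun t : ℝ => hes (Cone a c) H (x₁ + t • ξ) (v + t • u) (v + t • u))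
        = fun t : ℝ => hes (Cone a c) H (x₁ + t • ξ) v v
          + t * (hes (Cone a c) H (x₁ + t • ξ) v u + hes (Cone a c) H (x₁ + t • ξ) u v)
          + t * t * hes (Cone a c) H (x₁ + t • ξ) u u := by
      ext t
      simp only [map_add, map_smul, _root_.add_apply, _root_.smul_apply,
        smul_eq_mul]
      ring
    rw [e]
    have hid := HasJet2.id
    convert! ((hj v v).add (hid.mul ((hj v u).add (hj u v)))).add ((hid.mul hid).mul (hj u u))
      using 1
    · simp [hS.hes_comm hxc u v]; ring
    · simp [thd_symm hS.uniqueDiffOn hS.smooth_H hxc hS.subset_closure ξ u v]; ring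
  have hΦ := hA.sub ((hΩ ξ).mul hq)
  have hline : Tendsto (fun t : ℝ => x₁ + t • ξ) (𝓝 0) (𝓝 x₁) := by
    have : ContinuousAt (fun t : ℝ => x₁ + t • ξ) 0 := by fun_prop
    simpa using this.tendsto
  -- The base point moves along `ξ` while the test vector moves along `u`. The touching inequality
  -- makes the difference nonnegative, and it is zero at `t = 0`; the freedom in `u` replaces
  -- differentiation of an eigenvector.
  have hmin : IsLocalMin (fun t : ℝ => hes (Cone a c) H (x₁ + t • ξ) (v + t • u) (v + t • u)
      - Ω (x₁ + t • ξ) * (‖v + t • u‖ ^ 2 - κ * ⟪v + t • u, x₁ + t • ξ⟫ ^ 2)) 0 := by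
    filter_upwards [hline.eventually htouch] with t ht
    have := ht (v + t • u)
    simp only [zero_smul, add_zero, heq, hv, hvx]
    linarith
  obtain ⟨h1, h2⟩ := hΦ.of_isLocalMin hmin
  simp only [zero_smul, add_zero, hv, hvx] at h1 h2
  constructor <;> linarith

/-- The logarithmic equation is differentiated twice along a line while the eigenbasis at `x₁` stays
fixed, so the off-diagonal entries of `D³H` appear in `logD2`. -/
theorem jets_equation (hS : IsSol a c k l p g H) {x₁ : E} (hx : x₁ ∈ OpenCone a c)
    {b : OrthonormalBasis (Fin (Module.finrank ℝ E)) ℝ E} {x : Fin (Module.finrank ℝ E) → ℝ}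
    (hb : ∀ i u, hes (Cone a c) H x₁ (b i) u = x i * ⟪b i, u⟫) (v : E) :
    logD1 x k (bmat (thd (Cone a c) H x₁ v) b) - logD1 x l (bmat (thd (Cone a c) H x₁ v) b)
      = -(p + k - l - 1) * (fderivWithin ℝ g (Cone a c) x₁ v / g x₁)
        + (p - 1) * (fderivWithin ℝ H (Cone a c) x₁ v / H x₁) ∧
    ∑ i, (w1 x k i - w1 x l i) * fth (Cone a c) H x₁ v v (b i) (b i)
      + (logD2 x k (bmat (thd (Cone a c) H x₁ v) b) - logD2 x l (bmat (thd (Cone a c) H x₁ v) b))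
      = -(p + k - l - 1) * (hes (Cone a c) g x₁ v v / g x₁
          - (fderivWithin ℝ g (Cone a c) x₁ v / g x₁) ^ 2)
        + (p - 1) * (hes (Cone a c) H x₁ v v / H x₁
          - (fderivWithin ℝ H (Cone a c) x₁ v / H x₁) ^ 2) := by
  have hxc := openCone_subset_cone hx
  have hnhds := cone_mem_nhds hx
  have hxpos : ∀ i, 0 ≤ x i := fun i => by
    have h1 := hS.convex_H x₁ hxc (b i)
    rw [hb] at h1
    simpa using h1
  have hdiag : bmat (hes (Cone a c) H x₁) b = Matrix.diagonal x := bmat_eq_diagonal hb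
  have hk : 0 < es Finset.univ x k := by
    have := hS.admissible x₁ hxc b
    rwa [hdiag, msym_diagonal] at this
  have hl : 0 < es Finset.univ x l :=
    es_pos_of_le _ hxpos (by omega) (by exact_mod_cast hS.l_lt.le) hk
  have hjet : ∀ j : ℕ, 0 < es Finset.univ x j →
      HasJet2 (fun t : ℝ => Real.log (msym (bmat (hes (Cone a c) H (x₁ + t • v)) b) j))
        (logD1 x j (bmat (thd (Cone a c) H x₁ v) b))
        (∑ i, w1 x j i * fth (Cone a c) H x₁ v v (b i) (b i)
          + logD2 x j (bmat (thd (Cone a c) H x₁ v) b)) := by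
    intro j hj
    have h1 := hasJet2_msym (M := fun t : ℝ => bmat (hes (Cone a c) H (x₁ + t • v)) b)
      (B := bmat (thd (Cone a c) H x₁ v) b) (D := bmat (fth (Cone a c) H x₁ v v) b) hxpos
      (by simpa using hdiag)
      (fun i i' => hasJet2_hes_line hS.uniqueDiffOn hS.smooth_H hnhds v (b i) (b i')) j
    have h0 : msym (bmat (hes (Cone a c) H (x₁ + (0 : ℝ) • v)) b) j = es Finset.univ x j := by
      rw [zero_smul, add_zero, hdiag, msym_diagonal]
    have e1 : ∀ D : Matrix _ _ ℝ, ∑ i, D i i * es (Finset.univ.erase i) x (j - 1)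
        = (∑ i, D i i * w1 x j i) * es Finset.univ x j := by
      intro D
      rw [Finset.sum_mul]
      refine Finset.sum_congr rfl fun i _ => ?_
      rw [w1]; field_simp
    have e2 : ∀ D : Matrix (Fin (Module.finrank ℝ E)) (Fin (Module.finrank ℝ E)) ℝ,
        ∑ i, ∑ i' ∈ Finset.univ.erase i,
        (D i i * D i' i' - D i i' * D i' i) * es ((Finset.univ.erase i).erase i') x (j - 2)
        = (∑ i, ∑ i' ∈ Finset.univ.erase i, (D i i * D i' i' - D i i' * D i' i) * w2 x j i i')
          * es Finset.univ x j := by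
      intro D
      rw [Finset.sum_mul]
      refine Finset.sum_congr rfl fun i _ => ?_
      rw [Finset.sum_mul]
      refine Finset.sum_congr rfl fun i' _ => ?_
      rw [w2]; field_simp
    convert! h1.log (by rw [h0]; exact hj) using 1
    · rw [h0, e1, mul_div_cancel_right₀ _ hj.ne']
      rfl
    · rw [h0, e1, e1, e2, ← add_mul, mul_div_cancel_right₀ _ hj.ne',
        mul_div_cancel_right₀ _ hj.ne', add_sub_assoc]
      congr 1
      exact Finset.sum_congr rfl fun i _ => mul_comm _ _
  have hg := hasJet2_line hS.uniqueDiffOn hS.smooth_g hnhds v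
  have hH := hasJet2_line hS.uniqueDiffOn hS.smooth_H hnhds v
  have hR := ((hg.log (by simpa using hS.pos_g x₁ hxc)).const_mul (-(p + k - l - 1))).add
    ((hH.log (by simpa using hS.pos_H x₁ hxc)).const_mul (p - 1))
  have hline : Tendsto (fun t : ℝ => x₁ + t • v) (𝓝 0) (𝓝 x₁) := by
    have : ContinuousAt (fun t : ℝ => x₁ + t • v) 0 := by fun_prop
    simpa using this.tendsto
  have hLR := ((hjet k hk).sub (hjet l hl)).unique (hR.congr (by
    filter_upwards [hline.eventually hnhds] with t ht using hS.equation _ ht b))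
  simp only [zero_smul, add_zero] at hLR
  refine ⟨hLR.1, ?_⟩
  rw [← hLR.2]
  simp only [sub_mul, Finset.sum_sub_distrib]
  ring

/-- The key inequality: at an interior point where the smallest eigenvalue of the Hessian is
touched from below by `Ω`, the linearized operator applied to `Ω` is controlled. -/
theorem touching [FiniteDimensional ℝ E] (hS : IsSol a c k l p g H) {L κ₀ c₀ C₀ : ℝ}
    (hInv : InverseConcavityBound (Fin (Module.finrank ℝ E)) k l L κ₀ c₀ C₀)
    {x₁ : E} (hx : x₁ ∈ OpenCone a c)
    (hL2 : ∀ u, ‖u‖ = 1 → hes (Cone a c) H x₁ u u ≤ L)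
    (hL3 : ∀ u v w, ‖u‖ = 1 → ‖v‖ = 1 → ‖w‖ = 1 → |thd (Cone a c) H x₁ u v w| ≤ L)
    (hκ₀ : ∀ b : OrthonormalBasis (Fin (Module.finrank ℝ E)) ℝ E,
      κ₀ ≤ msym (bmat (hes (Cone a c) H x₁) b) k)
    {Ω : E → ℝ} {ω₁ ω₂ : E → ℝ}
    (hΩ : ∀ ξ, HasJet2 (fun t : ℝ => Ω (x₁ + t • ξ)) (ω₁ ξ) (ω₂ ξ)) {η : ℝ}
    (hω : ∀ ξ, ‖ξ‖ = 1 → |ω₁ ξ| ≤ η) {κ : ℝ} (hκ : 0 ≤ κ) (hc₀ : 0 ≤ c₀)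
    (htouch : ∀ᶠ x in 𝓝 x₁, ∀ u, Ω x * (‖u‖ ^ 2 - κ * ⟪u, x⟫ ^ 2) ≤ hes (Cone a c) H x u u)
    {v : E} (hv : ‖v‖ = 1) (hvx : ⟪v, x₁⟫ = 0) (heq : hes (Cone a c) H x₁ v v = Ω x₁)
    (hpos : 0 < Ω x₁) :
    ∃ (b : OrthonormalBasis (Fin (Module.finrank ℝ E)) ℝ E) (f : Fin (Module.finrank ℝ E) → ℝ),
      (∀ i, c₀ ≤ f i ∧ f i ≤ C₀) ∧
      ∑ i, f i * ω₂ (b i) ≤ C₀ * (η + Ω x₁ / ‖x₁‖) + (p - 1) * (Ω x₁ / H x₁)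
        + 2 * κ * Ω x₁ * (Module.finrank ℝ E * C₀) := by
  have hxc := openCone_subset_cone hx
  have hxn : 0 < ‖x₁‖ := norm_pos_iff.2 hxc.1
  have hη : 0 ≤ η := (abs_nonneg _).trans (hω v hv)
  set A := hes (Cone a c) H x₁ with hA
  obtain ⟨b, x, hb⟩ := exists_eigenbasis (B := A) (fun u v => hS.hes_comm hxc u v)
  have hbn : ∀ i, ‖b i‖ = 1 := fun i => b.norm_eq_one i
  have hbx : ∀ i, x i = A (b i) (b i) := fun i => by rw [hb]; simp
  have hx0 : ∀ i, 0 ≤ x i := fun i => by rw [hbx]; exact hS.convex_H x₁ hxc (b i)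
  have hxL : ∀ i, x i ≤ L := fun i => by rw [hbx]; exact hL2 (b i) (hbn i)
  have hdiag : bmat A b = Matrix.diagonal x := bmat_eq_diagonal hb
  have hk0 : κ₀ ≤ es Finset.univ x k := by
    have := hκ₀ b
    rwa [hdiag, msym_diagonal] at this
  obtain ⟨hf, hJB⟩ := hInv x hx0 hxL hk0
  set f : Fin (Module.finrank ℝ E) → ℝ := fun i => w1 x k i - w1 x l i with hfdef
  refine ⟨b, f, hf, ?_⟩
  have hmin := htouch.self_of_nhds
  -- the eigenvectors are either radial, or orthogonal to `x₁` with eigenvalue at least `Ω x₁`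
  have hcases : ∀ i, (⟪b i, x₁⟫ = 0 ∧ Ω x₁ ≤ x i) ∨
      (x i = 0 ∧ ∃ s : ℝ, |s| = ‖x₁‖⁻¹ ∧ b i = s • x₁) := by
    intro i
    have h1 : x i * ⟪b i, x₁⟫ = 0 := by rw [← hb]; exact hS.hes_self hxc (b i)
    by_cases h2 : ⟪b i, x₁⟫ = 0
    · left
      refine ⟨h2, ?_⟩
      have := hmin (b i)
      rw [← hA, ← hbx, h2, hbn] at this
      simpa using this
    · right
      have h3 : x i = 0 := (mul_eq_zero.1 h1).resolve_right h2
      -- Subtracting the radial part leaves a tangential vector on which the Hessian vanishes; as `Ω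
      -- x₁ > 0`, the touching inequality forces that vector to be zero.
      set s := ⟪b i, x₁⟫ / ‖x₁‖ ^ 2
      have h4 := hmin (b i - s • x₁)
      have h5 : ⟪b i - s • x₁, x₁⟫ = 0 := by
        rw [inner_sub_left, inner_smul_left, real_inner_self_eq_norm_sq]
        simp only [s, conj_trivial]
        field_simp
        simp
      have h6 : A (b i - s • x₁) (b i - s • x₁) = 0 := by
        simp only [map_sub, map_smul, _root_.sub_apply,
          _root_.smul_apply, smul_eq_mul]
        rw [hA, hS.hes_self hxc, hS.hes_self hxc, hS.hes_self' hxc, ← hA, ← hbx, h3]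
        ring
      rw [← hA, h6, h5] at h4
      have h7 : b i - s • x₁ = 0 := by
        rw [← norm_eq_zero]
        by_contra hne
        have : 0 < ‖b i - s • x₁‖ ^ 2 := by positivity
        nlinarith [mul_pos hpos this]
      have h8 : b i = s • x₁ := sub_eq_zero.1 h7
      refine ⟨h3, s, ?_, h8⟩
      have h9 := hbn i
      rw [h8, norm_smul, Real.norm_eq_abs] at h9
      exact eq_inv_of_mul_eq_one_left h9
  have hjets := fun (u : E) (hux : ⟪u, x₁⟫ = 0) ξ =>
    hS.touching_jets hx hΩ htouch hv hvx heq hux ξ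
  have hω₁ : ∀ ξ, thd (Cone a c) H x₁ ξ v v = ω₁ ξ := fun ξ => by
    have := (hjets 0 (by simp) ξ).1
    simpa using this
  -- Comparing the first-order conditions for `u = b i` and `u = 0` shows that `v` is an eigenvector
  -- for the eigenvalue `Ω x₁`.
  have hAv : ∀ i, A v (b i) = Ω x₁ * ⟪v, b i⟫ := by
    intro i
    rcases hcases i with h1 | ⟨-, s, -, h2⟩
    · have h2 := (hjets (b i) h1.1 0).1
      rw [hω₁] at h2
      rw [← hA] at h2
      linarith
    · rw [h2, map_smul, hA, hS.hes_self hxc, inner_smul_right, hvx]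
      simp
  have hvb : ∀ i, (x i - Ω x₁) * ⟪v, b i⟫ = 0 := by
    intro i
    have h1 := hAv i
    rw [hA, hS.hes_comm hxc, ← hA, hb, real_inner_comm] at h1
    linarith
  have hswap : ∀ u w z, thd (Cone a c) H x₁ u w z = thd (Cone a c) H x₁ w u z := fun u w z => by
    rw [thd_swap hS.uniqueDiffOn hS.smooth_H hxc hS.subset_closure]
  have hsymm : ∀ u w z, thd (Cone a c) H x₁ u w z = thd (Cone a c) H x₁ u z w := fun u w z =>
    thd_symm hS.uniqueDiffOn hS.smooth_H hxc hS.subset_closure u w z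
  -- the kernel of `A - Ω x₁`
  have hker : ∀ i, ⟪b i, x₁⟫ = 0 → x i = Ω x₁ → ∀ ξ,
      thd (Cone a c) H x₁ ξ v (b i) = ω₁ ξ * ⟪v, b i⟫ := by
    intro i h1 h2 ξ
    by_contra hne
    set r := thd (Cone a c) H x₁ ξ v (b i) - ω₁ ξ * ⟪v, b i⟫ with hr
    have hr0 : r ≠ 0 := sub_ne_zero.2 hne
    set q := fth (Cone a c) H x₁ ξ ξ v v - ω₂ ξ + Ω x₁ * (2 * κ * ⟪v, ξ⟫ ^ 2) with hq
    -- For `u = s • b i` in the eigenspace of `Ω x₁` the terms quadratic in `s` cancel. An affine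
    -- function of `s` that is bounded below has zero slope, so `r` must vanish; the value of `s`
    -- below would make it `-1`.
    have h3 : ∀ s : ℝ, 0 ≤ q + 4 * (s * r) := by
      intro s
      have h4 := (hjets (s • b i) (by rw [inner_smul_left, h1, mul_zero]) ξ).2
      rw [← hA] at h4
      simp only [map_smul, _root_.smul_apply, smul_eq_mul, ← hbx, h2,
        inner_smul_right, norm_smul, hbn, Real.norm_eq_abs, mul_one, sq_abs] at h4
      rw [hq, hr]
      linarith
    have h5 := h3 (-(q + 1) / (4 * r))
    have h6 : 4 * (-(q + 1) / (4 * r) * r) = -(q + 1) := by field_simp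
    linarith
  -- `J` collects the eigenvalues strictly above the touching value. The other directions are radial
  -- or in the eigenspace of `Ω x₁`, where the third derivatives are small.
  let J : Finset (Fin (Module.finrank ℝ E)) := Finset.univ.filter fun i => Ω x₁ < x i
  have hJ : ∀ i, i ∈ J ↔ Ω x₁ < x i := fun i => by simp [J]
  have hJx : ∀ i ∈ J, ⟪b i, x₁⟫ = 0 := by
    intro i hi
    rcases hcases i with h1 | ⟨h1, -⟩
    · exact h1.1
    · rw [hJ, h1] at hi
      exact absurd hi (not_lt.2 hpos.le)
  have hJv : ∀ i ∈ J, ⟪v, b i⟫ = 0 := fun i hi =>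
    (mul_eq_zero.1 (hvb i)).resolve_left (sub_pos.2 ((hJ i).1 hi)).ne'
  set B : Matrix (Fin (Module.finrank ℝ E)) (Fin (Module.finrank ℝ E)) ℝ :=
    bmat (thd (Cone a c) H x₁ v) b with hB
  have hBij : ∀ i j, B i j = thd (Cone a c) H x₁ v (b i) (b j) := fun i j => rfl
  have hinner : ∀ i, |⟪v, b i⟫| ≤ 1 := fun i => by
    simpa [hv, hbn] using abs_real_inner_le_norm v (b i)
  have hΩx : 0 ≤ Ω x₁ / ‖x₁‖ := by positivity
  -- In the eigenspace of `Ω x₁` the third derivative is controlled by the gradient of `Ω`; in the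
  -- radial direction, homogeneity turns it into a Hessian of size at most `Ω x₁ / ‖x₁‖`.
  have hBη : ∀ i j, i ∉ J → |B i j| ≤ η + Ω x₁ / ‖x₁‖ := by
    intro i j hi
    rw [hBij]
    rcases hcases i with ⟨h1, h2⟩ | ⟨h1, s, hs, h2⟩
    · have h3 : x i = Ω x₁ := le_antisymm (not_lt.1 fun h => hi ((hJ i).2 h)) h2
      rw [hsymm, hswap, hker i h1 h3, abs_mul]
      nlinarith [mul_le_mul (hω (b j) (hbn j)) (hinner i) (abs_nonneg _) hη]
    · rw [hsymm, h2, map_smul, hS.thd_self hxc, smul_eq_mul, abs_mul, abs_neg, hs,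
        hS.hes_comm hxc, ← hA, hAv, abs_mul, abs_of_pos hpos]
      have h3 : ‖x₁‖⁻¹ * (Ω x₁ * |⟪v, b j⟫|) ≤ ‖x₁‖⁻¹ * (Ω x₁ * 1) := by
        have := hinner j
        gcongr
      have h4 : ‖x₁‖⁻¹ * (Ω x₁ * 1) = Ω x₁ / ‖x₁‖ := by field_simp
      linarith
  have hmain := hJB J B (η + Ω x₁ / ‖x₁‖) (by positivity)
    (fun i hi => hpos.trans ((hJ i).1 hi)) (fun i j => hsymm _ _ _)
    (fun i j => hL3 _ _ _ hv (hbn i) (hbn j)) hBη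
  -- the second derivative test in the directions `b i`
  have htest : ∀ i, 0 ≤ fth (Cone a c) H x₁ v v (b i) (b i) - ω₂ (b i) + 2 * κ * Ω x₁
      - (if i ∈ J then 2 * ∑ j ∈ J, B i j ^ 2 / x j else 0) := by
    intro i
    have hv2 : Ω x₁ * (2 * κ * ⟪v, b i⟫ ^ 2) ≤ 2 * κ * Ω x₁ := by
      have h1 : ⟪v, b i⟫ ^ 2 ≤ 1 := by
        rw [← sq_abs]
        have := hinner i
        have := abs_nonneg ⟪v, b i⟫
        nlinarith
      have h2 := mul_le_mul_of_nonneg_left h1 (mul_nonneg hκ hpos.le)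
      linarith
    have hexch : fth (Cone a c) H x₁ (b i) (b i) v v = fth (Cone a c) H x₁ v v (b i) (b i) :=
      fth_exchange hS.uniqueDiffOn hS.smooth_H hxc hS.subset_closure _ _
    split_ifs with hi
    -- This `u` minimises `4 D³H(b_i, v, u) + 2 D²H(u, u)` over the span of the `b j` with `j ∈ J`;
    -- the minimum `-2 Σ B_ij² / x_j` is the term needed for inverse concavity.
    · set u : E := -∑ j ∈ J, (B i j / x j) • b j with hu
      have hux : ⟪u, x₁⟫ = 0 := by
        rw [hu, inner_neg_left, sum_inner, Finset.sum_eq_zero, neg_zero]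
        intro j hj
        rw [inner_smul_left, hJx j hj, mul_zero]
      have hvu : ⟪v, u⟫ = 0 := by
        rw [hu, inner_neg_right, inner_sum, Finset.sum_eq_zero, neg_zero]
        intro j hj
        rw [inner_smul_right, hJv j hj, mul_zero]
      have h1 := (hjets u hux (b i)).2
      rw [hvu, hexch, ← hA] at h1
      have h2 : thd (Cone a c) H x₁ (b i) v u = -∑ j ∈ J, B i j ^ 2 / x j := by
        rw [hu, map_neg, map_sum]
        congr 1
        refine Finset.sum_congr rfl fun j _ => ?_
        rw [map_smul, hswap, smul_eq_mul, ← hBij]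
        ring
      have h3 : A u u = ∑ j ∈ J, B i j ^ 2 / x j := by
        have hbu : ∀ j ∈ J, ⟪b j, u⟫ = -(B i j / x j) := by
          intro j hj
          rw [hu, inner_neg_right, inner_sum, Finset.sum_eq_single j]
          · rw [inner_smul_right]; simp
          · intro j' _ hne
            rw [inner_smul_right, b.inner_eq_zero hne.symm, mul_zero]
          · exact fun h => absurd hj h
        have hAu : A u = -∑ j ∈ J, (B i j / x j) • A (b j) := by
          rw [hu, map_neg, map_sum]
          simp only [map_smul]
        rw [hAu, _root_.neg_apply, _root_.sum_apply,
          ← Finset.sum_neg_distrib]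
        refine Finset.sum_congr rfl fun j hj => ?_
        have hxj : x j ≠ 0 := (hpos.trans ((hJ j).1 hj)).ne'
        rw [_root_.smul_apply, hb, hbu j hj, smul_eq_mul]
        field_simp
      rw [h2, h3] at h1
      have h4 : 0 ≤ Ω x₁ * (2 * ‖u‖ ^ 2) := by positivity
      linarith
    · have h1 := (hjets 0 (by simp) (b i)).2
      rw [hexch] at h1
      simp at h1
      linarith
  have hf0 : ∀ i, 0 ≤ f i := fun i => hc₀.trans (hf i).1
  have hsum : 0 ≤ ∑ i, f i * fth (Cone a c) H x₁ v v (b i) (b i) - ∑ i, f i * ω₂ (b i)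
      + 2 * κ * Ω x₁ * (Module.finrank ℝ E * C₀)
      - 2 * ∑ i ∈ J, ∑ j ∈ J, f i * (B i j ^ 2 / x j) := by
    have h1 : 0 ≤ ∑ i, f i * (fth (Cone a c) H x₁ v v (b i) (b i) - ω₂ (b i) + 2 * κ * Ω x₁
      - (if i ∈ J then 2 * ∑ j ∈ J, B i j ^ 2 / x j else 0)) :=
      Finset.sum_nonneg fun i _ => mul_nonneg (hf0 i) (htest i)
    have h2 : ∑ i, f i * (if i ∈ J then 2 * ∑ j ∈ J, B i j ^ 2 / x j else 0)
        = 2 * ∑ i ∈ J, ∑ j ∈ J, f i * (B i j ^ 2 / x j) := by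
      rw [← Finset.sum_subset (Finset.subset_univ J), Finset.mul_sum]
      · refine Finset.sum_congr rfl fun i hi => ?_
        rw [if_pos hi, ← Finset.mul_sum]
        ring
      · intro i _ hi
        rw [if_neg hi, mul_zero]
    have h3 : ∑ i, f i * (2 * κ * Ω x₁) ≤ 2 * κ * Ω x₁ * (Module.finrank ℝ E * C₀) := by
      rw [← Finset.sum_mul, mul_comm]
      refine mul_le_mul_of_nonneg_left ?_ (by positivity)
      refine (Finset.sum_le_card_nsmul _ _ C₀ fun i _ => (hf i).2).trans ?_
      simp
    simp only [mul_sub, mul_add, Finset.sum_sub_distrib, Finset.sum_add_distrib] at h1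
    rw [h2] at h1
    linarith
  obtain ⟨q1, q2⟩ := hS.jets_equation hx hb v
  rw [← hB] at q1 q2
  rw [q1] at hmain
  have hgpos := hS.pos_g x₁ hxc
  have hHpos := hS.pos_H x₁ hxc
  have hg2 : 0 ≤ hes (Cone a c) g x₁ v v / g x₁ :=
    div_nonneg (hS.convex_g x₁ hxc v) hgpos.le
  rw [← hA, heq] at q2
  have hm : (1 : ℝ) ≤ k - l := by
    have : (l : ℝ) + 1 ≤ k := by exact_mod_cast hS.l_lt
    linarith
  have hp := hS.one_le_p
  set X := fderivWithin ℝ g (Cone a c) x₁ v / g x₁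
  set Y := fderivWithin ℝ H (Cone a c) x₁ v / H x₁
  set m : ℝ := k - l with hmdef
  have hq : p + k - l - 1 = m + (p - 1) := by rw [hmdef]; ring
  rw [hq] at q2 hmain
  set r := p - 1
  have hr : 0 ≤ r := sub_nonneg.2 hp
  -- All squares of logarithmic gradients of `g` and `H` combine into a single square with a
  -- nonpositive coefficient, because `p ≥ 1`.
  have hid : (m + r) * X ^ 2 - r * Y ^ 2 - (-(m + r) * X + r * Y) ^ 2 / m
      = -(r * (m + r) * (X - Y) ^ 2 / m) := by
    field_simp
    ring
  have hle : 0 ≤ r * (m + r) * (X - Y) ^ 2 / m := by positivity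
  have hg3 : 0 ≤ (m + r) * (hes (Cone a c) g x₁ v v / g x₁) :=
    mul_nonneg (by linarith) hg2
  have hq2 : ∑ i, f i * fth (Cone a c) H x₁ v v (b i) (b i) + (logD2 x k B - logD2 x l B)
      = -(m + r) * (hes (Cone a c) g x₁ v v / g x₁ - X ^ 2)
        + r * (Ω x₁ / H x₁ - Y ^ 2) := q2
  linarith

end IsSol

end Touching

end CapillaryRank

namespace CapillaryRank

open Filter Topology

/-! ### Invariance under change of basis and the Hopf lemma -/

section Hopf

variable {E : Type*} [NormedAddCommGroup E] [InnerProductSpace ℝ E]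

theorem continuous_msym {ι : Type*} [Fintype ι] [DecidableEq ι] (k : ℕ) :
    Continuous fun M : Matrix ι ι ℝ => msym M k := by
  obtain ⟨c, hc⟩ := exists_coeff_eq_sum_eval (Fintype.card ι) k
  have h1 : (fun M : Matrix ι ι ℝ => msym M k) = fun M =>
      ∑ i ∈ Finset.range (Fintype.card ι + 1), c i * (1 + (i : ℝ) • M).det := by
    ext M
    rw [msym, hc _ (natDegree_charpolyRev_le _)]
    simp only [eval_charpolyRev_neg]
  rw [h1]
  refine continuous_finsetSum _ fun i _ => continuous_const.mul ?_
  exact Continuous.matrix_det (A := fun M : Matrix ι ι ℝ => 1 + (i : ℝ) • M) (by fun_prop)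

/-- The elementary symmetric functions of a bilinear form do not depend on the choice of an
orthonormal basis. -/
theorem msym_bmat {ι : Type*} [Fintype ι] [DecidableEq ι] {B : E →L[ℝ] E →L[ℝ] ℝ}
    {T : E →ₗ[ℝ] E} (hT : ∀ u v, ⟪T u, v⟫ = B u v) (b : OrthonormalBasis ι ℝ E) (k : ℕ) :
    haveI := b.toBasis.finiteDimensional_of_finite
    msym (bmat B b) k = ((-T).charpoly.reverse).coeff k := by
  have := b.toBasis.finiteDimensional_of_finite
  have h : bmat B b = (LinearMap.toMatrix b.toBasis b.toBasis T).transpose := by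
    ext i j
    rw [Matrix.transpose_apply, LinearMap.toMatrix_apply, bmat, Matrix.of_apply, ← hT]
    simp [OrthonormalBasis.repr_apply_apply, real_inner_comm]
  rw [msym, ← Matrix.reverse_charpoly, h, ← Matrix.transpose_neg, Matrix.charpoly_transpose,
    ← map_neg, LinearMap.charpoly_toMatrix]

/-- The operator of a bilinear form on a Euclidean space. -/
def opOf [CompleteSpace E] (B : E →L[ℝ] E →L[ℝ] ℝ) : E →ₗ[ℝ] E where
  toFun u := (InnerProductSpace.toDual ℝ E).symm (B u)
  map_add' u v := by simp
  map_smul' r u := by simp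

theorem inner_opOf [CompleteSpace E] (B : E →L[ℝ] E →L[ℝ] ℝ) (u v : E) :
    ⟪opOf B u, v⟫ = B u v :=
  InnerProductSpace.toDual_symm_apply

theorem msym_bmat_eq {B : E →L[ℝ] E →L[ℝ] ℝ} {ι κ : Type*} [Fintype ι] [DecidableEq ι] [Fintype κ]
    [DecidableEq κ] (b : OrthonormalBasis ι ℝ E) (b' : OrthonormalBasis κ ℝ E) (k : ℕ) :
    msym (bmat B b) k = msym (bmat B b') k := by
  have := b.toBasis.finiteDimensional_of_finite
  have : CompleteSpace E := FiniteDimensional.complete ℝ E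
  rw [msym_bmat (inner_opOf B), msym_bmat (inner_opOf B)]

theorem le_of_hasDerivWithinAt {φ : ℝ → ℝ} {d m r : ℝ} (hr : 0 < r)
    (h : HasDerivWithinAt φ d (Set.Icc 0 r) 0) (h0 : φ 0 = 0)
    (hm : ∀ᶠ t in 𝓝[>] 0, m * t ≤ φ t) : m ≤ d := by
  have h1 : HasDerivWithinAt φ d (Set.Ioi 0) 0 := by
    refine (h.mono Set.Ioc_subset_Icc_self).mono_of_mem_nhdsWithin ?_
    exact Ioc_mem_nhdsGT hr
  rw [hasDerivWithinAt_iff_tendsto_slope' (by simp)] at h1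
  refine ge_of_tendsto h1 ?_
  filter_upwards [hm, self_mem_nhdsWithin] with t ht ht0
  rw [slope_def_field, h0, sub_zero, sub_zero, le_div_iff₀ ht0]
  exact ht

namespace IsSol

variable {a : E} {c : ℝ} {k l : ℕ} {p : ℝ} {g H : E → ℝ}

/-- A lower bound for the Hessian on the orthogonal complement of the radial direction. -/
theorem le_hes (hS : IsSol a c k l p g H) {x : E} (hx : x ∈ Cone a c) {m κ : ℝ} (hm : 0 ≤ m)
    (hκ : (‖x‖ ^ 2)⁻¹ ≤ κ)
    (h : ∀ u, ‖u‖ = 1 → ⟪u, x⟫ = 0 → m ≤ hes (Cone a c) H x u u) (u : E) :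
    m * (‖u‖ ^ 2 - κ * ⟪u, x⟫ ^ 2) ≤ hes (Cone a c) H x u u := by
  have hxn : 0 < ‖x‖ := norm_pos_iff.2 hx.1
  set s := ⟪u, x⟫ / ‖x‖ ^ 2 with hs
  set w := u - s • x with hw
  have hwx : ⟪w, x⟫ = 0 := by
    rw [hw, inner_sub_left, inner_smul_left, real_inner_self_eq_norm_sq]
    simp only [hs, conj_trivial]
    field_simp
    simp
  have hww : hes (Cone a c) H x w w = hes (Cone a c) H x u u := by
    simp only [hw, map_sub, map_smul, _root_.sub_apply, _root_.smul_apply, smul_eq_mul]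
    rw [hS.hes_self hx, hS.hes_self hx, hS.hes_self' hx]
    ring
  have hnorm : ‖w‖ ^ 2 = ‖u‖ ^ 2 - (‖x‖ ^ 2)⁻¹ * ⟪u, x⟫ ^ 2 := by
    rw [← real_inner_self_eq_norm_sq, ← real_inner_self_eq_norm_sq u]
    simp only [hw, inner_sub_left, inner_sub_right, inner_smul_left, inner_smul_right,
      real_inner_self_eq_norm_sq, real_inner_comm u x, conj_trivial, hs]
    field_simp
    ring
  have h1 : m * ‖w‖ ^ 2 ≤ hes (Cone a c) H x w w := by
    by_cases hw0 : w = 0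
    · simp [hw0]
    · have hwn : 0 < ‖w‖ := norm_pos_iff.2 hw0
      have h2 := h (‖w‖⁻¹ • w) (by rw [norm_smul, norm_inv, norm_norm, inv_mul_cancel₀ hwn.ne'])
        (by rw [inner_smul_left, hwx, mul_zero])
      simp only [map_smul, _root_.smul_apply, smul_eq_mul] at h2
      have h3 := mul_le_mul_of_nonneg_right h2 (sq_nonneg ‖w‖)
      refine h3.trans (le_of_eq ?_)
      field_simp
  rw [← hww]
  refine le_trans ?_ h1
  refine mul_le_mul_of_nonneg_left ?_ hm
  rw [hnorm]
  have := mul_le_mul_of_nonneg_right hκ (sq_nonneg ⟪u, x⟫)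
  linarith

theorem hasJet2_barrier (z x₁ ξ : E) (R M ε κ' : ℝ) :
    HasJet2 (fun t : ℝ => ε * ((R ^ 2 - ‖x₁ + t • ξ - z‖ ^ 2)
        + M * ((R ^ 2 - ‖x₁ + t • ξ - z‖ ^ 2) * (R ^ 2 - ‖x₁ + t • ξ - z‖ ^ 2))) - κ')
      (ε * (-2 * ⟪x₁ - z, ξ⟫ * (1 + 2 * M * (R ^ 2 - ‖x₁ - z‖ ^ 2))))
      (ε * (-2 * ‖ξ‖ ^ 2 * (1 + 2 * M * (R ^ 2 - ‖x₁ - z‖ ^ 2)) + 8 * M * ⟪x₁ - z, ξ⟫ ^ 2)) := by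
  have hs : HasJet2 (fun t : ℝ => R ^ 2 - ‖x₁ + t • ξ - z‖ ^ 2) (-2 * ⟪x₁ - z, ξ⟫)
      (-2 * ‖ξ‖ ^ 2) := by
    have e : (fun t : ℝ => R ^ 2 - ‖x₁ + t • ξ - z‖ ^ 2) = fun t : ℝ =>
        (R ^ 2 - ‖x₁ - z‖ ^ 2) - (t * (2 * ⟪x₁ - z, ξ⟫) + t * t * ‖ξ‖ ^ 2) := by
      ext t
      rw [show x₁ + t • ξ - z = (x₁ - z) + t • ξ by abel, norm_add_sq_real, norm_smul,
        inner_smul_right, mul_pow, Real.norm_eq_abs, sq_abs]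
      ring
    rw [e]
    have hid := HasJet2.id
    convert! (HasJet2.const (R ^ 2 - ‖x₁ - z‖ ^ 2)).sub
      ((hid.mul (HasJet2.const (2 * ⟪x₁ - z, ξ⟫))).add
        ((hid.mul hid).mul (HasJet2.const (‖ξ‖ ^ 2)))) using 1
    · simp
    · simp
  convert! ((hs.add ((hs.mul hs).const_mul M)).const_mul ε).sub (HasJet2.const κ') using 1
  · simp only [zero_smul, add_zero]; ring
  · simp only [zero_smul, add_zero]; ring

set_option maxHeartbeats 2000000 in
/-- Hopf's lemma for the smallest eigenvalue of the Hessian. -/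
theorem hopf [FiniteDimensional ℝ E] (hS : IsSol a c k l p g H) {z x₀ : E} {R : ℝ} (hR : 0 < R)
    (hball : Metric.closedBall z R ⊆ Cone a c) (hopen : Metric.ball z R ⊆ OpenCone a c)
    (hx₀ : ‖x₀ - z‖ = R)
    (hpos : ∀ x ∈ Metric.closedBall z R, x ≠ x₀ → ∀ u, ⟪u, x⟫ = 0 → u ≠ 0 →
      0 < hes (Cone a c) H x u u) :
    ∃ ε δ : ℝ, 0 < ε ∧ 0 < δ ∧ ∀ x ∈ Metric.closedBall z R, ‖x - x₀‖ ≤ δ →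
      ∀ u, ‖u‖ = 1 → ⟪u, x⟫ = 0 → ε * (R ^ 2 - ‖x - z‖ ^ 2) ≤ hes (Cone a c) H x u u := by
  set K₀ := Metric.closedBall z R with hK₀
  have hproper : ProperSpace E := FiniteDimensional.proper ℝ E
  have hcpt : IsCompact K₀ := isCompact_closedBall z R
  have hne : K₀.Nonempty := ⟨z, Metric.mem_closedBall_self hR.le⟩
  have hcH2 : ContinuousOn (hes (Cone a c) H) (Cone a c) :=
    (contDiffOn_hes hS.uniqueDiffOn hS.smooth_H).continuousOn
  have hcH3 : ContinuousOn (thd (Cone a c) H) (Cone a c) :=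
    (contDiffOn_thd hS.uniqueDiffOn hS.smooth_H).continuousOn
  obtain ⟨L2, hL2⟩ := hcpt.exists_bound_of_continuousOn (hcH2.mono hball)
  obtain ⟨L3, hL3⟩ := hcpt.exists_bound_of_continuousOn (hcH3.mono hball)
  let b₀ := stdOrthonormalBasis ℝ E
  have hcM : ContinuousOn (fun x => msym (bmat (hes (Cone a c) H x) b₀) k) K₀ := by
    refine (continuous_msym k).comp_continuousOn ?_
    refine continuousOn_pi.2 fun i => continuousOn_pi.2 fun j => ?_
    exact ((hcH2.mono hball).clm_apply continuousOn_const).clm_apply continuousOn_const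
  obtain ⟨y₁, hy₁, hmin₁⟩ := hcpt.exists_isMinOn hne hcM
  set κ₀ := msym (bmat (hes (Cone a c) H y₁) b₀) k with hκ₀
  have hκ₀pos : 0 < κ₀ := hS.admissible y₁ (hball hy₁) b₀
  obtain ⟨y₂, hy₂, hmin₂⟩ := hcpt.exists_isMinOn hne (hS.smooth_H.continuousOn.mono hball)
  have hh₀ : 0 < H y₂ := hS.pos_H y₂ (hball hy₂)
  obtain ⟨y₃, hy₃, hmin₃⟩ := hcpt.exists_isMinOn hne (continuous_norm (E := E)).continuousOn
  have hρ : 0 < ‖y₃‖ := norm_pos_iff.2 (hball hy₃).1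
  set κ := (‖y₃‖ ^ 2)⁻¹ with hκ
  have hκpos : 0 < κ := by positivity
  obtain ⟨c₀, C₀, hc₀, hC₀, hInv⟩ := exists_inverse_concavity_perturbed
    (ι := Fin (Module.finrank ℝ E)) hS.l_lt (max L2 L3) hκ₀pos
  set N : ℝ := (Module.finrank ℝ E : ℝ) with hN
  have hp : 0 ≤ p - 1 := sub_nonneg.2 hS.one_le_p
  -- The upper bound of `IsSol.touching` divided by `ε`, with `η = 6 R ε` and `Ω ≤ 2 R² ε`.
  set Cup := C₀ * (6 * R + 2 * R ^ 2 / ‖y₃‖) + (p - 1) * (2 * R ^ 2 / H y₂)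
    + 2 * κ * (2 * R ^ 2) * (N * C₀) with hCup
  have hCup0 : 0 ≤ Cup := by positivity
  -- `M` makes the barrier a strict subsolution: with `|x - z| ≥ R / 2`, the linearized operator
  -- applied to it is at least `ε (Cup + 1)`.
  set M := (Cup + 6 * (N * C₀) + 1) / (2 * c₀ * R ^ 2) with hM
  have hM0 : 0 < M := by positivity
  have hMeq : 2 * M * c₀ * R ^ 2 = Cup + 6 * (N * C₀) + 1 := by rw [hM]; field_simp
  -- The first bound keeps `|x - z| ≥ R / 2`, the second keeps `M (R² - |x - z|²) ≤ 1`.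
  set δ := min (R / 2) (1 / (2 * M * R)) with hδ
  have hδ0 : 0 < δ := lt_min (by positivity) (by positivity)
  have hδ1 : δ ≤ R / 2 := min_le_left _ _
  have hδ2 : 2 * M * R * δ ≤ 1 := by
    have := min_le_right (R / 2) (1 / (2 * M * R))
    rw [← hδ, le_div_iff₀ (by positivity)] at this
    linarith
  -- geometry of the region
  have hreg : ∀ x ∈ K₀, ‖x - x₀‖ ≤ δ → R / 2 ≤ ‖x - z‖ ∧ 0 ≤ R ^ 2 - ‖x - z‖ ^ 2 ∧
      R ^ 2 - ‖x - z‖ ^ 2 ≤ R ^ 2 ∧ M * (R ^ 2 - ‖x - z‖ ^ 2) ≤ 1 := by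
    intro x hx hxδ
    rw [hK₀, mem_closedBall_iff_norm] at hx
    have h1 : R ≤ ‖x - z‖ + ‖x - x₀‖ := by
      rw [← hx₀, show x₀ - z = (x - z) - (x - x₀) by abel]
      exact norm_sub_le _ _
    have h2 := norm_nonneg (x - z)
    have h3 : R ^ 2 - ‖x - z‖ ^ 2 ≤ 2 * R * δ := by nlinarith
    refine ⟨by linarith, by nlinarith, by nlinarith, ?_⟩
    nlinarith [mul_le_mul_of_nonneg_left h3 hM0.le]
  set w : E → ℝ := fun x => (R ^ 2 - ‖x - z‖ ^ 2)
    + M * ((R ^ 2 - ‖x - z‖ ^ 2) * (R ^ 2 - ‖x - z‖ ^ 2)) with hw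
  have hwc : Continuous w := by simp only [hw]; fun_prop
  have hwreg : ∀ x ∈ K₀, ‖x - x₀‖ ≤ δ → R ^ 2 - ‖x - z‖ ^ 2 ≤ w x ∧ w x ≤ 2 * R ^ 2 := by
    intro x hx hxδ
    obtain ⟨-, h2, h3, h4⟩ := hreg x hx hxδ
    have h5 : 0 ≤ M * ((R ^ 2 - ‖x - z‖ ^ 2) * (R ^ 2 - ‖x - z‖ ^ 2)) := by positivity
    simp only [hw]
    refine ⟨by linarith, ?_⟩
    nlinarith [mul_le_mul_of_nonneg_right h4 h2]
  -- compact sets of unit tangent vectors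
  set S : Set (E × E) := {q | q.1 ∈ K₀ ∧ ‖q.1 - x₀‖ ≤ δ ∧ ‖q.2‖ = 1 ∧ ⟪q.2, q.1⟫ = 0} with hSdef
  have hScpt : IsCompact S := by
    refine (hcpt.prod (isCompact_closedBall (0 : E) 1)).of_isClosed_subset ?_ ?_
    · refine IsClosed.inter (Metric.isClosed_closedBall.preimage continuous_fst) ?_
      refine IsClosed.inter (isClosed_le
        (f := fun q : E × E => ‖q.1 - x₀‖) (by fun_prop) continuous_const) ?_
      refine IsClosed.inter (isClosed_eq (f := fun q : E × E => ‖q.2‖) (by fun_prop)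
        continuous_const) ?_
      exact isClosed_eq (continuous_snd.inner continuous_fst) continuous_const
    · rintro ⟨x, u⟩ ⟨h1, -, h2, -⟩
      exact ⟨h1, by simpa using h2.le⟩
  have hcΦ : ContinuousOn (fun q : E × E => hes (Cone a c) H q.1 q.2 q.2) S := by
    have h1 : ContinuousOn (fun q : E × E => hes (Cone a c) H q.1) S :=
      (hcH2.mono hball).comp continuousOn_fst fun q hq => hq.1
    exact (h1.clm_apply continuousOn_snd).clm_apply continuousOn_snd
  obtain ⟨m₁, hm₁, hm₁S⟩ : ∃ m₁ : ℝ, 0 < m₁ ∧ ∀ q ∈ S, ‖q.1 - x₀‖ = δ →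
      m₁ ≤ hes (Cone a c) H q.1 q.2 q.2 := by
    have hS₁ : IsCompact (S ∩ {q | ‖q.1 - x₀‖ = δ}) :=
      hScpt.inter_right (isClosed_eq (by fun_prop) continuous_const)
    rcases (S ∩ {q | ‖q.1 - x₀‖ = δ}).eq_empty_or_nonempty with he | hne'
    · refine ⟨1, one_pos, fun q hq hqδ => ?_⟩
      exact absurd (show q ∈ S ∩ {q | ‖q.1 - x₀‖ = δ} from ⟨hq, hqδ⟩) (by rw [he]; simp)
    · obtain ⟨q₁, hq₁, hqmin⟩ := hS₁.exists_isMinOn hne' (hcΦ.mono Set.inter_subset_left)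
      refine ⟨_, hpos q₁.1 hq₁.1.1 ?_ q₁.2 hq₁.1.2.2.2 ?_, fun q hq hqδ => hqmin ⟨hq, hqδ⟩⟩
      · intro h
        have := hq₁.2
        rw [Set.mem_ofPred_eq, h, sub_self, norm_zero] at this
        exact hδ0.ne this
      · intro h
        have := hq₁.1.2.2.1
        rw [h, norm_zero] at this
        exact zero_ne_one this
  -- As `w ≤ 2 R²`, this keeps the barrier below the Hessian on the part of the region where `|x -
  -- x₀| = δ`.
  set ε := m₁ / (2 * R ^ 2) with hε
  have hε0 : 0 < ε := by positivity
  have hεm : ε * (2 * R ^ 2) = m₁ := by rw [hε]; field_simp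
  suffices hmain : ∀ q ∈ S, ε * w q.1 ≤ hes (Cone a c) H q.1 q.2 q.2 by
    refine ⟨ε, δ, hε0, hδ0, fun x hx hxδ u hu hux => ?_⟩
    refine le_trans ?_ (hmain (x, u) ⟨hx, hxδ, hu, hux⟩)
    exact mul_le_mul_of_nonneg_left (hwreg x hx hxδ).1 hε0.le
  by_contra! hcon
  obtain ⟨q', hq', hlt'⟩ := hcon
  obtain ⟨⟨x₁, v⟩, hq₁, hqmin⟩ := hScpt.exists_isMinOn ⟨q', hq'⟩
    (hcΦ.sub ((continuous_const.mul (hwc.comp continuous_fst)).continuousOn :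
      ContinuousOn (fun q : E × E => ε * w q.1) S))
  have hqmin' : ∀ q ∈ S, hes (Cone a c) H x₁ v v - ε * w x₁
      ≤ hes (Cone a c) H q.1 q.2 q.2 - ε * w q.1 := fun q hq => hqmin hq
  have hq₁' := hq₁
  obtain ⟨hx₁K, hx₁δ, hv, hvx⟩ := hq₁
  simp only at hx₁K hx₁δ hv hvx
  -- The largest amount by which the barrier exceeds the Hessian. Lowering the barrier by `κ'` makes
  -- it touch from below at `x₁`, which lies strictly inside the region because the barrier stays
  -- below the Hessian on both boundary pieces.
  set κ' := ε * w x₁ - hes (Cone a c) H x₁ v v with hκ'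
  have hκ'0 : 0 < κ' := by linarith [hqmin' q' hq']
  have hnn := hS.convex_H x₁ (hball hx₁K) v
  have hlt1 : ‖x₁ - z‖ < R := by
    refine lt_of_le_of_ne (mem_closedBall_iff_norm.1 hx₁K) fun h => ?_
    have : w x₁ = 0 := by simp only [hw, h]; ring
    rw [hκ', this] at hκ'0
    linarith
  have hlt2 : ‖x₁ - x₀‖ < δ := by
    refine lt_of_le_of_ne hx₁δ fun h => ?_
    have h1 := hm₁S _ hq₁' h
    have h2 := mul_le_mul_of_nonneg_left (hwreg x₁ hx₁K hx₁δ).2 hε0.le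
    simp only at h1
    linarith
  have hx₁o : x₁ ∈ OpenCone a c := hopen (mem_ball_iff_norm.2 hlt1)
  have hne1 : x₁ ≠ x₀ := fun h => by rw [h, hx₀] at hlt1; exact lt_irrefl _ hlt1
  have hv0 : v ≠ 0 := fun h => by rw [h, norm_zero] at hv; exact zero_ne_one hv
  have hlam : 0 < hes (Cone a c) H x₁ v v := hpos x₁ hx₁K hne1 v hvx hv0
  have hΩeq : ε * w x₁ - κ' = hes (Cone a c) H x₁ v v := by rw [hκ']; ring
  have hκle : ∀ x ∈ K₀, (‖x‖ ^ 2)⁻¹ ≤ κ := by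
    intro x hx
    have h1 : ‖y₃‖ ≤ ‖x‖ := hmin₃ hx
    exact inv_anti₀ (by positivity) (by gcongr)
  have htouch : ∀ᶠ x in 𝓝 x₁, ∀ u, (ε * w x - κ') * (‖u‖ ^ 2 - κ * ⟪u, x⟫ ^ 2)
      ≤ hes (Cone a c) H x u u := by
    have e1 : ∀ᶠ x in 𝓝 x₁, ‖x - z‖ < R :=
      ContinuousAt.eventually_lt (by fun_prop) continuousAt_const hlt1
    have e2 : ∀ᶠ x in 𝓝 x₁, ‖x - x₀‖ < δ :=
      ContinuousAt.eventually_lt (by fun_prop) continuousAt_const hlt2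
    have e3 : ∀ᶠ x in 𝓝 x₁, 0 < ε * w x - κ' := by
      have hc : Continuous fun x => ε * w x - κ' := (continuous_const.mul hwc).sub continuous_const
      exact ContinuousAt.eventually_lt continuousAt_const hc.continuousAt (by rw [hΩeq]; exact hlam)
    filter_upwards [e1, e2, e3] with x h1 h2 h3
    have hxK : x ∈ K₀ := mem_closedBall_iff_norm.2 h1.le
    refine hS.le_hes (hball hxK) h3.le (hκle x hxK) fun u hu hux => ?_
    have := hqmin' (x, u) ⟨hxK, h2.le, hu, hux⟩
    simp only at this
    linarith
  have hbil : ∀ u, ‖u‖ = 1 → hes (Cone a c) H x₁ u u ≤ max L2 L3 := by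
    intro u hu
    have h1 := (hes (Cone a c) H x₁).le_opNorm₂ u u
    rw [hu, mul_one, mul_one] at h1
    exact (le_abs_self _).trans (h1.trans ((hL2 x₁ hx₁K).trans (le_max_left _ _)))
  have htri : ∀ u v w, ‖u‖ = 1 → ‖v‖ = 1 → ‖w‖ = 1 →
      |thd (Cone a c) H x₁ u v w| ≤ max L2 L3 := by
    intro u v w hu hv hw
    have h1 := (thd (Cone a c) H x₁ u).le_opNorm₂ v w
    have h2 := (thd (Cone a c) H x₁).le_opNorm u
    rw [hv, hw, mul_one, mul_one] at h1
    rw [hu, mul_one] at h2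
    exact h1.trans (h2.trans ((hL3 x₁ hx₁K).trans (le_max_right _ _)))
  obtain ⟨hr1, hr2, hr3, hr4⟩ := hreg x₁ hx₁K hx₁δ
  have hw2 := (hwreg x₁ hx₁K hx₁δ).2
  set s := R ^ 2 - ‖x₁ - z‖ ^ 2 with hs
  obtain ⟨b, f, hf, hfin⟩ := hS.touching (κ₀ := κ₀) (L := max L2 L3) (Ω := fun x => ε * w x - κ')
    (η := ε * (6 * R)) hInv hx₁o hbil htri
    (fun b => by rw [msym_bmat_eq b b₀]; exact hmin₁ hx₁K)
    (fun ξ => hasJet2_barrier z x₁ ξ R M ε κ')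
    (fun ξ hξ => by
      have h1 := abs_real_inner_le_norm (x₁ - z) ξ
      rw [hξ, mul_one] at h1
      have h2 : 0 ≤ 1 + 2 * M * s := by positivity
      have h3 : 1 + 2 * M * s ≤ 3 := by linarith
      rw [abs_mul, abs_of_pos hε0, abs_mul, abs_mul, abs_of_nonneg h2]
      refine mul_le_mul_of_nonneg_left ?_ hε0.le
      have h4 : |(-2 : ℝ)| * |⟪x₁ - z, ξ⟫| ≤ 2 * R := by norm_num; linarith
      calc _ ≤ 2 * R * 3 := mul_le_mul h4 h3 h2 (by positivity)
        _ = _ := by ring)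
    hκpos.le hc₀.le htouch hv hvx hΩeq.symm (by rw [hΩeq]; exact hlam)
  have hΩle : ε * w x₁ - κ' ≤ ε * (2 * R ^ 2) := by
    have := mul_le_mul_of_nonneg_left hw2 hε0.le
    linarith
  have hΩ0 : 0 ≤ ε * w x₁ - κ' := by rw [hΩeq]; exact hlam.le
  have hup : C₀ * (ε * (6 * R) + (ε * w x₁ - κ') / ‖x₁‖) + (p - 1) * ((ε * w x₁ - κ') / H x₁)
      + 2 * κ * (ε * w x₁ - κ') * (N * C₀) ≤ ε * Cup := by
    have h1 : (ε * w x₁ - κ') / ‖x₁‖ ≤ ε * (2 * R ^ 2) / ‖y₃‖ :=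
      div_le_div₀ (by positivity) hΩle hρ (hmin₃ hx₁K)
    have h2 : (ε * w x₁ - κ') / H x₁ ≤ ε * (2 * R ^ 2) / H y₂ :=
      div_le_div₀ (by positivity) hΩle hh₀ (hmin₂ hx₁K)
    have h3 : 2 * κ * (ε * w x₁ - κ') * (N * C₀) ≤ 2 * κ * (ε * (2 * R ^ 2)) * (N * C₀) := by
      gcongr
    have h4 := mul_le_mul_of_nonneg_left h1 hC₀
    have h5 := mul_le_mul_of_nonneg_left h2 hp
    have h6 : ε * Cup = C₀ * (ε * (6 * R) + ε * (2 * R ^ 2) / ‖y₃‖)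
        + (p - 1) * (ε * (2 * R ^ 2) / H y₂) + 2 * κ * (ε * (2 * R ^ 2)) * (N * C₀) := by
      rw [hCup]; ring
    linarith
  have hlow : ε * (2 * M * c₀ * R ^ 2 - 6 * (N * C₀))
      ≤ ∑ i, f i * (ε * (-2 * ‖b i‖ ^ 2 * (1 + 2 * M * s) + 8 * M * ⟪x₁ - z, b i⟫ ^ 2)) := by
    have h1 : ∀ i, f i * (ε * (-2 * ‖b i‖ ^ 2 * (1 + 2 * M * s) + 8 * M * ⟪x₁ - z, b i⟫ ^ 2))
        ≥ ε * (8 * M * c₀ * ⟪x₁ - z, b i⟫ ^ 2 - 6 * C₀) := by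
      intro i
      rw [b.norm_eq_one]
      have h2 : f i * (1 + 2 * M * s) ≤ C₀ * 3 :=
        mul_le_mul (hf i).2 (by linarith) (by positivity) hC₀
      have h3 : c₀ * (8 * M * ⟪x₁ - z, b i⟫ ^ 2) ≤ f i * (8 * M * ⟪x₁ - z, b i⟫ ^ 2) :=
        mul_le_mul_of_nonneg_right (hf i).1 (by positivity)
      have h4 : 8 * M * c₀ * ⟪x₁ - z, b i⟫ ^ 2 - 6 * C₀
          ≤ f i * (-2 * 1 ^ 2 * (1 + 2 * M * s) + 8 * M * ⟪x₁ - z, b i⟫ ^ 2) := by linarith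
      calc _ ≤ ε * (f i * (-2 * 1 ^ 2 * (1 + 2 * M * s) + 8 * M * ⟪x₁ - z, b i⟫ ^ 2)) :=
            mul_le_mul_of_nonneg_left h4 hε0.le
        _ = _ := by ring
    refine le_trans ?_ (Finset.sum_le_sum fun i _ => h1 i)
    rw [← Finset.mul_sum, Finset.sum_sub_distrib, ← Finset.mul_sum]
    have h5 : ∑ i, ⟪x₁ - z, b i⟫ ^ 2 = ‖x₁ - z‖ ^ 2 := by
      have := b.sum_sq_norm_inner_left (x₁ - z)
      simpa using this
    rw [h5]
    refine mul_le_mul_of_nonneg_left ?_ hε0.le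
    have h6 : (R / 2) ^ 2 ≤ ‖x₁ - z‖ ^ 2 := by gcongr
    have h7 := mul_le_mul_of_nonneg_left h6 (show 0 ≤ 8 * M * c₀ by positivity)
    simp only [Finset.sum_const, Finset.card_univ, Fintype.card_fin, nsmul_eq_mul]
    linarith
  rw [hMeq] at hlow
  have : ε * (Cup + 6 * (N * C₀) + 1 - 6 * (N * C₀)) ≤ ε * Cup := hlow.trans (hfin.trans hup)
  linarith

/-- The normal derivative of the Hessian at a degenerate point on the boundary of a ball in which
the Hessian is nondegenerate. -/
theorem thd_neg_of_hopf [FiniteDimensional ℝ E] (hS : IsSol a c k l p g H) {z x₀ : E} {R : ℝ}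
    (hR : 0 < R)
    (hball : Metric.closedBall z R ⊆ Cone a c) (hopen : Metric.ball z R ⊆ OpenCone a c)
    (hx₀ : ‖x₀ - z‖ = R)
    (hpos : ∀ x ∈ Metric.closedBall z R, x ≠ x₀ → ∀ u, ⟪u, x⟫ = 0 → u ≠ 0 →
      0 < hes (Cone a c) H x u u) {u : E} (hu : u ≠ 0) (hux : ⟪u, x₀⟫ = 0)
    (hdeg : hes (Cone a c) H x₀ u u = 0) :
    thd (Cone a c) H x₀ (x₀ - z) u u < 0 := by
  obtain ⟨ε, δ, hε, hδ, h⟩ := hS.hopf hR hball hopen hx₀ hpos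
  have hx₀K : x₀ ∈ Metric.closedBall z R := mem_closedBall_iff_norm.2 hx₀.le
  set ν := x₀ - z with hν
  have hnorm : ∀ t ∈ Set.Icc (0 : ℝ) 1, ‖x₀ - t • ν - z‖ = (1 - t) * R := by
    intro t ht
    rw [show x₀ - t • ν - z = (1 - t) • ν by rw [sub_smul, one_smul, hν]; abel, norm_smul, hx₀,
      Real.norm_of_nonneg (by linarith [ht.2])]
  have hmem : ∀ t ∈ Set.Icc (0 : ℝ) 1, x₀ - t • ν ∈ Metric.closedBall z R := by
    intro t ht
    rw [mem_closedBall_iff_norm, hnorm t ht]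
    nlinarith [ht.1]
  have hline : HasDerivWithinAt (fun t : ℝ => x₀ - t • ν) (-ν) (Set.Icc 0 1) 0 :=
    ((((hasDerivAt_id (0 : ℝ)).smul_const ν).const_sub x₀).congr_deriv
      (by rw [one_smul])).hasDerivWithinAt
  have hd1 : HasDerivWithinAt (fun t : ℝ => hes (Cone a c) H (x₀ - t • ν))
      (thd (Cone a c) H x₀ (-ν)) (Set.Icc 0 1) 0 := by
    refine HasFDerivWithinAt.comp_hasDerivWithinAt_of_eq (0 : ℝ) (t := Cone a c)
      (hasFDerivWithinAt_hes hS.uniqueDiffOn hS.smooth_H (hball hx₀K)) hline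
      (fun t ht => hball (hmem t ht)) (by simp)
  have hd : HasDerivWithinAt (fun t : ℝ => hes (Cone a c) H (x₀ - t • ν) u u)
      (-thd (Cone a c) H x₀ ν u u) (Set.Icc 0 1) 0 := by
    have := (hd1.clm_apply (hasDerivWithinAt_const (0 : ℝ) _ u)).clm_apply
      (hasDerivWithinAt_const (0 : ℝ) _ u)
    simpa using this
  -- The factor `4` dominates `‖x‖⁻²` once `‖x‖ > ‖x₀‖ / 2`. The fixed vector `u` ceases to be
  -- orthogonal to the moving point, but the correction is of order `t²` and costs at most half of
  -- `‖u‖²`.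
  set κ := (‖x₀‖ ^ 2)⁻¹ * 4 with hκ
  have hx₀n : 0 < ‖x₀‖ := norm_pos_iff.2 (hball hx₀K).1
  have hun : 0 < ‖u‖ := norm_pos_iff.2 hu
  have hlim : Tendsto (fun t : ℝ => x₀ - t • ν) (𝓝[>] 0) (𝓝 x₀) := by
    have h1 : ContinuousAt (fun t : ℝ => x₀ - t • ν) 0 := by fun_prop
    have h2 := h1.tendsto
    simp only [zero_smul, sub_zero] at h2
    exact h2.mono_left nhdsWithin_le_nhds
  have key := le_of_hasDerivWithinAt (m := ε * R ^ 2 * (‖u‖ ^ 2 / 2)) one_pos hd (by simpa using hdeg) (by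
    have e1 : ∀ᶠ t in 𝓝[>] (0 : ℝ), ‖x₀ - t • ν - x₀‖ < δ :=
      (hlim.eventually (ContinuousAt.eventually_lt (f := fun x => ‖x - x₀‖) (by fun_prop)
        continuousAt_const (by simpa using hδ)))
    have e2 : ∀ᶠ t in 𝓝[>] (0 : ℝ), ‖x₀‖ / 2 < ‖x₀ - t • ν‖ :=
      (hlim.eventually (ContinuousAt.eventually_lt (f := fun _ => ‖x₀‖ / 2) continuousAt_const
        (by fun_prop) (by linarith)))
    have e3 : ∀ᶠ t in 𝓝[>] (0 : ℝ), κ * (t ^ 2 * ⟪u, ν⟫ ^ 2) < ‖u‖ ^ 2 / 2 := by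
      refine Filter.Eventually.filter_mono nhdsWithin_le_nhds ?_
      exact ContinuousAt.eventually_lt (by fun_prop) continuousAt_const (by simp; positivity)
    filter_upwards [e1, e2, e3, Ioc_mem_nhdsGT (zero_lt_one (α := ℝ))] with t h1 h2 h3 ht
    have htI : t ∈ Set.Icc (0 : ℝ) 1 := Set.Ioc_subset_Icc_self ht
    have h4 : R ^ 2 * t ≤ R ^ 2 - ‖x₀ - t • ν - z‖ ^ 2 := by
      rw [hnorm t htI]
      nlinarith [mul_nonneg (mul_nonneg ht.1.le (sub_nonneg.2 ht.2)) (sq_nonneg R)]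
    have h5 : (‖x₀ - t • ν‖ ^ 2)⁻¹ ≤ κ := by
      rw [hκ, show (‖x₀‖ ^ 2)⁻¹ * 4 = ((‖x₀‖ / 2) ^ 2)⁻¹ by field_simp; norm_num]
      exact inv_anti₀ (by positivity) (by gcongr)
    have h6 := hS.le_hes (hball (hmem t htI)) (m := ε * (R ^ 2 * t)) (by have := ht.1; positivity) h5
      (fun u hu hux => (mul_le_mul_of_nonneg_left h4 hε.le).trans
        (h _ (hmem t htI) h1.le u hu hux)) u
    refine le_trans ?_ h6
    have h7 : ⟪u, x₀ - t • ν⟫ ^ 2 = t ^ 2 * ⟪u, ν⟫ ^ 2 := by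
      rw [inner_sub_right, hux, inner_smul_right]; ring
    rw [h7]
    have h8 : ‖u‖ ^ 2 / 2 ≤ ‖u‖ ^ 2 - κ * (t ^ 2 * ⟪u, ν⟫ ^ 2) := by linarith
    have h9 := mul_le_mul_of_nonneg_left h8 (show 0 ≤ ε * (R ^ 2 * t) by have := ht.1; positivity)
    linarith)
  have : 0 < ε * R ^ 2 * (‖u‖ ^ 2 / 2) := by positivity
  linarith

end IsSol

end Hopf

end CapillaryRank

namespace CapillaryRank

open Filter Topology

/-! ### Full rank in the interior of the cone -/

section FullRank

variable {E : Type*} [NormedAddCommGroup E] [InnerProductSpace ℝ E]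

/-- The ball of half the radius, internally tangent at `x₀`, meets the large sphere only there, by
the parallelogram law. It supplies a closed ball whose only possible bad point is `x₀`. -/
theorem norm_sub_lt_of_mem_half_ball {z x₀ x : E} (h : ‖x - (2⁻¹ : ℝ) • (z + x₀)‖ ≤ ‖x₀ - z‖ / 2)
    (hne : x ≠ x₀) : ‖x - z‖ < ‖x₀ - z‖ := by
  have h1 := parallelogram_law_with_norm ℝ (x - (2⁻¹ : ℝ) • (z + x₀)) ((2⁻¹ : ℝ) • (x₀ - z))
  have e1 : x - (2⁻¹ : ℝ) • (z + x₀) + (2⁻¹ : ℝ) • (x₀ - z) = x - z := by module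
  have e2 : x - (2⁻¹ : ℝ) • (z + x₀) - (2⁻¹ : ℝ) • (x₀ - z) = x - x₀ := by module
  rw [e1, e2, norm_smul, Real.norm_of_nonneg (by norm_num)] at h1
  have h2 : 0 < ‖x - x₀‖ := norm_pos_iff.2 (sub_ne_zero.2 hne)
  have h3 := mul_self_le_mul_self (norm_nonneg _) h
  refine lt_of_mul_self_lt_mul_self₀ (norm_nonneg _) ?_
  nlinarith [mul_pos h2 h2]

theorem norm_sub_half {z x₀ : E} : ‖x₀ - (2⁻¹ : ℝ) • (z + x₀)‖ = ‖x₀ - z‖ / 2 := by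
  rw [show x₀ - (2⁻¹ : ℝ) • (z + x₀) = (2⁻¹ : ℝ) • (x₀ - z) by module, norm_smul,
    Real.norm_of_nonneg (by norm_num)]
  ring

namespace IsSol

variable {a : E} {c : ℝ} {k l : ℕ} {p : ℝ} {g H : E → ℝ}

/-- The derivative of a function along a ray towards the inside of the cone. -/
theorem hasDerivWithinAt_ray {F : Type*} [NormedAddCommGroup F] [NormedSpace ℝ F] {K : Set E}
    {G : E → F} {G' : E →L[ℝ] F} {y v : E} {r : ℝ} (hG : HasFDerivWithinAt G G' K y)
    (h : ∀ t ∈ Set.Icc 0 r, y + t • v ∈ K) :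
    HasDerivWithinAt (fun t : ℝ => G (y + t • v)) (G' v) (Set.Icc 0 r) 0 := by
  have hline : HasDerivWithinAt (fun t : ℝ => y + t • v) v (Set.Icc 0 r) 0 :=
    ((((hasDerivAt_id (0 : ℝ)).smul_const v).const_add y).congr_deriv
      (by rw [one_smul])).hasDerivWithinAt
  exact hG.comp_hasDerivWithinAt_of_eq (0 : ℝ) hline h (by simp)

/-- At a minimum point of `H` on the unit sphere, the Hessian is nondegenerate. -/
theorem exists_nondegenerate [FiniteDimensional ℝ E] (hS : IsSol a c k l p g H) :
    ∃ y ∈ OpenCone a c, ∀ u, ⟪u, y⟫ = 0 → u ≠ 0 → 0 < hes (Cone a c) H y u u := by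
  have hproper : ProperSpace E := FiniteDimensional.proper ℝ E
  have ha := hS.norm_axis
  have hmemS : ∀ y : E, ‖y‖ = 1 → c * ‖y‖ ≤ ⟪a, y⟫ → y ∈ Cone a c := fun y h1 h2 =>
    ⟨fun h => by rw [h, norm_zero] at h1; exact zero_ne_one h1, h2⟩
  set S : Set E := Metric.sphere 0 1 ∩ {y | c * ‖y‖ ≤ ⟪a, y⟫} with hSdef
  have hScpt : IsCompact S := (isCompact_sphere 0 1).inter_right
    (isClosed_le (by fun_prop) (continuous_const.inner continuous_id))
  have hSK : S ⊆ Cone a c := fun y hy => hmemS y (by simpa using hy.1) hy.2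
  have haK : a ∈ Cone a c := openCone_subset_cone (axis_mem_openCone ha hS.c_lt)
  obtain ⟨y, hy, hmin⟩ := hScpt.exists_isMinOn ⟨a, by simpa using ha, haK.2⟩
    (hS.smooth_H.continuousOn.mono hSK)
  have hyK := hSK hy
  have hy1 : ‖y‖ = 1 := by simpa using hy.1
  set m := H y with hm
  have hm0 : 0 < m := hS.pos_H y hyK
  -- By homogeneity the minimum on the sphere makes the multiple `m` of the norm a support function
  -- of `H`, touching at `y`.
  have hlow : ∀ x ∈ Cone a c, m * ‖x‖ ≤ H x := by
    intro x hx
    have hxn : 0 < ‖x‖ := norm_pos_iff.2 hx.1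
    have h1 := smul_mem_cone hx (inv_pos.2 hxn)
    have h2 : m ≤ H (‖x‖⁻¹ • x) := hmin ⟨by simp [norm_smul, hxn.ne'], h1.2⟩
    rw [hS.hom_H x hx _ (inv_pos.2 hxn)] at h2
    have h3 := mul_le_mul_of_nonneg_right h2 hxn.le
    refine h3.trans (le_of_eq ?_)
    field_simp
  -- At a lateral boundary point `H` is stationary along the axis, whereas the lower bound grows at
  -- rate `m c`.
  have hopen : y ∈ OpenCone a c := by
    refine lt_of_le_of_ne hyK.2 fun hbd => ?_
    have hmem : ∀ t ∈ Set.Icc (0 : ℝ) 1, y + t • a ∈ Cone a c := by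
      intro t ht
      rcases ht.1.eq_or_lt with h | h
      · rw [← h, zero_smul, add_zero]; exact hyK
      · exact openCone_subset_cone
          (add_mem_openCone hS.c_pos hyK (smul_mem_openCone (axis_mem_openCone ha hS.c_lt) h))
    have h1 := (hasDerivWithinAt_ray (hasFDerivWithinAt_self hS.smooth_H hyK) hmem).sub_const m
    rw [hS.boundary_H y hyK hbd] at h1
    have h2 := le_of_hasDerivWithinAt (m := m * c) one_pos h1 (by simp [hm]) (by
      filter_upwards [Ioc_mem_nhdsGT (zero_lt_one (α := ℝ))] with t ht
      have h3 := hlow _ (hmem t (Set.Ioc_subset_Icc_self ht))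
      have h4 : 1 + c * t ≤ ‖y + t • a‖ := by
        refine le_of_sq_le_sq ?_ (norm_nonneg _)
        rw [norm_add_sq_real, norm_smul, inner_smul_right, real_inner_comm, ← hbd, hy1, ha,
          Real.norm_of_nonneg ht.1.le]
        have hc2 : c ^ 2 ≤ 1 := pow_le_one₀ hS.c_pos.le hS.c_lt.le
        nlinarith [mul_le_mul_of_nonneg_right hc2 (sq_nonneg t)]
      nlinarith [mul_le_mul_of_nonneg_left h4 hm0.le])
    have := mul_pos hm0 hS.c_pos
    linarith
  refine ⟨y, hopen, fun u huy hu => ?_⟩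
  have hun : 0 < ‖u‖ := norm_pos_iff.2 hu
  have hnhds := cone_mem_nhds hopen
  have hid := HasJet2.id
  have hj := (hasJet2_line hS.uniqueDiffOn hS.smooth_H hnhds u).sub
    ((HasJet2.const m).add ((hid.mul hid).mul (HasJet2.const (m * (‖u‖ ^ 2 / 4)))))
  have hline : Tendsto (fun t : ℝ => y + t • u) (𝓝 0) (𝓝 y) := by
    have : ContinuousAt (fun t : ℝ => y + t • u) 0 := by fun_prop
    simpa using this.tendsto
  -- The range in which √(1+s) ≥ 1 + s/4, with s = t²‖u‖²; the crude constant `1/4` is enough for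
  -- positivity.
  have hsmall : ∀ᶠ t in 𝓝 (0 : ℝ), t ^ 2 * ‖u‖ ^ 2 < 8 :=
    ContinuousAt.eventually_lt (by fun_prop) continuousAt_const (by simp)
  obtain ⟨-, h2⟩ := hj.of_isLocalMin (by
    filter_upwards [hline.eventually hnhds, hsmall] with t ht ht2
    have h3 := hlow _ ht
    have h4 : 1 + t ^ 2 * ‖u‖ ^ 2 / 4 ≤ ‖y + t • u‖ := by
      refine le_of_sq_le_sq ?_ (norm_nonneg _)
      rw [norm_add_sq_real, norm_smul, inner_smul_right, real_inner_comm, huy, hy1, mul_pow,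
        Real.norm_eq_abs, sq_abs]
      nlinarith [mul_nonneg (sq_nonneg t) (sq_nonneg ‖u‖)]
    have h5 := mul_le_mul_of_nonneg_left h4 hm0.le
    simp only [zero_smul, add_zero, zero_mul, mul_zero]
    linarith)
  have h6 : 0 < m * (‖u‖ ^ 2 / 4) := by positivity
  simp at h2
  linarith

/-- The constant rank theorem in the interior. -/
theorem hes_pos_of_mem_openCone [FiniteDimensional ℝ E] (hS : IsSol a c k l p g H) {y : E}
    (hy : y ∈ OpenCone a c) {u : E} (huy : ⟪u, y⟫ = 0) (hu : u ≠ 0) :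
    0 < hes (Cone a c) H y u u := by
  have hproper : ProperSpace E := FiniteDimensional.proper ℝ E
  refine lt_of_le_of_ne (hS.convex_H y (openCone_subset_cone hy) u) fun hdeg => ?_
  obtain ⟨y₀, hy₀, hpos₀⟩ := hS.exists_nondegenerate
  have hcH2 : ContinuousOn (hes (Cone a c) H) (Cone a c) :=
    (contDiffOn_hes hS.uniqueDiffOn hS.smooth_H).continuousOn
  have hseg : segment ℝ y₀ y ⊆ OpenCone a c := (convex_openCone hS.c_pos).segment_subset hy₀ hy
  have hsegc : IsCompact (segment ℝ y₀ y) := by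
    rw [segment_eq_image_lineMap]
    exact isCompact_Icc.image (by fun_prop)
  obtain ⟨r, hr, hT⟩ := hsegc.exists_cthickening_subset_open isOpen_openCone hseg
  set T := Metric.cthickening r (segment ℝ y₀ y) with hTdef
  have hTc : IsCompact T := hsegc.cthickening
  have hTK : T ⊆ Cone a c := hT.trans openCone_subset_cone
  -- The degenerate points in a compact neighbourhood of the segment from the good point `y₀` to
  -- `y`, obtained by projecting the compact set of unit null vectors.
  set D : Set E := Prod.fst '' {q : E × E | q ∈ T ×ˢ Metric.sphere (0 : E) 1 ∧ ⟪q.2, q.1⟫ = 0 ∧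
    hes (Cone a c) H q.1 q.2 q.2 = 0} with hD
  have hDc : IsCompact D := by
    refine IsCompact.image ?_ continuous_fst
    have hprod := hTc.prod (isCompact_sphere (0 : E) 1)
    have hcΦ : ContinuousOn (fun q : E × E => hes (Cone a c) H q.1 q.2 q.2)
        (T ×ˢ Metric.sphere (0 : E) 1) := by
      have h1 : ContinuousOn (fun q : E × E => hes (Cone a c) H q.1)
          (T ×ˢ Metric.sphere (0 : E) 1) :=
        (hcH2.mono hTK).comp continuousOn_fst fun q hq => hq.1
      exact (h1.clm_apply continuousOn_snd).clm_apply continuousOn_snd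
    have h2 := hprod.inter_right (t := {q : E × E | ⟪q.2, q.1⟫ = 0})
      (isClosed_eq (continuous_snd.inner continuous_fst) continuous_const)
    have h3 := (hcΦ.mono Set.inter_subset_left).preimage_isClosed_of_isClosed h2.isClosed
      (isClosed_singleton (x := (0 : ℝ)))
    rw [show {q : E × E | q ∈ T ×ˢ Metric.sphere (0 : E) 1 ∧ ⟪q.2, q.1⟫ = 0 ∧
      hes (Cone a c) H q.1 q.2 q.2 = 0} = T ×ˢ Metric.sphere (0 : E) 1
        ∩ {q : E × E | ⟪q.2, q.1⟫ = 0} ∩ (fun q => hes (Cone a c) H q.1 q.2 q.2) ⁻¹' {0} from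
      Set.ext fun q => (and_assoc (b := ⟪q.2, q.1⟫ = 0)).symm]
    exact h2.of_isClosed_subset h3 Set.inter_subset_left
  have hDmem : ∀ x ∈ T, x ∉ D → ∀ u, ⟪u, x⟫ = 0 → u ≠ 0 → 0 < hes (Cone a c) H x u u := by
    intro x hx hxD u hux hu
    refine lt_of_le_of_ne (hS.convex_H x (hTK hx) u) fun h => hxD ?_
    have hun : 0 < ‖u‖ := norm_pos_iff.2 hu
    refine ⟨(x, ‖u‖⁻¹ • u), ⟨⟨hx, by simp [norm_smul, hun.ne']⟩, ?_, ?_⟩, rfl⟩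
    · simp [inner_smul_left, hux]
    · simp [← h]
  have hsegT : segment ℝ y₀ y ⊆ T := Metric.self_subset_cthickening _
  have hyD : y ∈ D := by
    by_contra hyD
    exact (hDmem y (hsegT (right_mem_segment ℝ y₀ y)) hyD u huy hu).ne hdeg
  have hy₀D : y₀ ∉ D := by
    rintro ⟨⟨x, v⟩, ⟨⟨-, hv⟩, hvx, hv0⟩, rfl⟩
    refine (hpos₀ v hvx ?_).ne' hv0
    rintro rfl
    simp at hv
  have hDne : D.Nonempty := ⟨y, hyD⟩
  have hd0 : 0 < Metric.infDist y₀ D := (hDc.isClosed.notMem_iff_infDist_pos hDne).1 hy₀D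
  set ρ := min (Metric.infDist y₀ D) r / 2 with hρ
  have hρ0 : 0 < ρ := by positivity
  have hρ1 : ρ ≤ Metric.infDist y₀ D := by
    have := min_le_left (Metric.infDist y₀ D) r; linarith [lt_min hd0 hr]
  have hρ2 : ρ ≤ r := by
    have := min_le_right (Metric.infDist y₀ D) r; linarith [lt_min hd0 hr]
  -- Along the segment the distance to `D` falls from at least `ρ` to zero, so some `z` is at
  -- distance exactly `ρ`. Since `ρ ≤ r`, the ball about `z` stays in `T`, and it touches `D` first
  -- at `x₀`.
  obtain ⟨z, hz, hzρ⟩ : ∃ z ∈ segment ℝ y₀ y, Metric.infDist z D = ρ := by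
    have hconn : IsPreconnected (segment ℝ y₀ y) := (convex_segment y₀ y).isPreconnected
    refine hconn.intermediate_value (right_mem_segment ℝ y₀ y) (left_mem_segment ℝ y₀ y)
      (Metric.continuous_infDist_pt D).continuousOn ⟨?_, hρ1⟩
    rw [Metric.infDist_zero_of_mem hyD]
    exact hρ0.le
  obtain ⟨x₀, hx₀D, hx₀z⟩ := hDc.exists_infDist_eq_dist hDne z
  rw [hzρ, dist_comm, dist_eq_norm] at hx₀z
  have hzT : Metric.closedBall z ρ ⊆ T :=
    (Metric.closedBall_subset_closedBall hρ2).trans (Metric.closedBall_subset_cthickening hz r)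
  have hgood : ∀ x, ‖x - z‖ < ρ → ∀ u, ⟪u, x⟫ = 0 → u ≠ 0 → 0 < hes (Cone a c) H x u u := by
    intro x hx
    refine hDmem x (hzT (mem_closedBall_iff_norm.2 hx.le)) fun hxD => ?_
    have := Metric.infDist_le_dist_of_mem (x := z) hxD
    rw [hzρ, dist_comm, dist_eq_norm] at this
    linarith
  obtain ⟨⟨x₀', v⟩, ⟨⟨hx₀T, hv⟩, hvx, hv0⟩, rfl⟩ := hx₀D
  simp only at hx₀z hx₀T hv hvx hv0
  set z' := (2⁻¹ : ℝ) • (z + x₀') with hz'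
  have hsub : ∀ x ∈ Metric.closedBall z' (ρ / 2), x ≠ x₀' → ‖x - z‖ < ρ := by
    intro x hx hne
    rw [hx₀z]
    refine norm_sub_lt_of_mem_half_ball ?_ hne
    rw [← hx₀z]
    exact mem_closedBall_iff_norm.1 hx
  have hsubT : Metric.closedBall z' (ρ / 2) ⊆ T := by
    intro x hx
    by_cases hne : x = x₀'
    · rw [hne]; exact hx₀T
    · exact hzT (mem_closedBall_iff_norm.2 (hsub x hx hne).le)
  have hv1 : v ≠ 0 := by rintro rfl; simp at hv
  have hneg := hS.thd_neg_of_hopf (z := z') (x₀ := x₀') (R := ρ / 2) (by positivity)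
    (hsubT.trans hTK) (Metric.ball_subset_closedBall.trans (hsubT.trans hT))
    (by rw [hz', norm_sub_half, ← hx₀z]) (fun x hx hne => hgood x (hsub x hx hne)) hv1 hvx hv0
  have hnhds := cone_mem_nhds (hT hx₀T)
  have hline : Tendsto (fun t : ℝ => x₀' + t • (x₀' - z')) (𝓝 0) (𝓝 x₀') := by
    have : ContinuousAt (fun t : ℝ => x₀' + t • (x₀' - z')) 0 := by fun_prop
    simpa using this.tendsto
  -- The form is nonnegative in the fixed direction `v` at all nearby points and vanishes at `x₀'`;
  -- hence its derivative is zero, against the Hopf lemma.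
  have h0 := (hasJet2_hes_line hS.uniqueDiffOn hS.smooth_H hnhds (x₀' - z') v v).of_isLocalMin (by
    filter_upwards [hline.eventually hnhds] with t ht
    simp only [zero_smul, add_zero, hv0]
    exact hS.convex_H _ ht v)
  exact hneg.ne h0.1

end IsSol

end FullRank

end CapillaryRank

namespace CapillaryRank

open Filter Topology

/-! ### Full rank on the lateral boundary -/

section Boundary

variable {E : Type*} [NormedAddCommGroup E] [InnerProductSpace ℝ E]

namespace IsSol

variable {a : E} {c : ℝ} {k l : ℕ} {p : ℝ} {g H : E → ℝ}

/-- The Neumann condition, differentiated twice along a circle in the boundary of the cone. -/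
theorem derivatives_boundary (hS : IsSol a c k l p g H) {x₀ : E} (hx : ‖x₀‖ = 1)
    (hbd : ⟪a, x₀⟫ = c) {τ : E} (hτx : ⟪τ, x₀⟫ = 0) (hτa : ⟪τ, a⟫ = 0)
    (hτ : ‖τ‖ ^ 2 = 1 - c ^ 2) :
    hes (Cone a c) H x₀ τ a = 0 ∧ thd (Cone a c) H x₀ τ τ a = -c * hes (Cone a c) H x₀ a a := by
  have ha := hS.norm_axis
  have haa : ⟪a, a⟫ = 1 := by rw [real_inner_self_eq_norm_sq, ha, one_pow]
  have hxx : ⟪x₀, x₀⟫ = 1 := by rw [real_inner_self_eq_norm_sq, hx, one_pow]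
  have hxa : ⟪x₀, a⟫ = c := by rw [real_inner_comm, hbd]
  have hxτ : ⟪x₀, τ⟫ = 0 := by rw [real_inner_comm, hτx]
  have haτ : ⟪a, τ⟫ = 0 := by rw [real_inner_comm, hτa]
  have hττ : ⟪τ, τ⟫ = 1 - c ^ 2 := by rw [real_inner_self_eq_norm_sq, hτ]
  -- The circle of unit boundary points through `x₀` with velocity `τ`. Its radius is `√(1 - c²)`,
  -- which explains the normalisation of `τ`.
  set γ : ℝ → E := fun t => Real.cos t • (x₀ - c • a) + Real.sin t • τ + c • a with hγ
  set γ' : ℝ → E := fun t => -Real.sin t • (x₀ - c • a) + Real.cos t • τ with hγ'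
  have hd : ∀ t, HasDerivAt γ (γ' t) t := fun t =>
    (((Real.hasDerivAt_cos t).smul_const (x₀ - c • a)).add
      ((Real.hasDerivAt_sin t).smul_const τ)).add_const (c • a)
  have hd' : HasDerivAt γ' (-(x₀ - c • a)) 0 := by
    exact (((Real.hasDerivAt_sin 0).neg.smul_const (x₀ - c • a)).add
      ((Real.hasDerivAt_cos 0).smul_const τ)).congr_deriv (by simp)
  have hγa : ∀ t, ⟪a, γ t⟫ = c := fun t => by
    simp only [hγ, inner_add_right, inner_sub_right, inner_smul_right, haa, haτ, hbd]
    ring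
  have hγn : ∀ t, ‖γ t‖ = 1 := fun t => by
    have h : ‖γ t‖ ^ 2 = 1 := by
      rw [← real_inner_self_eq_norm_sq]
      simp only [hγ, inner_add_right, inner_sub_right, inner_smul_right, inner_add_left,
        inner_sub_left, inner_smul_left, haa, haτ, hbd, hxx, hxa, hxτ, hτx, hτa, hττ, conj_trivial]
      linear_combination (1 - c ^ 2) * Real.sin_sq_add_cos_sq t
    exact (sq_eq_sq₀ (norm_nonneg _) zero_le_one).1 (by rw [h, one_pow])
  have hmem : ∀ t, γ t ∈ Cone a c := fun t =>
    ⟨fun h => by have := hγn t; rw [h, norm_zero] at this; exact zero_ne_one this,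
      by rw [hγn, hγa, mul_one]⟩
  have h0 : γ 0 = x₀ := by simp [hγ]
  have h0' : γ' 0 = τ := by simp [hγ']
  have hcomp : ∀ {F : Type _} [NormedAddCommGroup F] [NormedSpace ℝ F] {G : E → F} {G' : E →L[ℝ] F}
      (t : ℝ), HasFDerivWithinAt G G' (Cone a c) (γ t) →
      HasDerivAt (fun t => G (γ t)) (G' (γ' t)) t := by
    intro F _ _ G G' t hG
    have := hG.comp_hasDerivWithinAt t (hd t).hasDerivWithinAt (s := Set.univ)
      (fun s _ => hmem s)
    rwa [hasDerivWithinAt_univ] at this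
  have h1 : ∀ t, hes (Cone a c) H (γ t) (γ' t) a = 0 := by
    intro t
    have h2 := (hcomp t (hasFDerivWithinAt_fderivWithin hS.uniqueDiffOn hS.smooth_H
      (hmem t))).clm_apply (hasDerivAt_const t a)
    have h3 : (fun t => fderivWithin ℝ H (Cone a c) (γ t) a) = fun _ => 0 := by
      ext s
      exact hS.boundary_H _ (hmem s) (by rw [hγn, hγa, mul_one])
    rw [h3] at h2
    have := h2.unique (hasDerivAt_const t 0)
    simpa using this
  refine ⟨by simpa [h0, h0'] using h1 0, ?_⟩
  have h2 := ((hcomp 0 (hasFDerivWithinAt_hes hS.uniqueDiffOn hS.smooth_H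
      (hmem 0))).clm_apply hd').clm_apply (hasDerivAt_const 0 a)
  simp only [h1] at h2
  -- The acceleration is `-(x₀ - c a)`; its radial part drops out of the Hessian and the rest
  -- contributes `c D²H(a, a)`.
  have h3 := h2.unique (hasDerivAt_const 0 0)
  simp only [h0, h0', map_neg, map_sub, map_smul, _root_.add_apply, _root_.neg_apply,
    _root_.sub_apply, _root_.smul_apply, smul_eq_mul, hS.hes_self' (h0 ▸ hmem 0), map_zero] at h3
  linarith

variable [FiniteDimensional ℝ E] (hS : IsSol a c k l p g H) {x₀ : E} (hx : ‖x₀‖ = 1)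
  (hbd : ⟪a, x₀⟫ = c)
include hS hx hbd

omit [FiniteDimensional ℝ E] hS in
theorem mem_cone_of_boundary : x₀ ∈ Cone a c :=
  ⟨fun h => by rw [h, norm_zero] at hx; exact zero_ne_one hx, by rw [hx, hbd, mul_one]⟩

omit [FiniteDimensional ℝ E] in
-- The vector `c • x₀ - a` is an outward conormal, and its radial part is handled by homogeneity.
-- The facts along a circle are rescaled to an arbitrary length of `τ`.
theorem hes_boundary {τ : E} (hτx : ⟪τ, x₀⟫ = 0) (hτa : ⟪τ, a⟫ = 0) :
    hes (Cone a c) H x₀ τ (c • x₀ - a) = 0 ∧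
    (1 - c ^ 2) * thd (Cone a c) H x₀ (c • x₀ - a) τ τ
      = c * (‖τ‖ ^ 2 * hes (Cone a c) H x₀ (c • x₀ - a) (c • x₀ - a)
        - (1 - c ^ 2) * hes (Cone a c) H x₀ τ τ) := by
  have hxK := mem_cone_of_boundary hx hbd
  rcases eq_or_ne τ 0 with rfl | hτ
  · simp
  have hτn : 0 < ‖τ‖ := norm_pos_iff.2 hτ
  have hs2 : 0 < 1 - c ^ 2 := by nlinarith [hS.c_pos, hS.c_lt]
  set r := √(1 - c ^ 2) / ‖τ‖ with hr
  have hr0 : 0 < r := div_pos (Real.sqrt_pos.2 hs2) hτn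
  have hr2 : r ^ 2 * ‖τ‖ ^ 2 = 1 - c ^ 2 := by
    rw [hr, div_pow, Real.sq_sqrt hs2.le]; field_simp
  obtain ⟨h1, h2⟩ := hS.derivatives_boundary hx hbd (τ := r • τ)
    (by rw [inner_smul_left, hτx, mul_zero]) (by rw [inner_smul_left, hτa, mul_zero])
    (by rw [norm_smul, mul_pow, Real.norm_eq_abs, sq_abs, hr2])
  have hsw : thd (Cone a c) H x₀ (c • x₀ - a) τ τ = thd (Cone a c) H x₀ τ τ (c • x₀ - a) := by
    rw [thd_swap hS.uniqueDiffOn hS.smooth_H hxK hS.subset_closure,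
      thd_symm hS.uniqueDiffOn hS.smooth_H hxK hS.subset_closure]
  rw [hsw]
  simp only [map_smul, _root_.smul_apply, smul_eq_mul] at h1 h2
  have h1' : hes (Cone a c) H x₀ τ a = 0 := (mul_eq_zero.1 h1).resolve_left hr0.ne'
  simp only [map_sub, map_smul, _root_.sub_apply, _root_.smul_apply, smul_eq_mul,
    hS.hes_self hxK, hS.hes_self' hxK, hS.thd_self hxK, h1']
  refine ⟨by ring, ?_⟩
  rw [← hr2]
  linear_combination (-‖τ‖ ^ 2) * h2

omit [FiniteDimensional ℝ E] in
theorem norm_conormal_sq : ‖c • x₀ - a‖ ^ 2 = 1 - c ^ 2 := by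
  rw [norm_sub_sq_real, inner_smul_left, real_inner_comm, hbd, norm_smul, hx, hS.norm_axis,
    Real.norm_of_nonneg hS.c_pos.le]
  simp only [conj_trivial]; ring

/-- At a boundary point, the Hessian cannot degenerate in the conormal direction. -/
theorem thd_conormal_nonneg (h0 : hes (Cone a c) H x₀ (c • x₀ - a) (c • x₀ - a) = 0) :
    0 ≤ thd (Cone a c) H x₀ (c • x₀ - a) (c • x₀ - a) (c • x₀ - a) := by
  by_contra! hneg
  have hxK := mem_cone_of_boundary hx hbd
  have ha := hS.norm_axis
  have hs2 : 0 < 1 - c ^ 2 := by nlinarith [hS.c_pos, hS.c_lt]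
  have hboundary := fun τ => hes_boundary hS hx hbd (τ := τ)
  have hνn := norm_conormal_sq hS hx hbd
  set ν := c • x₀ - a with hν
  set A := hes (Cone a c) H x₀ with hA
  have hAsymm : ∀ u v, A u v = A v u := hS.hes_comm hxK
  have hxx : ⟪x₀, x₀⟫ = 1 := by rw [real_inner_self_eq_norm_sq, hx, one_pow]
  have hνν : ⟪ν, ν⟫ = 1 - c ^ 2 := by rw [real_inner_self_eq_norm_sq, hνn]
  have hνx : ⟪ν, x₀⟫ = 0 := by
    rw [hν, inner_sub_left, inner_smul_left, hxx, hbd]; simp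
  have hxν : ⟪x₀, ν⟫ = 0 := by rw [real_inner_comm, hνx]
  have haν : a = c • x₀ - ν := by rw [hν]; abel
  have hAx : ∀ u, A x₀ u = 0 := fun u => hS.hes_self' hxK u
  -- decomposition of a vector
  have hdec : ∀ u : E, ∃ τ, u = ⟪x₀, u⟫ • x₀ + (⟪ν, u⟫ / (1 - c ^ 2)) • ν + τ ∧ ⟪τ, x₀⟫ = 0 ∧
      ⟪τ, ν⟫ = 0 := by
    intro u
    refine ⟨u - ⟪x₀, u⟫ • x₀ - (⟪ν, u⟫ / (1 - c ^ 2)) • ν, by abel, ?_, ?_⟩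
    · simp only [inner_sub_left, inner_smul_left, hxx, hνx, conj_trivial]
      rw [real_inner_comm]; ring
    · simp only [inner_sub_left, inner_smul_left, hνν, hxν, conj_trivial]
      rw [real_inner_comm]; field_simp; ring
  have hτa : ∀ τ, ⟪τ, x₀⟫ = 0 → ⟪τ, ν⟫ = 0 → ⟪τ, a⟫ = 0 := by
    intro τ h1 h2
    rw [haν, inner_sub_right, inner_smul_right, h1, h2]; simp
  have hAν : ∀ u, A ν u = 0 := by
    intro u
    obtain ⟨τ, hu, h1, h2⟩ := hdec u
    rw [hu, map_add, map_add, map_smul, map_smul, hAsymm ν x₀, hAx, h0, hAsymm,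
      (hboundary τ h1 (hτa τ h1 h2)).1]
    simp
  -- Both `x₀` and `ν` are null for `A`. Subtracting these rank one forms moves them to the
  -- eigenvalues `-1` and `-2` while the others stay nonnegative, so every eigenvector is radial,
  -- conormal, or orthogonal to both.
  let S : E →L[ℝ] E →L[ℝ] ℝ := A
    - (ContinuousLinearMap.smulRightL ℝ E (E →L[ℝ] ℝ) (innerSL ℝ x₀)) (innerSL ℝ x₀)
    - (2 / (1 - c ^ 2)) • (ContinuousLinearMap.smulRightL ℝ E (E →L[ℝ] ℝ) (innerSL ℝ ν)) (innerSL ℝ ν)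
  have hSap : ∀ u v, S u v = A u v - ⟪x₀, u⟫ * ⟪x₀, v⟫ - 2 / (1 - c ^ 2) * (⟪ν, u⟫ * ⟪ν, v⟫) := by
    intro u v
    simp [S]
  obtain ⟨b, y, hb⟩ := exists_eigenbasis (B := S) fun u v => by rw [hSap, hSap, hAsymm u v]; ring
  have hbx : ∀ i, ⟪x₀, b i⟫ ≠ 0 → y i = -1 := by
    intro i hi
    have h1 := hb i x₀
    rw [hSap, hAsymm, hAx, hxx, hνx, real_inner_comm x₀ (b i)] at h1
    have h2 : (y i + 1) * ⟪x₀, b i⟫ = 0 := by linarith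
    linarith [(mul_eq_zero.1 h2).resolve_right hi]
  have hbν : ∀ i, ⟪ν, b i⟫ ≠ 0 → y i = -2 := by
    intro i hi
    have h1 := hb i ν
    rw [hSap, hAsymm, hAν, hxν, hνν, real_inner_comm ν (b i)] at h1
    field_simp at h1
    have h2 : (y i + 2) * ⟪ν, b i⟫ = 0 := by linarith
    linarith [(mul_eq_zero.1 h2).resolve_right hi]
  have hzero : ∀ i τ, ⟪τ, x₀⟫ = 0 → ⟪τ, ν⟫ = 0 → ⟪b i, τ⟫ = ‖τ‖ ^ 2 → A (b i) τ = A τ τ → y i < 0 →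
      τ = 0 := by
    intro i τ h1 h2 h3 h4 h5
    have h6 := hb i τ
    rw [hSap, h3, h4, real_inner_comm τ x₀, real_inner_comm τ ν, h1, h2] at h6
    have h7 := hS.convex_H x₀ hxK τ
    have h8 : ‖τ‖ ^ 2 = 0 := by
      by_contra h
      have h9 : 0 < ‖τ‖ ^ 2 := lt_of_le_of_ne (sq_nonneg _) (Ne.symm h)
      have := mul_neg_of_neg_of_pos h5 h9
      linarith
    exact norm_eq_zero.1 (pow_eq_zero_iff (two_ne_zero)|>.1 h8)
  have hcase : ∀ i, (∃ r : ℝ, b i = r • x₀) ∨ (∃ r : ℝ, r ≠ 0 ∧ b i = r • ν) ∨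
      (⟪b i, x₀⟫ = 0 ∧ ⟪b i, ν⟫ = 0) := by
    intro i
    obtain ⟨τ, hu, h1, h2⟩ := hdec (b i)
    have h1' : ⟪x₀, τ⟫ = 0 := by rw [real_inner_comm, h1]
    have h2' : ⟪ν, τ⟫ = 0 := by rw [real_inner_comm, h2]
    have h3 : ⟪b i, τ⟫ = ‖τ‖ ^ 2 := by
      rw [hu, inner_add_left, inner_add_left, inner_smul_left, inner_smul_left, h1', h2',
        real_inner_self_eq_norm_sq]
      simp
    have h4 : A (b i) τ = A τ τ := by
      rw [hu]
      simp only [map_add, map_smul, _root_.add_apply, _root_.smul_apply, hAx, hAν]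
      simp
    by_cases hi : ⟪x₀, b i⟫ = 0
    · by_cases hi' : ⟪ν, b i⟫ = 0
      · exact Or.inr (Or.inr ⟨by rw [real_inner_comm, hi], by rw [real_inner_comm, hi']⟩)
      · have hτ := hzero i τ h1 h2 h3 h4 (by rw [hbν i hi']; norm_num)
        refine Or.inr (Or.inl ⟨_, div_ne_zero hi' hs2.ne', ?_⟩)
        rwa [hi, hτ, zero_smul, zero_add, add_zero] at hu
    · have hi' : ⟪ν, b i⟫ = 0 := by
        by_contra hi'
        have := hbx i hi
        rw [hbν i hi'] at this
        norm_num at this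
      have hτ := hzero i τ h1 h2 h3 h4 (by rw [hbx i hi]; norm_num)
      exact Or.inl ⟨_, by rwa [hi', hτ, zero_div, zero_smul, add_zero, add_zero] at hu⟩
  set x : Fin (Module.finrank ℝ E) → ℝ := fun i => A (b i) (b i) with hxdef
  have hbA : ∀ i u, A (b i) u = x i * ⟪b i, u⟫ := by
    intro i u
    rcases hcase i with ⟨r, hr⟩ | ⟨r, -, hr⟩ | ⟨h1, h2⟩
    · simp [hxdef, hr, hAx]
    · simp [hxdef, hr, hAν]
    · have h3 : ∀ u, A (b i) u = y i * ⟪b i, u⟫ := by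
        intro u
        rw [← hb, hSap, real_inner_comm, h1, real_inner_comm (b i) ν, h2]; ring
      rw [h3, hxdef]
      simp only
      rw [h3, real_inner_self_eq_norm_sq, b.norm_eq_one]; ring
  have hthd : ∀ i, thd (Cone a c) H x₀ ν (b i) (b i) ≤ -c * x i ∧
      (⟪ν, b i⟫ ≠ 0 → thd (Cone a c) H x₀ ν (b i) (b i) < -c * x i) := by
    intro i
    rcases hcase i with ⟨r, hr⟩ | ⟨r, hr0, hr⟩ | ⟨h1, h2⟩
    · refine ⟨?_, fun h => absurd (by rw [hr, inner_smul_right, hνx, mul_zero]) h⟩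
      simp [hxdef, hr, hAx, hS.thd_self hxK, hS.hes_self' hxK]
    · have h3 : thd (Cone a c) H x₀ ν (b i) (b i) < -c * x i := by
        simp only [hxdef, hr, map_smul, _root_.smul_apply, smul_eq_mul, hAν]
        have := mul_pos_of_neg_of_neg hneg (neg_lt_zero.2 (pow_pos (abs_pos.2 hr0) 2))
        rw [sq_abs] at this
        linarith
      exact ⟨h3.le, fun _ => h3⟩
    · refine ⟨?_, fun h => absurd (by rw [real_inner_comm, h2]) h⟩
      have h3 := (hboundary (b i) h1 (hτa _ h1 h2)).2
      rw [h0] at h3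
      have h4 : (1 - c ^ 2) * (thd (Cone a c) H x₀ ν (b i) (b i) + c * x i) = 0 := by
        rw [hxdef]; linear_combination h3
      linarith [(mul_eq_zero.1 h4).resolve_left hs2.ne']
  have hxpos : ∀ i, 0 ≤ x i := fun i => hS.convex_H x₀ hxK (b i)
  have hdiag : bmat A b = Matrix.diagonal x := bmat_eq_diagonal hbA
  have hk : 0 < es Finset.univ x k := by
    have := hS.admissible x₀ hxK b
    rwa [← hA, hdiag, msym_diagonal] at this
  have hl : 0 < es Finset.univ x l :=
    es_pos_of_le _ hxpos (by omega) (by exact_mod_cast hS.l_lt.le) hk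
  -- the derivative of the equation
  have hmem : ∀ t ∈ Set.Icc (0 : ℝ) 1, x₀ + t • (-ν) ∈ Cone a c := by
    intro t ht
    rcases ht.1.eq_or_lt with h | h
    · rw [← h, zero_smul, add_zero]; exact hxK
    · have e : x₀ + t • (-ν) = (1 - t * c) • x₀ + t • a := by rw [hν]; module
      rw [e]
      have h2 : 0 < 1 - t * c := by nlinarith [ht.2, hS.c_lt, hS.c_pos]
      exact openCone_subset_cone (add_mem_openCone hS.c_pos (smul_mem_cone hxK h2)
        (smul_mem_openCone (axis_mem_openCone ha hS.c_lt) h))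
  have hjet : ∀ j : ℕ, 0 < es Finset.univ x j → HasDerivWithinAt
      (fun t : ℝ => Real.log (msym (bmat (hes (Cone a c) H (x₀ + t • (-ν))) b) j))
      (∑ i, -(thd (Cone a c) H x₀ ν (b i) (b i)) * w1 x j i) (Set.Icc 0 1) 0 := by
    intro j hj
    have h1 := hasDerivWithinAt_ray (hasFDerivWithinAt_hes hS.uniqueDiffOn hS.smooth_H hxK) hmem
    have h2 := hasDerivWithinAt_msym (M := fun t : ℝ => bmat (hes (Cone a c) H (x₀ + t • (-ν))) b)
      (B := bmat (thd (Cone a c) H x₀ (-ν)) b) (x := x) (s := Set.Icc 0 1)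
      (by simpa using hdiag)
      (fun i i' => by
        have h3 := (h1.clm_apply (hasDerivWithinAt_const (0 : ℝ) _ (b i))).clm_apply
          (hasDerivWithinAt_const (0 : ℝ) _ (b i'))
        simpa [bmat] using h3) j
    have h0 : msym (bmat (hes (Cone a c) H (x₀ + (0 : ℝ) • (-ν))) b) j = es Finset.univ x j := by
      rw [zero_smul, add_zero, ← hA, hdiag, msym_diagonal]
    refine (h2.log (by rw [h0]; exact hj.ne')).congr_deriv ?_
    rw [h0, Finset.sum_div]
    refine Finset.sum_congr rfl fun i _ => ?_
    simp only [bmat, w1, Matrix.of_apply, map_neg, _root_.neg_apply]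
    ring
  have hg := hasDerivWithinAt_ray (hasFDerivWithinAt_self hS.smooth_g hxK) hmem
  have hH := hasDerivWithinAt_ray (hasFDerivWithinAt_self hS.smooth_H hxK) hmem
  have hR := ((hg.log (by simpa using (hS.pos_g x₀ hxK).ne')).const_mul (-(p + k - l - 1))).add
    ((hH.log (by simpa using (hS.pos_H x₀ hxK).ne')).const_mul (p - 1))
  have hLR := (uniqueDiffOn_Icc zero_lt_one (0 : ℝ) (by simp)).eq_deriv _
    (((hjet k hk).sub (hjet l hl)).congr (fun t ht => (hS.equation _ (hmem t ht) b).symm)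
      (hS.equation _ (hmem 0 (by simp)) b).symm) hR
  have hbdc : c * ‖x₀‖ = ⟪a, x₀⟫ := by rw [hx, hbd, mul_one]
  have hsmul := fun y (hy : y ∈ Cone a c) t (ht : (0 : ℝ) < t) => smul_mem_cone hy ht
  have hHν : fderivWithin ℝ H (Cone a c) x₀ (-ν) = -(c * H x₀) := by
    rw [hν, map_neg, map_sub, map_smul, hS.boundary_H x₀ hxK hbdc,
      fderivWithin_apply_self hS.smooth_H hsmul hS.hom_H hxK, smul_eq_mul, sub_zero]
  have hgν : -(c * g x₀) ≤ fderivWithin ℝ g (Cone a c) x₀ (-ν) := by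
    rw [hν, map_neg, map_sub, map_smul, fderivWithin_apply_self hS.smooth_g hsmul hS.hom_g hxK,
      smul_eq_mul]
    linarith [hS.boundary_g x₀ hxK hbdc]
  simp only [zero_smul, add_zero, hHν] at hLR
  have hgpos := hS.pos_g x₀ hxK
  have hHpos := hS.pos_H x₀ hxK
  have hgν' : -c ≤ fderivWithin ℝ g (Cone a c) x₀ (-ν) / g x₀ := by
    rw [le_div_iff₀ hgpos]; linarith
  have hHν' : -(c * H x₀) / H x₀ = -c := by field_simp
  have hkl : (l : ℝ) + 1 ≤ k := by exact_mod_cast hS.l_lt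
  have hq : 0 ≤ p + k - l - 1 := by linarith [hS.one_le_p]
  rw [hHν', ← Finset.sum_sub_distrib] at hLR
  -- In the inward direction `-ν`, `log H` has derivative `-c` and `log g` at least `-c`; the
  -- weights `p - 1` and `-(p + k - l - 1)` leave at most `(k - l) c`.
  have hle : ∑ i, (-(thd (Cone a c) H x₀ ν (b i) (b i)) * w1 x k i
      - -(thd (Cone a c) H x₀ ν (b i) (b i)) * w1 x l i) ≤ (k - l) * c := by
    rw [hLR]
    have := mul_le_mul_of_nonneg_left hgν' hq
    linarith
  -- Euler's identity for `log (σ_k / σ_l)` evaluates the weighted sum of `c x i`; ellipticity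
  -- preserves the strict inequality in the conormal direction.
  have hlt : (k - l) * c < ∑ i, (-(thd (Cone a c) H x₀ ν (b i) (b i)) * w1 x k i
      - -(thd (Cone a c) H x₀ ν (b i) (b i)) * w1 x l i) := by
    have h1 : (k - l) * c = ∑ i, (c * x i) * (w1 x k i - w1 x l i) := by
      simp only [mul_sub, Finset.sum_sub_distrib, mul_assoc, ← Finset.mul_sum,
        sum_mul_w1 x hk.ne', sum_mul_w1 x hl.ne']
      ring
    rw [h1]
    have hf := fun i => w1_sub_w1_pos hxpos hS.l_lt hk i
    obtain ⟨i₀, hi₀⟩ : ∃ i, ⟪ν, b i⟫ ≠ 0 := by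
      by_contra! hcon
      have h2 := b.sum_sq_norm_inner_left ν
      simp only [hcon, norm_zero, hνn] at h2
      simp at h2
      linarith
    refine Finset.sum_lt_sum (fun i _ => ?_) ⟨i₀, Finset.mem_univ _, ?_⟩
    · have := mul_le_mul_of_nonneg_right (hthd i).1 (hf i).le
      linarith
    · have := mul_lt_mul_of_pos_right ((hthd i₀).2 hi₀) (hf i₀)
      linarith
  linarith

/-- The constant rank theorem at unit boundary points. -/
theorem hes_pos_of_boundary {u : E} (hux : ⟪u, x₀⟫ = 0) (hu : u ≠ 0) :
    0 < hes (Cone a c) H x₀ u u := by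
  have hxK := mem_cone_of_boundary hx hbd
  refine lt_of_le_of_ne (hS.convex_H x₀ hxK u) fun hdeg => ?_
  have ha := hS.norm_axis
  have hc := hS.c_pos
  have hs2 : 0 < 1 - c ^ 2 := by nlinarith [hS.c_pos, hS.c_lt]
  -- The ball centred at `c⁻¹ • a` through `x₀` lies in the open cone: its inequality combined with
  -- `2‖y‖ ≤ ‖y‖² + 1` gives `c‖y‖ < ⟪a, y⟫`. It is tangent to the boundary at `x₀`, with normal
  -- along the conormal.
  have hexp : ∀ y : E, ‖y - c⁻¹ • a‖ ^ 2 = ‖y‖ ^ 2 - 2 * c⁻¹ * ⟪a, y⟫ + c⁻¹ ^ 2 := by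
    intro y
    rw [norm_sub_sq_real, inner_smul_right, real_inner_comm, norm_smul, ha,
      Real.norm_of_nonneg (inv_pos.2 hc).le]
    ring
  have hR : ‖x₀ - c⁻¹ • a‖ ^ 2 = c⁻¹ ^ 2 - 1 := by
    rw [hexp, hx, hbd]; field_simp; ring
  have hinv : 1 < c⁻¹ := (one_lt_inv₀ hc).2 hS.c_lt
  have hR0 : 0 < ‖x₀ - c⁻¹ • a‖ := by
    refine norm_pos_iff.2 fun h => ?_
    rw [h, norm_zero] at hR
    nlinarith
  have hopen : ∀ y, ‖y - c⁻¹ • a‖ < ‖x₀ - c⁻¹ • a‖ → y ∈ OpenCone a c := by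
    intro y hy
    have h1 : ‖y - c⁻¹ • a‖ ^ 2 < ‖x₀ - c⁻¹ • a‖ ^ 2 := by gcongr
    rw [hR, hexp] at h1
    have h2 : 2 * ‖y‖ < 2 * (c⁻¹ * ⟪a, y⟫) := by nlinarith [sq_nonneg (‖y‖ - 1)]
    have h3 := mul_lt_mul_of_pos_left h2 hc
    show c * ‖y‖ < ⟪a, y⟫
    have h4 : c * (2 * (c⁻¹ * ⟪a, y⟫)) = 2 * ⟪a, y⟫ := by field_simp
    linarith
  set z := (2⁻¹ : ℝ) • (c⁻¹ • a + x₀) with hz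
  have hsub : ∀ y ∈ Metric.closedBall z (‖x₀ - c⁻¹ • a‖ / 2), y ≠ x₀ → y ∈ OpenCone a c :=
    fun y hy hne => hopen y
      (norm_sub_lt_of_mem_half_ball (mem_closedBall_iff_norm.1 hy) hne)
  have hν : c • x₀ - a = (2 * c) • (x₀ - z) := by
    rw [hz]
    have : a = c • c⁻¹ • a := by rw [smul_smul, mul_inv_cancel₀ hc.ne', one_smul]
    nth_rw 1 [this]
    module
  have hneg : ∀ v : E, v ≠ 0 → ⟪v, x₀⟫ = 0 → hes (Cone a c) H x₀ v v = 0 →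
      thd (Cone a c) H x₀ (c • x₀ - a) v v < 0 := by
    intro v hv hvx hv0
    have h := hS.thd_neg_of_hopf (z := z) (x₀ := x₀) (R := ‖x₀ - c⁻¹ • a‖ / 2) (by positivity)
      (fun y hy => by
        by_cases hne : y = x₀
        · rw [hne]; exact hxK
        · exact openCone_subset_cone (hsub y hy hne))
      (fun y hy => hsub y (Metric.ball_subset_closedBall hy) (by
        rintro rfl
        rw [mem_ball_iff_norm, hz, norm_sub_half] at hy
        exact lt_irrefl _ hy))
      (by rw [hz, norm_sub_half])
      (fun y hy hne u huy hu => hS.hes_pos_of_mem_openCone (hsub y hy hne) huy hu) hv hvx hv0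
    rw [hν, map_smul]
    simp only [_root_.smul_apply, smul_eq_mul]
    exact mul_neg_of_pos_of_neg (by positivity) h
  have hboundary := fun τ => hes_boundary hS hx hbd (τ := τ)
  have hνn := norm_conormal_sq hS hx hbd
  have hthd := thd_conormal_nonneg hS hx hbd
  have hνx : ⟪c • x₀ - a, x₀⟫ = 0 := by
    rw [inner_sub_left, inner_smul_left, real_inner_self_eq_norm_sq, hx, hbd]; simp
  set ν := c • x₀ - a with hνdef
  set r := ⟪u, ν⟫ / (1 - c ^ 2) with hr
  set τ := u - r • ν with hτ
  have hτx : ⟪τ, x₀⟫ = 0 := by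
    rw [hτ, inner_sub_left, inner_smul_left, hux, hνx]; simp
  have hτν : ⟪τ, ν⟫ = 0 := by
    rw [hτ, inner_sub_left, inner_smul_left, real_inner_self_eq_norm_sq, hνn, hr]
    simp only [conj_trivial]; field_simp; ring
  have hτa : ⟪τ, a⟫ = 0 := by
    have : a = c • x₀ - ν := by rw [hνdef]; abel
    rw [this, inner_sub_right, inner_smul_right, hτx, hτν]; simp
  obtain ⟨h1, h2⟩ := hboundary τ hτx hτa
  have hu' : u = r • ν + τ := by rw [hτ]; abel
  -- There is no cross term between `ν` and `τ`, so a null vector has null components: a nonzero `τ`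
  -- contradicts `hes_boundary`, and otherwise `ν` contradicts `thd_conormal_nonneg`.
  have hA : hes (Cone a c) H x₀ u u = r ^ 2 * hes (Cone a c) H x₀ ν ν + hes (Cone a c) H x₀ τ τ := by
    rw [hu']
    simp only [map_add, map_smul, _root_.add_apply, _root_.smul_apply, smul_eq_mul,
      hS.hes_comm hxK ν τ, h1]
    ring
  have hνν := hS.convex_H x₀ hxK ν
  have hττ := hS.convex_H x₀ hxK τ
  have hrν := mul_nonneg (sq_nonneg r) hνν
  by_cases hτ0 : τ = 0
  · have hr0 : r ≠ 0 := by
      intro h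
      rw [hτ0, h] at hu'
      exact hu (by simpa using hu')
    have h3 : hes (Cone a c) H x₀ ν ν = 0 := by
      have h4 : r ^ 2 * hes (Cone a c) H x₀ ν ν = 0 := by linarith
      exact (mul_eq_zero.1 h4).resolve_left (pow_ne_zero 2 hr0)
    have hν0 : ν ≠ 0 := by
      intro h
      rw [h, norm_zero] at hνn
      norm_num at hνn
      linarith
    exact absurd (hneg ν hν0 hνx h3) (not_lt.2 (hthd h3))
  · have h3 : hes (Cone a c) H x₀ τ τ = 0 := by linarith
    have h4 := hneg τ hτ0 hτx h3
    rw [h3] at h2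
    have h5 := mul_neg_of_pos_of_neg hs2 h4
    have h6 : 0 ≤ c * (‖τ‖ ^ 2 * hes (Cone a c) H x₀ ν ν - (1 - c ^ 2) * 0) := by
      rw [mul_zero, sub_zero]; positivity
    linarith

omit hx hbd in
/-- The Hessian of a solution is nondegenerate in all directions orthogonal to the radial one. -/
theorem hes_pos {y : E} (hy : y ∈ Cone a c) {u : E} (huy : ⟪u, y⟫ = 0) (hu : u ≠ 0) :
    0 < hes (Cone a c) H y u u := by
  rcases hy.2.lt_or_eq with h | h
  · exact hS.hes_pos_of_mem_openCone h huy hu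
  · have hyn : 0 < ‖y‖ := norm_pos_iff.2 hy.1
    have h2 := hes_pos_of_boundary hS (x₀ := ‖y‖⁻¹ • y) (by simp [norm_smul, hyn.ne'])
      (by rw [inner_smul_right, ← h]; field_simp) (u := u)
      (by rw [inner_smul_right, huy, mul_zero]) hu
    rw [hes_smul hS.smooth_H (fun _ hy _ ht => smul_mem_cone hy ht) hS.hom_H hS.uniqueDiffOn hy
      (inv_pos.2 hyn), inv_inv] at h2
    exact pos_of_mul_pos_right h2 hyn.le

end IsSol

end Boundary

end CapillaryRank

namespace CapillaryRank

open Filter Topology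

/-! ### Comparing symmetric functions on the ambient and tangent spaces -/

section Translation

theorem es_eq_sum {ι : Type*} (s : Finset ι) (x : ι → ℝ) (k : ℕ) :
    es s x k = ∑ t ∈ s.powersetCard k, ∏ a ∈ t, x a := by
  rw [es_natCast, Finset.prod_one_add, Polynomial.finsetSum_coeff,
    ← Finset.sum_filter_add_sum_filter_not s.powerset fun t => t.card = k]
  have h : ∀ t : Finset ι, (∏ a ∈ t, (Polynomial.C (x a) * Polynomial.X)).coeff k
      = if t.card = k then ∏ a ∈ t, x a else 0 := by
    intro t
    rw [Finset.prod_mul_distrib, Finset.prod_const, ← map_prod, Polynomial.coeff_C_mul_X_pow]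
    simp [eq_comm]
  simp only [h]
  rw [Finset.powersetCard_eq_filter, Finset.sum_congr rfl fun t ht => if_pos (Finset.mem_filter.1 ht).2,
    Finset.sum_eq_zero fun t ht => if_neg (Finset.mem_filter.1 ht).2, add_zero]

theorem es_const_mul {ι : Type*} (s : Finset ι) (r : ℝ) (x : ι → ℝ) (k : ℕ) :
    es s (fun a => r * x a) k = r ^ k * es s x k := by
  rw [es_eq_sum, es_eq_sum, Finset.mul_sum]
  refine Finset.sum_congr rfl fun t ht => ?_
  rw [Finset.prod_mul_distrib, Finset.prod_const, (Finset.mem_powersetCard.1 ht).2]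

theorem es_sumElim_zero {ι κ : Type*} [Fintype ι] [Fintype κ] (x : κ → ℝ) (k : ℕ) :
    es Finset.univ (Sum.elim (fun _ : ι => (0 : ℝ)) x) k = es Finset.univ x k := by
  rw [es_natCast, es_natCast, Fintype.prod_sum_type]
  simp

variable {E : Type*} [NormedAddCommGroup E] [InnerProductSpace ℝ E]

theorem msym_bmat_of_scaled {ι : Type*} [Fintype ι] [DecidableEq ι] {B B' : E →L[ℝ] E →L[ℝ] ℝ} {r : ℝ}
    (hB : ∀ u v, B u v = B v u) (h : ∀ u v, B' u v = r * B u v) (b : OrthonormalBasis ι ℝ E)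
    (k : ℕ) : msym (bmat B' b) k = r ^ k * msym (bmat B b) k := by
  have := b.toBasis.finiteDimensional_of_finite
  obtain ⟨b', x, hb'⟩ := exists_eigenbasis hB
  rw [msym_bmat_eq b b', msym_bmat_eq b b', bmat_eq_diagonal hb',
    bmat_eq_diagonal (x := fun i => r * x i) (fun i u => by rw [h, hb', mul_assoc]),
    msym_diagonal, msym_diagonal, es_const_mul]

/-- The elementary symmetric functions of the eigenvalues of an operator on a hyperplane, in terms
of the extension of the quadratic form by zero. -/
theorem msym_bmat_eq_sigma [FiniteDimensional ℝ E] {ι : Type*} [Fintype ι] [DecidableEq ι]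
    {B : E →L[ℝ] E →L[ℝ] ℝ} {y : E} (hB : ∀ u v, B u v = B v u) (hy : ∀ u, B y u = 0)
    {T : (ℝ ∙ y)ᗮ →ₗ[ℝ] (ℝ ∙ y)ᗮ} (hT : ∀ v w, ⟪T v, w⟫ = B v w) (b : OrthonormalBasis ι ℝ E)
    (k : ℕ) : msym (bmat B b) k = Capillary.sigma k T := by
  have hsymm : T.IsSymmetric := fun v w => by
    rw [hT, real_inner_comm, hT, hB]
  let e₁ := stdOrthonormalBasis ℝ (ℝ ∙ y)
  let e₂ := hsymm.eigenvectorBasis rfl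
  let x := hsymm.eigenvalues rfl
  -- An orthonormal basis of the span of `y` joined to an eigenbasis on its complement; the former
  -- only adds zero eigenvalues.
  let b' := (e₁.prod e₂).map (ℝ ∙ y).orthogonalDecomposition.symm
  have h1 : ∀ i, b' (Sum.inl i) = (e₁ i : E) := by
    intro i
    simp [b', Submodule.orthogonalDecomposition_symm_apply]
  have h2 : ∀ i, b' (Sum.inr i) = (e₂ i : E) := by
    intro i
    simp [b', Submodule.orthogonalDecomposition_symm_apply]
  have hx : ∀ i u, B (b' i) u = Sum.elim (fun _ => (0 : ℝ)) x i * ⟪b' i, u⟫ := by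
    rintro (i | i) u
    · obtain ⟨r, hr⟩ := Submodule.mem_span_singleton.1 (e₁ i).2
      rw [h1, ← hr, map_smul, _root_.smul_apply, hy]
      simp
    · rw [h2, Sum.elim_inr]
      obtain ⟨r, w, rfl⟩ : ∃ (r : ℝ) (w : (ℝ ∙ y)ᗮ), u = r • y + w := by
        obtain ⟨r, hr⟩ := Submodule.mem_span_singleton.1 ((ℝ ∙ y).starProjection_apply_mem u)
        refine ⟨r, (ℝ ∙ y)ᗮ.orthogonalProjectionOnto u, ?_⟩
        rw [hr, ← Submodule.starProjection_apply, Submodule.starProjection_orthogonal]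
        simp
      rw [map_add, map_smul, hB _ y, hy, smul_zero, zero_add, inner_add_right,
        inner_smul_right, Submodule.mem_orthogonal_singleton_iff_inner_left.1 (e₂ i).2, mul_zero,
        zero_add, ← hT, hsymm.apply_eigenvectorBasis, inner_smul_left]
      rfl
  rw [msym_bmat_eq b b', bmat_eq_diagonal hx, msym_diagonal, es_sumElim_zero, es_eq_sum,
    Capillary.sigma, hsymm.roots_charpoly_eq_eigenvalues rfl, Finset.esymm_map_val]
  rfl

end Translation

end CapillaryRank

namespace CapillaryRank

open Filter Topology

/-! ### Product with the norm: from the degree zero to the degree one extension -/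

section Norm

variable {E : Type*} [NormedAddCommGroup E] [InnerProductSpace ℝ E]

theorem hasFDerivAt_norm_of_ne_zero {y : E} (hy : y ≠ 0) :
    HasFDerivAt (fun z : E => ‖z‖) (‖y‖⁻¹ • innerSL ℝ y) y := by
  have h1 := (hasStrictFDerivAt_norm_sq y).hasFDerivAt.sqrt
    (pow_ne_zero 2 (norm_ne_zero_iff.2 hy))
  have h2 : (fun z : E => √(‖z‖ ^ 2)) = fun z => ‖z‖ := by
    ext z; exact Real.sqrt_sq (norm_nonneg z)
  rw [h2, Real.sqrt_sq (norm_nonneg y)] at h1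
  refine h1.congr_fderiv ?_
  ext w
  simp
  ring

section

variable {K : Set E} {F : E → ℝ} (hK : UniqueDiffOn ℝ K) (hK0 : (0 : E) ∉ K)
  (hF : ContDiffOn ℝ 4 F K) {y : E} (hy : y ∈ K)
include hK hK0 hF hy

theorem fderivWithin_norm_mul (w : E) : fderivWithin ℝ (fun z => ‖z‖ * F z) K y w
    = ‖y‖ * fderivWithin ℝ F K y w + F y * (‖y‖⁻¹ * ⟪y, w⟫) := by
  have hy0 : y ≠ 0 := fun h => hK0 (h ▸ hy)
  have h := (hasFDerivAt_norm_of_ne_zero hy0).hasFDerivWithinAt.mul (hasFDerivWithinAt_self hF hy)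
  have h' := h.fderivWithin (hK y hy)
  have h2 := DFunLike.congr_fun h' w
  refine h2.trans ?_
  simp

/-- At a unit point the norm has Hessian equal to the metric on tangent vectors, and its first
derivative vanishes there. This is the origin of the term `u σ` in `W[u]`. -/
theorem hes_norm_mul (hy1 : ‖y‖ = 1) {v w : E} (hv : ⟪y, v⟫ = 0) (hw : ⟪y, w⟫ = 0)
    (hNF : ContDiffOn ℝ 4 (fun z => ‖z‖ * F z) K) :
    hes K (fun z => ‖z‖ * F z) y v w = hes K F y v w + F y * ⟪v, w⟫ := by
  have hy0 : y ≠ 0 := fun h => hK0 (h ▸ hy)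
  have h1 := (hasFDerivWithinAt_fderivWithin hK hNF hy).clm_apply (hasFDerivWithinAt_const w y K)
  have hN := (hasFDerivAt_norm_of_ne_zero hy0).hasFDerivWithinAt (s := K)
  have hN' : HasFDerivWithinAt (fun z : E => ‖z‖⁻¹) (-(‖y‖ ^ 2)⁻¹ • (‖y‖⁻¹ • innerSL ℝ y)) K y :=
    (hasDerivAt_inv (norm_ne_zero_iff.2 hy0)).comp_hasFDerivWithinAt y hN
  have hin : HasFDerivWithinAt (fun z : E => ⟪z, w⟫) (innerSL ℝ w) K y := by
    have h := (innerSL ℝ w).hasFDerivWithinAt (s := K) (x := y)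
    refine h.congr (fun z _ => ?_) ?_ <;> simp [real_inner_comm]
  have h2 := (hN.mul ((hasFDerivWithinAt_fderivWithin hK hF hy).clm_apply
    (hasFDerivWithinAt_const w y K))).add
    ((hasFDerivWithinAt_self hF hy).mul (hN'.mul hin))
  have h3 := (hK y hy).eq (h1.congr
    (fun z hz => (fderivWithin_norm_mul hK hK0 hF hz w).symm)
    (fderivWithin_norm_mul hK hK0 hF hy w).symm) h2
  have h4 := DFunLike.congr_fun h3 v
  simp [hy1, hv, hw, real_inner_comm] at h4
  rw [h4]

end

/-- The Riesz representation as a real continuous linear map. -/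
def riesz (E : Type*) [NormedAddCommGroup E] [InnerProductSpace ℝ E] [CompleteSpace E] :
    (E →L[ℝ] ℝ) →L[ℝ] E :=
  LinearMap.mkContinuous
    { toFun := (InnerProductSpace.toDual ℝ E).symm
      map_add' := fun u v => by simp
      map_smul' := fun r u => by simp } 1 fun u => by simp

theorem inner_riesz [CompleteSpace E] (φ : E →L[ℝ] ℝ) (v : E) : ⟪riesz E φ, v⟫ = φ v :=
  InnerProductSpace.toDual_symm_apply

end Norm

/-! ### The cap and its cone in coordinates centred at the vertex -/

open Capillary
open scoped Pointwise

variable {n : ℕ} {θ : ℝ}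

/-- The axis of the cone over the cap. -/
def axis (n : ℕ) : Amb n := EuclideanSpace.single (Fin.last n) 1

theorem norm_axis : ‖axis n‖ = 1 := by simp [axis]

theorem inner_axis (y : Amb n) : ⟪axis n, y⟫ = y (Fin.last n) := by
  simp [axis, EuclideanSpace.inner_single_left]

theorem center_eq : center n θ = -(Real.cos θ • axis n) := by
  rw [center, e, smul_neg]; rfl

theorem inner_axis_center : ⟪axis n, center n θ⟫ = -Real.cos θ := by
  rw [center_eq, inner_neg_right, inner_smul_right, real_inner_self_eq_norm_sq, norm_axis]; simp

/-- Recentring at the vertex turns the cap into the part of the unit sphere within angle `θ` of the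
axis, so the opening constant is `cos θ`. -/
theorem mem_cap_iff {ξ : Amb n} :
    ξ ∈ cap n θ ↔ Real.cos θ ≤ ⟪axis n, ξ - center n θ⟫ ∧ ‖ξ - center n θ‖ = 1 := by
  rw [inner_sub_right, inner_axis_center, inner_axis, cap, Set.mem_ofPred_eq]
  refine and_congr_left fun _ => ?_
  constructor <;> intro h <;> linarith

theorem radialProj_center_add (y : Amb n) :
    radialProj θ (center n θ + y) = center n θ + ‖y‖⁻¹ • y := by
  rw [radialProj, add_sub_cancel_left]

theorem radialProj_mem_cap {y : Amb n} (hy : y ∈ Cone (axis n) (Real.cos θ)) :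
    center n θ + ‖y‖⁻¹ • y ∈ cap n θ := by
  have hyn : 0 < ‖y‖ := norm_pos_iff.2 hy.1
  rw [mem_cap_iff, add_sub_cancel_left, norm_smul, inner_smul_right, norm_inv, norm_norm]
  refine ⟨?_, inv_mul_cancel₀ hyn.ne'⟩
  rw [inv_mul_eq_div, le_div_iff₀ hyn]
  exact hy.2

theorem center_add_mem_cone_iff {y : Amb n} :
    center n θ + y ∈ cone n θ ↔ y ∈ Cone (axis n) (Real.cos θ) := by
  rw [cone, Set.mem_ofPred_eq, radialProj_center_add]
  refine ⟨fun h => ?_, radialProj_mem_cap⟩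
  rw [mem_cap_iff, add_sub_cancel_left, norm_smul, inner_smul_right, norm_inv, norm_norm] at h
  have hyn : 0 < ‖y‖ := by
    refine norm_pos_iff.2 fun h0 => ?_
    have := h.2
    rw [h0, norm_zero, mul_zero] at this
    exact zero_ne_one this
  refine ⟨norm_pos_iff.1 hyn, ?_⟩
  have := h.1
  rwa [inv_mul_eq_div, le_div_iff₀ hyn] at this

theorem cone_eq_vadd : cone n θ = center n θ +ᵥ Cone (axis n) (Real.cos θ) := by
  ext x
  rw [Set.mem_vadd_set_iff_neg_vadd_mem, vadd_eq_add, ← center_add_mem_cone_iff,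
    add_neg_cancel_left]

theorem sub_center_mem_cone {ξ : Amb n} (hξ : ξ ∈ cap n θ) :
    ξ - center n θ ∈ Cone (axis n) (Real.cos θ) := by
  rw [mem_cap_iff] at hξ
  refine ⟨fun h => ?_, by rw [hξ.2, mul_one]; exact hξ.1⟩
  have := hξ.2
  rw [h, norm_zero] at this
  exact zero_ne_one this

/-- The radially constant extension, in coordinates centred at the vertex of the cone. -/
def radExt (θ : ℝ) (u : Amb n → ℝ) (y : Amb n) : ℝ := u (center n θ + ‖y‖⁻¹ • y)

/-- The extension that is homogeneous of degree one, in coordinates centred at the vertex of the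
cone. -/
def homExt (θ : ℝ) (u : Amb n → ℝ) (y : Amb n) : ℝ := ‖y‖ * radExt θ u y

theorem radExt_eq (u : Amb n → ℝ) : radExt θ u = fun y => ext θ u (center n θ + y) := by
  ext y
  rw [ext, radialProj_center_add, radExt]

theorem radExt_sub_center (u : Amb n → ℝ) {ξ : Amb n} (hξ : ξ ∈ cap n θ) :
    radExt θ u (ξ - center n θ) = u ξ := by
  rw [radExt, (mem_cap_iff.1 hξ).2]; simp

theorem radExt_smul (u : Amb n → ℝ) (y : Amb n) {t : ℝ} (ht : 0 < t) :
    radExt θ u (t • y) = radExt θ u y := by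
  rw [radExt, radExt, norm_smul, Real.norm_of_nonneg ht.le, smul_smul, mul_inv_rev, mul_assoc,
    inv_mul_cancel₀ ht.ne', mul_one]

theorem homExt_smul (u : Amb n → ℝ) (y : Amb n) {t : ℝ} (ht : 0 < t) :
    homExt θ u (t • y) = t * homExt θ u y := by
  rw [homExt, homExt, radExt_smul u y ht, norm_smul, Real.norm_of_nonneg ht.le, mul_assoc]

theorem zero_notMem_cone {E : Type*} [NormedAddCommGroup E] [InnerProductSpace ℝ E] {a : E} {c : ℝ} :
    (0 : E) ∉ Cone a c := fun h => h.1 rfl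

theorem contDiffOn_radExt {u : Amb n → ℝ} {m : WithTop ℕ∞} (hu : ContDiffOn ℝ m u (cap n θ)) :
    ContDiffOn ℝ m (radExt θ u) (Cone (axis n) (Real.cos θ)) := by
  refine hu.comp (t := cap n θ) (f := fun y => center n θ + ‖y‖⁻¹ • y) ?_ fun y hy => radialProj_mem_cap hy
  have h1 : ContDiffOn ℝ m (fun y : Amb n => ‖y‖) (Cone (axis n) (Real.cos θ)) :=
    contDiffOn_id.norm ℝ fun y hy => hy.1
  exact contDiffOn_const.add ((h1.inv fun y hy => norm_ne_zero_iff.2 hy.1).smul contDiffOn_id)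

theorem contDiffOn_homExt {u : Amb n → ℝ} {m : WithTop ℕ∞} (hu : ContDiffOn ℝ m u (cap n θ)) :
    ContDiffOn ℝ m (homExt θ u) (Cone (axis n) (Real.cos θ)) :=
  (contDiffOn_id.norm ℝ fun _ hy => hy.1).mul (contDiffOn_radExt hu)

theorem grad_center_add (u : Amb n → ℝ) (y : Amb n) : grad θ u (center n θ + y)
    = riesz (Amb n) (fderivWithin ℝ (radExt θ u) (Cone (axis n) (Real.cos θ)) y) := by
  rw [grad, gradientWithin, cone_eq_vadd, ← fderivWithin_comp_add_left, ← radExt_eq]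
  rfl

theorem dirDeriv_eq (u : Amb n → ℝ) (ξ v : Amb n) : dirDeriv θ u ξ v
    = fderivWithin ℝ (radExt θ u) (Cone (axis n) (Real.cos θ)) (ξ - center n θ) v := by
  rw [dirDeriv]
  conv_lhs => rw [← add_sub_cancel (center n θ) ξ]
  rw [grad_center_add, inner_riesz]

section Angle

variable (hθ : θ ∈ Set.Ioo 0 (Real.pi / 2))
include hθ

theorem cos_pos_of_mem : 0 < Real.cos θ :=
  Real.cos_pos_of_mem_Ioo ⟨by linarith [hθ.1, Real.pi_pos], hθ.2⟩

theorem sin_pos_of_mem : 0 < Real.sin θ :=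
  Real.sin_pos_of_pos_of_lt_pi hθ.1 (by linarith [hθ.2, Real.pi_pos])

theorem cos_lt_one_of_mem : Real.cos θ < 1 := by
  have h1 := sin_pos_of_mem hθ
  have h2 := cos_pos_of_mem hθ
  nlinarith [Real.sin_sq_add_cos_sq θ]

theorem uniqueDiffOn_axis : UniqueDiffOn ℝ (Cone (axis n) (Real.cos θ)) :=
  uniqueDiffOn_cone norm_axis (cos_pos_of_mem hθ) (cos_lt_one_of_mem hθ)

theorem cone_subset_closure_interior :
    Cone (axis n) (Real.cos θ) ⊆ closure (interior (Cone (axis n) (Real.cos θ))) :=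
  (cone_subset_closure norm_axis (cos_pos_of_mem hθ) (cos_lt_one_of_mem hθ)).trans
    (closure_mono openCone_subset_interior)

/-- The form `W[u]` is the Hessian of the extension of degree one. -/
theorem inner_W {u : Amb n → ℝ} (hu : ContDiffOn ℝ 4 u (cap n θ)) {ξ : Amb n} (hξ : ξ ∈ cap n θ)
    (v w : tangent θ ξ) : ⟪W θ u ξ v, w⟫
      = hes (Cone (axis n) (Real.cos θ)) (homExt θ u) (ξ - center n θ) v w := by
  have hK := uniqueDiffOn_axis (n := n) hθ
  have hyK := sub_center_mem_cone hξ
  have hF := contDiffOn_radExt hu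
  have hperp : ∀ v : tangent θ ξ, ⟪ξ - center n θ, (v : Amb n)⟫ = 0 := fun v =>
    Submodule.mem_orthogonal_singleton_iff_inner_right.1 v.2
  have h1 := hes_norm_mul hK zero_notMem_cone hF hyK (mem_cap_iff.1 hξ).2 (hperp v) (hperp w)
    (contDiffOn_homExt hu)
  refine Eq.trans ?_ h1.symm
  have h2 : fderivWithin ℝ (grad θ u) (cone n θ) ξ = (riesz (Amb n)).comp
      (hes (Cone (axis n) (Real.cos θ)) (radExt θ u) (ξ - center n θ)) := by
    have h3 : fderivWithin ℝ (grad θ u) (cone n θ) (center n θ + (ξ - center n θ))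
        = (riesz (Amb n)).comp
      (hes (Cone (axis n) (Real.cos θ)) (radExt θ u) (ξ - center n θ)) := by
      rw [cone_eq_vadd, ← fderivWithin_comp_add_left]
      simp only [grad_center_add]
      exact ((riesz (Amb n)).hasFDerivAt.comp_hasFDerivWithinAt (ξ - center n θ)
        (hasFDerivWithinAt_fderivWithin hK hF hyK)).fderivWithin (hK _ hyK)
    rwa [add_sub_cancel] at h3
  rw [radExt_sub_center u hξ, W, LinearMap.add_apply, inner_add_left]
  congr 1
  · rw [← inner_riesz, hess, h2]
    exact (tangent θ ξ).inner_orthogonalProjectionOnto_eq_of_mem_right w _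
  · simp [inner_smul_left]

theorem hes_homExt_comm {u : Amb n → ℝ} (hu : ContDiffOn ℝ 4 u (cap n θ)) {y : Amb n}
    (hy : y ∈ Cone (axis n) (Real.cos θ)) (v w : Amb n) :
    hes (Cone (axis n) (Real.cos θ)) (homExt θ u) y v w
      = hes (Cone (axis n) (Real.cos θ)) (homExt θ u) y w v :=
  hes_symm (uniqueDiffOn_axis hθ) (contDiffOn_homExt hu) hy (cone_subset_closure_interior hθ) v w

theorem hes_homExt_self {u : Amb n → ℝ} (hu : ContDiffOn ℝ 4 u (cap n θ)) {y : Amb n}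
    (hy : y ∈ Cone (axis n) (Real.cos θ)) (v : Amb n) :
    hes (Cone (axis n) (Real.cos θ)) (homExt θ u) y v y = 0 :=
  hes_apply_self (contDiffOn_homExt hu) (fun _ hy _ ht => smul_mem_cone hy ht)
    (fun y _ _ ht => homExt_smul u y ht) (uniqueDiffOn_axis hθ) hy v

theorem hes_homExt_smul {u : Amb n → ℝ} (hu : ContDiffOn ℝ 4 u (cap n θ)) {y : Amb n}
    (hy : y ∈ Cone (axis n) (Real.cos θ)) {t : ℝ} (ht : 0 < t) (v w : Amb n) :
    hes (Cone (axis n) (Real.cos θ)) (homExt θ u) (t • y) v w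
      = t⁻¹ * hes (Cone (axis n) (Real.cos θ)) (homExt θ u) y v w :=
  hes_smul (contDiffOn_homExt hu) (fun _ hy _ ht => smul_mem_cone hy ht)
    (fun y _ _ ht => homExt_smul u y ht) (uniqueDiffOn_axis hθ) hy ht v w

/-- The Hessian is homogeneous of degree `-1` and its null radial direction does not affect the
symmetric functions. -/
theorem msym_homExt {u : Amb n → ℝ} (hu : ContDiffOn ℝ 4 u (cap n θ)) {y : Amb n}
    (hy : y ∈ Cone (axis n) (Real.cos θ)) {ι : Type*} [Fintype ι] [DecidableEq ι]
    (b : OrthonormalBasis ι ℝ (Amb n)) (j : ℕ) :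
    msym (bmat (hes (Cone (axis n) (Real.cos θ)) (homExt θ u) y) b) j
      = ‖y‖⁻¹ ^ j * sigma j (W θ u (center n θ + ‖y‖⁻¹ • y)) := by
  have hyn : 0 < ‖y‖ := norm_pos_iff.2 hy.1
  have hξ := radialProj_mem_cap hy
  have hy' := sub_center_mem_cone hξ
  have hcomm := hes_homExt_comm hθ hu hy'
  rw [← msym_bmat_eq_sigma hcomm (fun v => by rw [hcomm, hes_homExt_self hθ hu hy'])
    (inner_W hθ hu hξ) b]
  refine msym_bmat_of_scaled hcomm (fun v w => ?_) b j
  rw [add_sub_cancel_left, hes_homExt_smul hθ hu hy (inv_pos.2 hyn), inv_inv, ← mul_assoc,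
    inv_mul_cancel₀ hyn.ne', one_mul]

/-- After rescaling to the cap, the radial component of a vector contributes nothing, so only the
convexity of `u` on tangent vectors matters. -/
theorem hes_homExt_nonneg {u : Amb n → ℝ} (hu : ContDiffOn ℝ 4 u (cap n θ))
    (hconv : IsConvex n θ u) {y : Amb n} (hy : y ∈ Cone (axis n) (Real.cos θ)) (v : Amb n) :
    0 ≤ hes (Cone (axis n) (Real.cos θ)) (homExt θ u) y v v := by
  have hyn : 0 < ‖y‖ := norm_pos_iff.2 hy.1
  have hξ := radialProj_mem_cap hy
  have hy' := sub_center_mem_cone hξ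
  have hcomm := hes_homExt_comm hθ hu hy'
  have h1 : 0 ≤ hes (Cone (axis n) (Real.cos θ)) (homExt θ u)
      (center n θ + ‖y‖⁻¹ • y - center n θ) v v := by
    obtain ⟨r, hr⟩ := Submodule.mem_span_singleton.1 ((ℝ ∙ (center n θ + ‖y‖⁻¹ • y - center n θ)).starProjection_apply_mem v)
    set w := (tangent θ (center n θ + ‖y‖⁻¹ • y)).orthogonalProjectionOnto v with hw
    have hv : v = r • (center n θ + ‖y‖⁻¹ • y - center n θ) + w := by
      rw [hr, hw, ← Submodule.starProjection_apply, Submodule.starProjection_orthogonal]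
      simp
    have h2 := hconv _ hξ w
    rw [inner_W hθ hu hξ] at h2
    have h3 : ∀ v, hes (Cone (axis n) (Real.cos θ)) (homExt θ u)
        (center n θ + ‖y‖⁻¹ • y - center n θ) (center n θ + ‖y‖⁻¹ • y - center n θ) v = 0 :=
      fun v => by rw [hcomm, hes_homExt_self hθ hu hy']
    rw [hv]
    simp only [map_add, map_smul, _root_.add_apply, _root_.smul_apply, h3,
      hes_homExt_self hθ hu hy', smul_zero, zero_add, add_zero]
    exact h2
  rw [add_sub_cancel_left, hes_homExt_smul hθ hu hy (inv_pos.2 hyn), inv_inv] at h1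
  exact nonneg_of_mul_nonneg_right h1 hyn

end Angle

end CapillaryRank

namespace CapillaryRank

open Filter Topology

/-! ### From the capillary problem to `IsSol` -/

section Data

open Capillary

variable {n : ℕ} {θ : ℝ} (hθ : θ ∈ Set.Ioo 0 (Real.pi / 2))
include hθ

theorem fderivWithin_homExt_axis {u : Amb n → ℝ} (hu : ContDiffOn ℝ 4 u (cap n θ)) {y : Amb n}
    (hy : y ∈ Cone (axis n) (Real.cos θ)) :
    fderivWithin ℝ (homExt θ u) (Cone (axis n) (Real.cos θ)) y (axis n)
      = fderivWithin ℝ (homExt θ u) (Cone (axis n) (Real.cos θ)) (‖y‖⁻¹ • y) (axis n) := by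
  rw [fderivWithin_smul (contDiffOn_homExt hu) (fun _ hy _ ht => smul_mem_cone hy ht)
    (fun y _ _ ht => homExt_smul u y ht) (uniqueDiffOn_axis hθ) hy
    (inv_pos.2 (norm_pos_iff.2 hy.1))]

/-- The derivative in the direction of the axis, in terms of the conormal derivative. -/
theorem fderivWithin_homExt_axis_of_boundary {u : Amb n → ℝ} (hu : ContDiffOn ℝ 4 u (cap n θ))
    {y : Amb n} (hy1 : ‖y‖ = 1) (hbd : Real.cos θ = ⟪axis n, y⟫) :
    center n θ + y ∈ capBoundary n θ ∧
    fderivWithin ℝ (homExt θ u) (Cone (axis n) (Real.cos θ)) y (axis n)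
      = Real.sin θ * (Real.cot θ * u (center n θ + y)
        - dirDeriv θ u (center n θ + y) (conormal θ (center n θ + y))) := by
  have hs := sin_pos_of_mem hθ
  have hyK : y ∈ Cone (axis n) (Real.cos θ) :=
    ⟨fun h => by rw [h, norm_zero] at hy1; exact zero_ne_one hy1, by rw [hy1, mul_one, hbd]⟩
  have hcap : center n θ + y ∈ cap n θ := by
    rw [mem_cap_iff, add_sub_cancel_left]; exact ⟨hbd.le, hy1⟩
  refine ⟨⟨hcap, ?_⟩, ?_⟩
  · rw [← inner_axis, inner_add_right, inner_axis_center, ← hbd]; ring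
  have hK := uniqueDiffOn_axis (n := n) hθ
  have hF := contDiffOn_radExt hu
  have h0 : fderivWithin ℝ (radExt θ u) (Cone (axis n) (Real.cos θ)) y y = 0 := by
    have h1 := fderivWithin_norm_mul hK zero_notMem_cone hF hyK y
    have h2 := fderivWithin_apply_self (contDiffOn_homExt hu)
      (fun _ hy _ ht => smul_mem_cone hy ht) (fun y _ _ ht => homExt_smul u y ht) hyK
    have h3 : fderivWithin ℝ (fun z => ‖z‖ * radExt θ u z) (Cone (axis n) (Real.cos θ)) y y
      = ‖y‖ * radExt θ u y := h2
    rw [h3, hy1, real_inner_self_eq_norm_sq, hy1] at h1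
    linarith
  have h1 : fderivWithin ℝ (homExt θ u) (Cone (axis n) (Real.cos θ)) y (axis n)
      = fderivWithin ℝ (radExt θ u) (Cone (axis n) (Real.cos θ)) y (axis n)
        + u (center n θ + y) * Real.cos θ := by
    refine (fderivWithin_norm_mul hK zero_notMem_cone hF hyK (axis n)).trans ?_
    rw [hy1, real_inner_comm, ← hbd, inv_one, one_mul, one_mul, radExt, hy1, inv_one, one_smul]
  -- The conormal and the axis differ by scaling and a radial vector, and the radially constant
  -- extension has no radial derivative. Thus the Robin condition for `u` is exactly the vanishing
  -- of the axial derivative of its degree one extension.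
  have hμ : conormal θ (center n θ + y) = Real.cot θ • y - (Real.sin θ)⁻¹ • axis n := by
    have h4 : Real.cot θ * Real.cos θ + Real.sin θ = (Real.sin θ)⁻¹ := by
      rw [Real.cot_eq_cos_div_sin]
      field_simp
      linarith [Real.sin_sq_add_cos_sq θ]
    rw [conormal, center_eq, show e n = -axis n from rfl, ← h4]
    module
  rw [dirDeriv_eq, add_sub_cancel_left, hμ, map_sub, map_smul, map_smul, h0, h1,
    Real.cot_eq_cos_div_sin]
  simp only [smul_eq_mul]
  field_simp
  ring

theorem dirDeriv_rpow {f : Amb n → ℝ} (hf : ContDiffOn ℝ 4 f (cap n θ))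
    (hpos : ∀ ξ ∈ cap n θ, 0 < f ξ) (r : ℝ) {ξ : Amb n} (hξ : ξ ∈ cap n θ) (v : Amb n) :
    dirDeriv θ (fun ξ => f ξ ^ r) ξ v = r * f ξ ^ (r - 1) * dirDeriv θ f ξ v := by
  have hyK := sub_center_mem_cone hξ
  have h1 := (hasFDerivWithinAt_self (contDiffOn_radExt hf) hyK).rpow_const (p := r)
    (Or.inl (by rw [radExt_sub_center f hξ]; exact (hpos ξ hξ).ne'))
  have h2 := h1.fderivWithin (uniqueDiffOn_axis hθ _ hyK)
  rw [dirDeriv_eq, dirDeriv_eq]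
  refine (DFunLike.congr_fun h2 v).trans ?_
  rw [radExt_sub_center f hξ]
  simp

/-- The homogeneous extensions of the data of the capillary problem. -/
theorem isSol_homExt {k l : ℕ} (hlk : l < k) {p : ℝ} (hp : 1 ≤ p) {f h : Amb n → ℝ}
    (hf : ContDiffOn ℝ 4 f (cap n θ)) (hf_pos : ∀ ξ ∈ cap n θ, 0 < f ξ)
    (hf_convex : IsConvex n θ (fun ξ => f ξ ^ (-(1 / (p + k - l - 1)))))
    (hf_bdry : ∀ ξ ∈ capBoundary n θ,
      0 ≤ dirDeriv θ f ξ (conormal θ ξ) + Real.cot θ * (p + k - l - 1) * f ξ)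
    (hh : ContDiffOn ℝ 4 h (cap n θ)) (hh_pos : ∀ ξ ∈ cap n θ, 0 < h ξ)
    (hh_adm : KConvex n θ k h) (hh_sol : Solves n θ k l p f h) (hh_convex : IsConvex n θ h) :
    IsSol (axis n) (Real.cos θ) k l p (homExt θ (fun ξ => f ξ ^ (-(1 / (p + k - l - 1)))))
      (homExt θ h) := by
  have hkl : (l : ℝ) + 1 ≤ k := by exact_mod_cast hlk
  have hq : 0 < p + k - l - 1 := by linarith
  have hs := sin_pos_of_mem hθ
  have hg : ContDiffOn ℝ 4 (fun ξ => f ξ ^ (-(1 / (p + k - l - 1)))) (cap n θ) :=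
    hf.rpow_const_of_ne fun ξ hξ => (hf_pos ξ hξ).ne'
  have hunit : ∀ y ∈ Cone (axis n) (Real.cos θ), Real.cos θ * ‖y‖ = ⟪axis n, y⟫ →
      ‖‖y‖⁻¹ • y‖ = 1 ∧ Real.cos θ = ⟪axis n, ‖y‖⁻¹ • y⟫ := by
    intro y hy hbd
    have hyn : 0 < ‖y‖ := norm_pos_iff.2 hy.1
    refine ⟨by simp [norm_smul, hyn.ne'], ?_⟩
    rw [inner_smul_right, ← hbd]
    field_simp
  refine
    { norm_axis := norm_axis
      c_pos := cos_pos_of_mem hθ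
      c_lt := cos_lt_one_of_mem hθ
      l_lt := hlk
      one_le_p := hp
      smooth_H := contDiffOn_homExt hh
      smooth_g := contDiffOn_homExt hg
      hom_H := fun y _ _ ht => homExt_smul _ y ht
      hom_g := fun y _ _ ht => homExt_smul _ y ht
      pos_H := fun y hy => mul_pos (norm_pos_iff.2 hy.1) (hh_pos _ (radialProj_mem_cap hy))
      pos_g := fun y hy => mul_pos (norm_pos_iff.2 hy.1)
        (Real.rpow_pos_of_pos (hf_pos _ (radialProj_mem_cap hy)) _)
      convex_H := fun y hy v => hes_homExt_nonneg hθ hh hh_convex hy v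
      convex_g := fun y hy v => hes_homExt_nonneg hθ hg hf_convex hy v
      boundary_H := ?_
      boundary_g := ?_
      admissible := ?_
      equation := ?_ }
  · intro y hy hbd
    obtain ⟨h1, h2⟩ := hunit y hy hbd
    obtain ⟨h3, h4⟩ := fderivWithin_homExt_axis_of_boundary hθ hh h1 h2
    rw [fderivWithin_homExt_axis hθ hh hy, h4, hh_sol.robin _ h3]
    ring
  · intro y hy hbd
    obtain ⟨h1, h2⟩ := hunit y hy hbd
    obtain ⟨h3, h4⟩ := fderivWithin_homExt_axis_of_boundary hθ hg h1 h2
    rw [fderivWithin_homExt_axis hθ hg hy, h4, dirDeriv_rpow hθ hf hf_pos _ h3.1]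
    have h5 := hf_bdry _ h3
    have hfp := hf_pos _ h3.1
    set ξ := center n θ + ‖y‖⁻¹ • y
    have h6 : f ξ ^ (-(1 / (p + k - l - 1))) = f ξ ^ (-(1 / (p + k - l - 1)) - 1) * f ξ := by
      rw [Real.rpow_sub_one hfp.ne']; field_simp
    have h7 : 0 < f ξ ^ (-(1 / (p + k - l - 1)) - 1) := Real.rpow_pos_of_pos hfp _
    rw [h6]
    -- The negative exponent turns the lower bound on the conormal derivative of `f` into the sign
    -- of the axial derivative of `g`; the factor in front is positive.
    have h8 : Real.sin θ * (Real.cot θ * (f ξ ^ (-(1 / (p + k - l - 1)) - 1) * f ξ)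
        - -(1 / (p + k - l - 1)) * f ξ ^ (-(1 / (p + k - l - 1)) - 1)
          * dirDeriv θ f ξ (conormal θ ξ))
        = Real.sin θ * f ξ ^ (-(1 / (p + k - l - 1)) - 1) * (p + k - l - 1)⁻¹
          * (dirDeriv θ f ξ (conormal θ ξ) + Real.cot θ * (p + k - l - 1) * f ξ) := by
      generalize f ξ ^ (-(1 / (p + k - l - 1)) - 1) = r
      field_simp
      ring
    rw [h8]
    positivity
  · intro y hy b
    have hyn : 0 < ‖y‖ := norm_pos_iff.2 hy.1
    rw [msym_homExt hθ hh hy]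
    exact mul_pos (by positivity) (hh_adm _ (radialProj_mem_cap hy) k (by omega) le_rfl)
  · intro y hy b
    have hyn : 0 < ‖y‖ := norm_pos_iff.2 hy.1
    have hξ := radialProj_mem_cap hy
    have h1 := hh_sol.eqn _ hξ
    have hσk := hh_adm _ hξ k (by omega) le_rfl
    have hfp := hf_pos _ hξ
    have hhp := hh_pos _ hξ
    rw [msym_homExt hθ hh hy, msym_homExt hθ hh hy, homExt, homExt, radExt, radExt]
    set ξ := center n θ + ‖y‖⁻¹ • y
    have hrhs : 0 < f ξ * h ξ ^ (p - 1) := mul_pos hfp (Real.rpow_pos_of_pos hhp _)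
    -- Admissibility says nothing about `l = 0`; positivity of the right side of the equation covers
    -- every `l`.
    have hσl : 0 < sigma l (W θ h ξ) := by
      rw [← h1] at hrhs
      exact (div_pos_iff_of_pos_left hσk).1 hrhs
    have h2 := congrArg Real.log h1
    rw [Real.log_div hσk.ne' hσl.ne', Real.log_mul hfp.ne' (Real.rpow_pos_of_pos hhp _).ne',
      Real.log_rpow hhp] at h2
    rw [Real.log_mul (by positivity) hσk.ne', Real.log_mul (by positivity) hσl.ne',
      Real.log_mul hyn.ne' (Real.rpow_pos_of_pos hfp _).ne', Real.log_mul hyn.ne' hhp.ne',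
      Real.log_rpow hfp, Real.log_pow, Real.log_pow, Real.log_inv]
    have h3 : (p + k - l - 1) * (1 / (p + k - l - 1)) = 1 := by field_simp
    -- The powers of `‖y‖` balance because `-k + l = -(p + k - l - 1) + (p - 1)`, so the equation
    -- holds on the whole cone without a weight.
    linear_combination h2 - Real.log (f ξ) * h3

end Data

end CapillaryRank

end

/-! ### The full rank theorem on the cap -/

theorem theorem4p1 (n k l : ℕ) (hlk : l < k) (hkn : k ≤ n - 1)
    (θ : ℝ) (hθ : θ ∈ Set.Ioo 0 (Real.pi / 2)) (p : ℝ) (hp : 1 ≤ p)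
    (f : Capillary.Amb n → ℝ)
    (hf_smooth : ContDiffOn ℝ ∞ f (Capillary.cap n θ))
    (hf_pos : ∀ ξ ∈ Capillary.cap n θ, 0 < f ξ)
    (hf_convex : Capillary.IsConvex n θ (fun ξ => f ξ ^ (-(1 / (p + k - l - 1)))))
    (hf_bdry : ∀ ξ ∈ Capillary.capBoundary n θ,
      0 ≤ Capillary.dirDeriv θ f ξ (Capillary.conormal θ ξ)
        + Real.cot θ * (p + k - l - 1) * f ξ)
    (h : Capillary.Amb n → ℝ)
    (hh_C4 : ContDiffOn ℝ 4 h (Capillary.cap n θ))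
    (hh_pos : ∀ ξ ∈ Capillary.cap n θ, 0 < h ξ)
    (hh_adm : Capillary.KConvex n θ k h)
    (hh_sol : Capillary.Solves n θ k l p f h)
    (hh_convex : Capillary.IsConvex n θ h) :
    Capillary.IsStrictlyConvex n θ h := by
  have hf : ContDiffOn ℝ 4 f (Capillary.cap n θ) := contDiffOn_infty.1 hf_smooth 4
  intro ξ hξ v hv
  have hS := CapillaryRank.isSol_homExt hθ hlk hp hf hf_pos hf_convex hf_bdry hh_C4 hh_pos hh_adm
    hh_sol hh_convex
  rw [CapillaryRank.inner_W hθ hh_C4 hξ]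
  exact hS.hes_pos (CapillaryRank.sub_center_mem_cone hξ)
    (Submodule.mem_orthogonal_singleton_iff_inner_left.1 v.2) (by simpa using hv)
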